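/- **Setting.** Write $\partial_i=\partial_{x^i}$. For constants $C_{ij}{}^k=C_{ji}{}^k$ ($i,j,k\in\{1,2\}$) let $\mathcal{M}(C)$ be the affine surface $(\mathbb{R}^+\times\mathbb{R},\nabla)$ with $\nabla_{\partial_i}\partial_j=(x^1)^{-1}C_{ij}{}^k\partial_k$, $x^1>0$; let $\mathcal{F}^{\mathcal{B}}$ be the family of those $\mathcal{M}(C)$ which are not flat. Let $\mathfrak{K}(\mathcal{M})$ be the real Lie algebra of smooth vector fields $X$ on $\mathbb{R}^+\times\mathbb{R}$ with $[X,\nabla_YZ]-\nabla_Y[X,Z]-\nabla_{[X,Y]}Z=0$ for all smooth $Y,Z$ (affine Killing vector fields), and let $\mathfrak{K}_0^{\mathcal{B}}=\operatorname{Span}\{x^1\partial_1+x^2\partial_2,\ \partial_2\}$. The Ricci tensor is $\rho(\xi_1,\xi_2)=\operatorname{Tr}\{\xi_3\mapsto R(\xi_3,\xi_1)\xi_2\}$. Two surfaces $\mathcal{M}(C)$, $\mathcal{M}(\tilde C)$ are *linearly equivalent* if some map $(x^1,x^2)\mapsto(tx^1,ux^1+vx^2+w)$ with $t>0$, $v\neq0$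 carries one connection to the other. An affine surface is of *Type $\mathcal{A}$* if it is locally homogeneous, not flat, and near every point has coordinates in which the Christoffel symbols are constant; it is of *Type $\mathcal{C}$* if it is locally homogeneous, not flat, and $\nabla$ is the Levi-Civita connection of a pseudo-Riemannian metric of constant sectional curvature. When we say below that a surface is not of Type $\mathcal{A}$ (or $\mathcal{C}$), we mean that no non-empty open subset of it is. Let $\mathfrak{su}(1,1)$ be the Lie algebra of $SU(1,1)$. Listing $C=(C_{11}{}^1,C_{11}{}^2,C_{12}{}^1,C_{12}{}^2,C_{22}{}^1,C_{22}{}^2)$, set $$\mathcal{N}_1^\pm=\mathcal{M}(-\tfrac32,0,0,-\tfrac12,\mp\tfrac12,0),\qquad \mathcal{N}_2^c=\mathcal{M}(-\tfrac32,0,1,-\tfrac12,c,2)\ (c\in\mathbb{R}),$$ $$\mathcal{N}_3=\mathcal{M}(-1,0,0,-1,-1,0),\qquad \mathcal{N}_4=\mathcal{M}(-1,0,0,-1,1,0).$$ **Theorem 3.11.** If $\mathcal{M}=\mathcal{M}(C)\in\mathcal{F}^{\mathcal{B}}$, then $2\le\dim\mathfrak{K}(\mathcal{M})\le4$. 1.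 If $\dim\mathfrak{K}(\mathcal{M})=4$, then $C_{12}{}^1=C_{22}{}^1=C_{22}{}^2=0$, $\mathcal{M}$ is also of Type $\mathcal{A}$, $\rho=(x^1)^{-2}\tilde\rho_{11}\,dx^1\otimes dx^1$ for a constant $\tilde\rho_{11}$, and $\mathcal{M}$ is linearly equivalent to a surface with $C_{12}{}^1=C_{22}{}^1=C_{22}{}^2=0$ and with the same constant $\tilde\rho_{11}$ in its Ricci tensor, for which one of the following holds: (a) $C_{11}{}^1-2C_{12}{}^2=0$, $C_{11}{}^2=1$, $\tilde\rho_{11}=(1+C_{12}{}^2)C_{12}{}^2\ne0$, and $\mathfrak{K}=\operatorname{Span}\{x^1\partial_1-x^1\log(x^1)\partial_2,\ x^1\partial_2\}\oplus\mathfrak{K}_0^{\mathcal{B}}$; (b) $C_{11}{}^2=0$, $\tilde\rho_{11}=(1+C_{11}{}^1-C_{12}{}^2)C_{12}{}^2\ne0$, $a:=1+C_{11}{}^1-2C_{12}{}^2\ne0$, and $\mathfrak{K}=\operatorname{Span}\{x^1\partial_1,\ (x^1)^a\partial_2\}\oplus\mathfrak{K}_0^{\mathcal{B}}$; (c) $C_{11}{}^2=0$,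 $1+C_{11}{}^1-2C_{12}{}^2=0$, $\tilde\rho_{11}=(C_{12}{}^2)^2\ne0$, and $\mathfrak{K}=\operatorname{Span}\{x^1\partial_1,\ \log(x^1)\partial_2\}\oplus\mathfrak{K}_0^{\mathcal{B}}$. 2. If $\dim\mathfrak{K}(\mathcal{M})=3$, then $\mathfrak{K}(\mathcal{M})\cong\mathfrak{su}(1,1)$, $\mathcal{M}$ is not of Type $\mathcal{A}$, and $\mathcal{M}$ is linearly equivalent to a surface $\mathcal{N}$ with $\mathfrak{K}(\mathcal{N})=\operatorname{Span}\{X(\sigma)\}\oplus\mathfrak{K}_0^{\mathcal{B}}$, where $X(\sigma)=2x^1x^2\partial_1+\{(x^2)^2+\sigma(x^1)^2\}\partial_2$, such that one of the following holds: (a) $\sigma=0$, $\mathcal{N}=\mathcal{N}_1^+$ or $\mathcal{N}=\mathcal{N}_1^-$, and $\mathcal{M}$ is not of Type $\mathcal{C}$; (b) $\sigma=0$, $\mathcal{N}=\mathcal{N}_2^c$ for some $c\in\mathbb{R}$, and $\mathcal{M}$ is not of Type $\mathcal{C}$; (c) $\sigma=1$, $\mathcal{N}=\mathcal{N}_3$,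 and $\mathcal{M}$ is of Type $\mathcal{C}$; (d) $\sigma=-1$, $\mathcal{N}=\mathcal{N}_4$, and $\mathcal{M}$ is of Type $\mathcal{C}$. 3. Every $\mathcal{M}(C)$ with $C_{12}{}^1=C_{22}{}^1=C_{22}{}^2=0$ whose coefficients satisfy the conditions on $C$ in (a), (b) or (c) of part 1, including that the stated value of $\tilde\rho_{11}$ is non-zero, has $\dim\mathfrak{K}=4$. Each of $\mathcal{N}_1^\pm$, $\mathcal{N}_2^c$ ($c\in\mathbb{R}$), $\mathcal{N}_3$, $\mathcal{N}_4$ has $\dim\mathfrak{K}=3$; $\mathcal{N}_3$ and $\mathcal{N}_4$ are of Type $\mathcal{C}$, while $\mathcal{N}_1^\pm$ and $\mathcal{N}_2^c$ are not. -/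

import Mathlib

open scoped ContDiff
open TopologicalSpace

/-! # Affine surfaces in one coordinate patch

An affine surface is an open subset `M.U` of `ℝ²` with a torsion free connection, given by its
Christoffel symbols in the standard coordinates `(x¹, x²) = (x 0, x 1)`. -/

/-- Points, and tangent vectors, of the coordinate plane. -/
abbrev Plane : Type := Fin 2 → ℝ

/-- The coordinate vector field `∂_i` (index `0` is `∂₁`, index `1` is `∂₂`). -/
def coordField (i : Fin 2) : Plane → Plane := fun _ => Pi.single i 1

/-- Smooth vector fields on the open set `U`. They are stored as maps on the whole plane which
are smooth on `U` and are extended by zero outside `U`, so that equality is equality on `U`. -/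
def smoothVF (U : Opens Plane) : Submodule ℝ (Plane → Plane) where
  carrier := {X | ContDiffOn ℝ ∞ X U ∧ ∀ p, p ∉ U → X p = 0}
  add_mem' := by
    rintro X Y ⟨hX, hX'⟩ ⟨hY, hY'⟩
    exact ⟨hX.add hY, fun p hp => by simp [hX' p hp, hY' p hp]⟩
  zero_mem' := ⟨contDiffOn_const, fun _ _ => rfl⟩
  smul_mem' := by
    rintro c X ⟨hX, hX'⟩
    exact ⟨contDiffOn_const.smul hX, fun p hp => by simp [hX' p hp]⟩

namespace SmoothVF

variable {U : Opens Plane}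

theorem contDiffAt (X : smoothVF U) {p : Plane} (hp : p ∈ U) : ContDiffAt ℝ ∞ X.1 p :=
  X.2.1.contDiffAt (U.isOpen.mem_nhds hp)

theorem differentiableAt (X : smoothVF U) {p : Plane} (hp : p ∈ U) :
    DifferentiableAt ℝ X.1 p :=
  (contDiffAt X hp).differentiableAt (by simp)

theorem eq_zero (X : smoothVF U) {p : Plane} (hp : p ∉ U) : X.1 p = 0 := X.2.2 p hp

theorem ext_on {X Y : smoothVF U} (h : ∀ p ∈ U, X.1 p = Y.1 p) : X = Y := by
  apply Subtype.ext
  funext p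
  by_cases hp : p ∈ U
  · exact h p hp
  · rw [eq_zero X hp, eq_zero Y hp]

/-- The Lie bracket of vector fields on `U` is Mathlib's `VectorField.lieBracket`. -/
noncomputable instance : Bracket (smoothVF U) (smoothVF U) where
  bracket X Y := ⟨VectorField.lieBracket ℝ X.1 Y.1,
    fun p hp => ((contDiffAt X hp).lieBracket_vectorField (contDiffAt Y hp)
      (by simp)).contDiffWithinAt,
    fun _ hp => VectorField.lieBracket_eq_zero_of_eq_zero (eq_zero X hp) (eq_zero Y hp)⟩

theorem bracket_apply (X Y : smoothVF U) (p : Plane) :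
    (⁅X, Y⁆ : smoothVF U).1 p = VectorField.lieBracket ℝ X.1 Y.1 p := rfl

noncomputable instance : LieRing (smoothVF U) where
  add_lie X Y Z := ext_on fun p hp => by
    exact VectorField.lieBracket_add_left (differentiableAt X hp) (differentiableAt Y hp)
  lie_add X Y Z := ext_on fun p hp => by
    exact VectorField.lieBracket_add_right (differentiableAt Y hp) (differentiableAt Z hp)
  lie_self X := ext_on fun p _ => by
    simp [bracket_apply]
  leibniz_lie X Y Z := ext_on fun p hp => by
    have h := VectorField.leibniz_identity_lieBracket (𝕜 := ℝ) (n := ∞)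
      (by simpa using (WithTop.coe_le_coe.2 le_top : ((2 : ℕ∞) : ℕ∞ω) ≤ ∞))
      (contDiffAt X hp) (contDiffAt Y hp) (contDiffAt Z hp)
    exact h

noncomputable instance : LieAlgebra ℝ (smoothVF U) where
  lie_smul c X Y := ext_on fun p hp => by
    exact VectorField.lieBracket_const_smul_right (differentiableAt Y hp)

end SmoothVF

/-- An affine surface: an open set `U` of the plane with a torsion free connection,
`∇_{∂_i} ∂_j = ∑ k, Γ p i j k ∂_k`. -/
structure AffineSurface where
  U : Opens Plane
  Γ : Plane → Fin 2 → Fin 2 → Fin 2 → ℝ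
  smooth : ∀ i j k, ContDiffOn ℝ ∞ (fun p => Γ p i j k) U
  torsionFree : ∀ p ∈ U, ∀ i j k, Γ p i j k = Γ p j i k

namespace AffineSurface

variable (M : AffineSurface)

/-- The bilinear map `Γ_p(v, w) = Γ_{ij}^k v^i w^j ∂_k`. -/
def conn (p v w : Plane) : Plane := fun k => ∑ i, ∑ j, M.Γ p i j k * v i * w j

/-- The covariant derivative `∇_Y Z`. -/
noncomputable def nabla (Y Z : Plane → Plane) : Plane → Plane :=
  fun p => fderiv ℝ Z p (Y p) + M.conn p (Y p) (Z p)

/-- The curvature operator `R(X, Y) Z = ∇_X ∇_Y Z - ∇_Y ∇_X Z - ∇_{[X, Y]} Z`. -/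
noncomputable def curvature (X Y Z : Plane → Plane) : Plane → Plane :=
  M.nabla X (M.nabla Y Z) - M.nabla Y (M.nabla X Z) - M.nabla (VectorField.lieBracket ℝ X Y) Z

/-- The components `ρ_{ij} = ρ(∂_i, ∂_j)` of the Ricci tensor
`ρ(ξ₁, ξ₂) = Tr (ξ₃ ↦ R(ξ₃, ξ₁) ξ₂)`. -/
noncomputable def ricci (p : Plane) (i j : Fin 2) : ℝ :=
  ∑ k, M.curvature (coordField k) (coordField i) (coordField j) p k

/-- The connection is flat: its curvature tensor vanishes identically. -/
def IsFlat : Prop :=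
  ∀ p ∈ M.U, ∀ i j k, M.curvature (coordField i) (coordField j) (coordField k) p = 0

theorem contDiffOn_nabla (Y Z : smoothVF M.U) :
    ContDiffOn ℝ ∞ (M.nabla Y.1 Z.1) M.U := by
  have h1 : ContDiffOn ℝ ∞ (fun p => fderiv ℝ Z.1 p (Y.1 p)) M.U :=
    (Z.2.1.fderiv_of_isOpen M.U.isOpen (by simp)).clm_apply Y.2.1
  refine h1.add ?_
  rw [contDiffOn_pi]
  intro k
  have hY := contDiffOn_pi.1 Y.2.1
  have hZ := contDiffOn_pi.1 Z.2.1
  exact ContDiffOn.sum fun i _ => ContDiffOn.sum fun j _ =>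
    ((M.smooth i j k).mul (hY i)).mul (hZ j)

theorem nabla_eq_zero (Y Z : Plane → Plane) {p : Plane} (hp : Y p = 0) :
    M.nabla Y Z p = 0 := by
  ext k
  simp [nabla, conn, hp]

/-- The covariant derivative as an operation on smooth vector fields on `M.U`. -/
noncomputable def cov (Y Z : smoothVF M.U) : smoothVF M.U :=
  ⟨M.nabla Y.1 Z.1, M.contDiffOn_nabla Y Z,
    fun _ hp => M.nabla_eq_zero _ _ (SmoothVF.eq_zero Y hp)⟩

theorem cov_sub_right (Y Z Z' : smoothVF M.U) : M.cov Y (Z - Z') = M.cov Y Z - M.cov Y Z' := by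
  refine SmoothVF.ext_on fun p hp => ?_
  have h : fderiv ℝ (Z.1 - Z'.1) p = fderiv ℝ Z.1 p - fderiv ℝ Z'.1 p :=
    fderiv_sub (SmoothVF.differentiableAt Z hp) (SmoothVF.differentiableAt Z' hp)
  ext k
  change fderiv ℝ (Z.1 - Z'.1) p (Y.1 p) k + M.conn p (Y.1 p) (Z.1 p - Z'.1 p) k =
    (fderiv ℝ Z.1 p (Y.1 p) k + M.conn p (Y.1 p) (Z.1 p) k) -
      (fderiv ℝ Z'.1 p (Y.1 p) k + M.conn p (Y.1 p) (Z'.1 p) k)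
  rw [h]
  simp only [conn, sub_apply, Pi.sub_apply, Fin.sum_univ_two]
  ring

theorem cov_linear_left (a b : ℝ) (Y Y' Z : smoothVF M.U) :
    M.cov (a • Y + b • Y') Z = a • M.cov Y Z + b • M.cov Y' Z := by
  refine SmoothVF.ext_on fun p _ => ?_
  ext k
  change fderiv ℝ Z.1 p (a • Y.1 p + b • Y'.1 p) k +
      M.conn p (a • Y.1 p + b • Y'.1 p) (Z.1 p) k =
    a * (fderiv ℝ Z.1 p (Y.1 p) k + M.conn p (Y.1 p) (Z.1 p) k) +
      b * (fderiv ℝ Z.1 p (Y'.1 p) k + M.conn p (Y'.1 p) (Z.1 p) k)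
  simp only [conn, map_add, map_smul, Pi.add_apply, Pi.smul_apply, smul_eq_mul,
    Fin.sum_univ_two]
  ring

/-- `X` is an affine Killing vector field:
`[X, ∇_Y Z] - ∇_Y [X, Z] - ∇_{[X, Y]} Z = 0` for all smooth vector fields `Y`, `Z`. -/
def IsKilling (X : smoothVF M.U) : Prop :=
  ∀ Y Z : smoothVF M.U, ⁅X, M.cov Y Z⁆ - M.cov Y ⁅X, Z⁆ - M.cov ⁅X, Y⁆ Z = 0

/-- The Lie algebra `𝔎(M)` of affine Killing vector fields, under the Lie bracket. -/
noncomputable def killing : LieSubalgebra ℝ (smoothVF M.U) where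
  carrier := {X | M.IsKilling X}
  add_mem' := by
    intro X X' hX hX' Y Z
    have h1 := hX Y Z
    have h2 := hX' Y Z
    have e1 := M.cov_linear_left 1 1 ⁅X, Y⁆ ⁅X', Y⁆ Z
    have e2 := M.cov_sub_right Y ⁅X, Z⁆ (-⁅X', Z⁆)
    have e3 := M.cov_sub_right Y 0 ⁅X', Z⁆
    have e4 := M.cov_sub_right Y 0 0
    simp only [one_smul, sub_neg_eq_add, zero_sub, sub_self] at e1 e2 e3 e4
    rw [add_lie, add_lie, add_lie, e1, e2, e3, e4]
    have h12 := congrArg₂ (· + ·) h1 h2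
    simp only [add_zero] at h12
    refine Eq.trans ?_ h12
    abel
  zero_mem' := by
    intro Y Z
    have e1 := M.cov_linear_left 0 0 0 0 Z
    have e4 := M.cov_sub_right Y 0 0
    simp only [zero_smul, add_zero, sub_self] at e1 e4
    simp [e1, e4]
  smul_mem' := by
    intro a X hX Y Z
    have h1 := hX Y Z
    have e1 := M.cov_linear_left a 0 ⁅X, Y⁆ 0 Z
    have e2 : M.cov Y (a • ⁅X, Z⁆) = a • M.cov Y ⁅X, Z⁆ := by
      refine SmoothVF.ext_on fun p hp => ?_
      have h : fderiv ℝ (a • (⁅X, Z⁆ : smoothVF M.U).1) p =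
          a • fderiv ℝ (⁅X, Z⁆ : smoothVF M.U).1 p :=
        fderiv_const_smul (SmoothVF.differentiableAt _ hp) a
      ext k
      change fderiv ℝ (a • (⁅X, Z⁆ : smoothVF M.U).1) p (Y.1 p) k +
          M.conn p (Y.1 p) (a • (⁅X, Z⁆ : smoothVF M.U).1 p) k =
        a * (fderiv ℝ (⁅X, Z⁆ : smoothVF M.U).1 p (Y.1 p) k +
          M.conn p (Y.1 p) ((⁅X, Z⁆ : smoothVF M.U).1 p) k)
      rw [h]
      simp only [conn, smul_apply, Pi.smul_apply, smul_eq_mul, Fin.sum_univ_two]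
      ring
    simp only [smul_zero, zero_smul, add_zero] at e1
    rw [smul_lie, smul_lie, smul_lie, e1, e2, ← smul_sub, ← smul_sub, h1, smul_zero]
  lie_mem' := by
    intro X X' hX hX' Y Z
    have key : ∀ {W : smoothVF M.U}, M.IsKilling W → ∀ Y Z,
        ⁅W, M.cov Y Z⁆ = M.cov Y ⁅W, Z⁆ + M.cov ⁅W, Y⁆ Z := by
      intro W hW Y Z
      have h := hW Y Z
      rw [sub_sub, sub_eq_zero] at h
      exact h
    have e1 := M.cov_linear_left 1 (-1) ⁅X, ⁅X', Y⁆⁆ ⁅X', ⁅X, Y⁆⁆ Z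
    simp only [one_smul, neg_smul, ← sub_eq_add_neg] at e1
    rw [lie_lie, lie_lie, lie_lie, e1, M.cov_sub_right, key hX', key hX, lie_add, lie_add,
      key hX, key hX, key hX', key hX']
    abel

/-- `𝔎(M)` as a space of maps (extended by zero outside `M.U`). -/
noncomputable def killingSpace : Submodule ℝ (Plane → Plane) :=
  M.killing.toSubmodule.map (smoothVF M.U).subtype

/-- The restriction of `M` to an open subset `V`. -/
def restrict (V : Opens Plane) (hV : V ≤ M.U) : AffineSurface where
  U := V
  Γ := M.Γ
  smooth i j k := (M.smooth i j k).mono hV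
  torsionFree p hp := M.torsionFree p (hV hp)

/-- The smooth map `f`, defined on `V`, maps the connection of `M` to that of `N`, i.e.
`f_* (∇_v w) = ∇'_v (f_* w)` for constant `v`, `w`; in coordinates this is the transformation law
`∂_i∂_j f^k + Γ'_{ab}^k(f) ∂_i f^a ∂_j f^b = Γ_{ij}^l ∂_l f^k`. -/
def IsAffineMap (M N : AffineSurface) (f : Plane → Plane) (V : Set Plane) : Prop :=
  ∀ p ∈ V, ∀ v w : Plane,
    fderiv ℝ (fun q => fderiv ℝ f q w) p v + N.conn (f p) (fderiv ℝ f p v) (fderiv ℝ f p w) =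
      fderiv ℝ f p (M.conn p v w)

/-- A diffeomorphism from an open subset of `M` to an open subset of `N` which maps the
connection of `M` to that of `N`. -/
structure IsLocalIso (M N : AffineSurface) (φ : OpenPartialHomeomorph Plane Plane) : Prop where
  source_subset : φ.source ⊆ M.U
  target_subset : φ.target ⊆ N.U
  smooth : ContDiffOn ℝ ∞ φ φ.source
  smooth_symm : ContDiffOn ℝ ∞ φ.symm φ.target
  affine : IsAffineMap M N φ φ.source

/-- Locally homogeneous: any two points are related by the germ of an affine diffeomorphism. -/
def IsLocallyHomogeneous : Prop :=
  ∀ p ∈ M.U, ∀ q ∈ M.U, ∃ φ : OpenPartialHomeomorph Plane Plane,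
    IsLocalIso M M φ ∧ p ∈ φ.source ∧ φ p = q

end AffineSurface

/-- An array of constants `c i j k = C_{ij}^k` with `C_{ij}^k = C_{ji}^k`. -/
structure Coeffs where
  c : Fin 2 → Fin 2 → Fin 2 → ℝ
  symm : ∀ i j k, c i j k = c j i k

/-- The array with `C₁₁¹ = a`, `C₁₁² = b`, `C₁₂¹ = C₂₁¹ = c`, `C₁₂² = C₂₁² = d`, `C₂₂¹ = e`,
`C₂₂² = f`. -/
def Coeffs.mk6 (a b c d e f : ℝ) : Coeffs where
  c i j := ![![![a, b], ![c, d]], ![![c, d], ![e, f]]] i j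
  symm i j k := by fin_cases i <;> fin_cases j <;> rfl

/-- The half plane `ℝ⁺ × ℝ`. -/
def halfPlane : Opens Plane :=
  ⟨{x | 0 < x 0}, isOpen_lt continuous_const (continuous_apply 0)⟩

namespace AffineSurface

/-- `ℝ²` with constant Christoffel symbols. -/
def modelA (C : Coeffs) : AffineSurface where
  U := ⊤
  Γ _ := C.c
  smooth _ _ _ := contDiffOn_const
  torsionFree _ _ := C.symm

/-- `ℝ⁺ × ℝ` with Christoffel symbols `Γ_{ij}^k = (x¹)⁻¹ C_{ij}^k`. -/
noncomputable def modelB (C : Coeffs) : AffineSurface where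
  U := halfPlane
  Γ p i j k := (p 0)⁻¹ * C.c i j k
  smooth i j k := by
    have h : ContDiffOn ℝ ∞ (fun p : Plane => p 0) halfPlane := (contDiff_apply ℝ ℝ 0).contDiffOn
    exact (h.inv fun p hp => ne_of_gt hp).mul contDiffOn_const
  torsionFree p _ i j k := by rw [C.symm]

variable (M : AffineSurface)

/-- Type `𝒜`: locally homogeneous, not flat, and near every point there are local coordinates in
which the Christoffel symbols are constant. -/
def IsTypeA : Prop :=
  M.IsLocallyHomogeneous ∧ ¬ M.IsFlat ∧
    ∀ p ∈ M.U, ∃ (C : Coeffs) (φ : OpenPartialHomeomorph Plane Plane),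
      p ∈ φ.source ∧ IsLocalIso M (modelA C) φ

/-- `g` is a smooth pseudo-Riemannian metric on `M.U`. -/
structure IsMetric (g : Plane → Matrix (Fin 2) (Fin 2) ℝ) : Prop where
  smooth : ∀ i j, ContDiffOn ℝ ∞ (fun p => g p i j) M.U
  symm : ∀ p ∈ M.U, (g p).IsSymm
  nondegenerate : ∀ p ∈ M.U, (g p).det ≠ 0

/-- The (torsion free) connection of `M` is the Levi-Civita connection of `g`: `∇ g = 0`. -/
def IsLeviCivita (g : Plane → Matrix (Fin 2) (Fin 2) ℝ) : Prop :=
  ∀ p ∈ M.U, ∀ i j k, fderiv ℝ (fun q => g q i j) p (Pi.single k 1) =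
    ∑ l, (M.Γ p k i l * g p l j + M.Γ p k j l * g p i l)

/-- The curvature of `M` is that of constant sectional curvature `κ` with respect to `g`:
`R(X, Y) Z = κ (g(Y, Z) X - g(X, Z) Y)`. -/
def HasConstantCurvature (g : Plane → Matrix (Fin 2) (Fin 2) ℝ) (κ : ℝ) : Prop :=
  ∀ p ∈ M.U, ∀ i j k, M.curvature (coordField i) (coordField j) (coordField k) p =
    κ • (g p j k • coordField i p - g p i k • coordField j p)

/-- Type `𝒞`: locally homogeneous, not flat, and `∇` is the Levi-Civita connection of a
pseudo-Riemannian metric of constant sectional curvature. -/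
def IsTypeC : Prop :=
  M.IsLocallyHomogeneous ∧ ¬ M.IsFlat ∧
    ∃ g κ, M.IsMetric g ∧ M.IsLeviCivita g ∧ M.HasConstantCurvature g κ

/-- No non-empty open part of `M` is of Type `𝒜`. -/
def NowhereTypeA : Prop :=
  ∀ (V : Opens Plane) (hV : V ≤ M.U), (V : Set Plane).Nonempty → ¬ (M.restrict V hV).IsTypeA

/-- No non-empty open part of `M` is of Type `𝒞`. -/
def NowhereTypeC : Prop :=
  ∀ (V : Opens Plane) (hV : V ≤ M.U), (V : Set Plane).Nonempty → ¬ (M.restrict V hV).IsTypeC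

end AffineSurface

namespace TypeB

open AffineSurface

/-- The group of maps `(x¹, x²) ↦ (t x¹, u x¹ + v x² + w)`, with `t > 0` and `v ≠ 0`, consists of
the affine maps which preserve `ℝ⁺ × ℝ`. -/
def shear (t u v w : ℝ) : Plane → Plane := fun x => ![t * x 0, u * x 0 + v * x 1 + w]

/-- Linear equivalence of `(ℝ⁺ × ℝ, (x¹)⁻¹ C)` and `(ℝ⁺ × ℝ, (x¹)⁻¹ C')`. -/
def LinEquiv (C C' : Coeffs) : Prop :=
  ∃ t u v w : ℝ, 0 < t ∧ v ≠ 0 ∧ IsAffineMap (modelB C) (modelB C') (shear t u v w) halfPlane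

/-- The vector field `f¹ ∂₁ + f² ∂₂` on `ℝ⁺ × ℝ`, extended by zero. -/
noncomputable def field (f : Plane → Plane) : Plane → Plane :=
  (halfPlane : Set Plane).indicator f

/-- `𝔎₀ = Span {x¹ ∂₁ + x² ∂₂, ∂₂}`. -/
noncomputable def K0 : Submodule ℝ (Plane → Plane) :=
  Submodule.span ℝ {field fun x => ![x 0, x 1], field fun _ => ![0, 1]}

/-- `𝔎` is the direct sum of the span of `S` and of `𝔎₀`. -/
def KillingIs (C : Coeffs) (S : Set (Plane → Plane)) : Prop :=
  (modelB C).killingSpace = Submodule.span ℝ S ⊔ K0 ∧ Disjoint (Submodule.span ℝ S) K0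

/-- `X(σ) = 2 x¹ x² ∂₁ + ((x²)² + σ (x¹)²) ∂₂`. -/
noncomputable def Xfield (σ : ℝ) : Plane → Plane :=
  field fun x => ![2 * x 0 * x 1, x 1 ^ 2 + σ * x 0 ^ 2]

/-- The dimension of `𝔎`. -/
noncomputable def dimK (C : Coeffs) : ℕ := Module.finrank ℝ (modelB C).killing

/-- The Ricci tensor is `ρ = (x¹)⁻² r dx¹ ⊗ dx¹`. -/
def RicciIs (C : Coeffs) (r : ℝ) : Prop :=
  ∀ p ∈ halfPlane, ∀ i j, (modelB C).ricci p i j = if i = 0 ∧ j = 0 then (p 0 ^ 2)⁻¹ * r else 0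

/-- `C₁₂¹ = C₂₂¹ = C₂₂² = 0`. -/
def Vanishing (C : Coeffs) : Prop := C.c 0 1 0 = 0 ∧ C.c 1 1 0 = 0 ∧ C.c 1 1 1 = 0

/-- First normal form: `C₁₁¹ - 2 C₁₂² = 0`, `C₁₁² = 1`, `r = (1 + C₁₂²) C₁₂² ≠ 0`. -/
def Form1 (C : Coeffs) (r : ℝ) : Prop :=
  Vanishing C ∧ C.c 0 0 0 - 2 * C.c 0 1 1 = 0 ∧ C.c 0 0 1 = 1 ∧
    r = (1 + C.c 0 1 1) * C.c 0 1 1 ∧ r ≠ 0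

/-- Second normal form: `C₁₁² = 0`, `r = (1 + C₁₁¹ - C₁₂²) C₁₂² ≠ 0`, and
`a = 1 + C₁₁¹ - 2 C₁₂² ≠ 0`. -/
def Form2 (C : Coeffs) (r a : ℝ) : Prop :=
  Vanishing C ∧ C.c 0 0 1 = 0 ∧ r = (1 + C.c 0 0 0 - C.c 0 1 1) * C.c 0 1 1 ∧ r ≠ 0 ∧
    a = 1 + C.c 0 0 0 - 2 * C.c 0 1 1 ∧ a ≠ 0

/-- Third normal form: `C₁₁² = 0`, `1 + C₁₁¹ - 2 C₁₂² = 0`, `r = (C₁₂²)² ≠ 0`. -/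
def Form3 (C : Coeffs) (r : ℝ) : Prop :=
  Vanishing C ∧ C.c 0 0 1 = 0 ∧ 1 + C.c 0 0 0 - 2 * C.c 0 1 1 = 0 ∧ r = C.c 0 1 1 ^ 2 ∧ r ≠ 0

/-- `𝒩₁⁺`. -/
noncomputable def N1plus : Coeffs := Coeffs.mk6 (-3 / 2) 0 0 (-1 / 2) (-1 / 2) 0

/-- `𝒩₁⁻`. -/
noncomputable def N1minus : Coeffs := Coeffs.mk6 (-3 / 2) 0 0 (-1 / 2) (1 / 2) 0

/-- `𝒩₂^c`. -/
noncomputable def N2 (c : ℝ) : Coeffs := Coeffs.mk6 (-3 / 2) 0 1 (-1 / 2) c 2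

/-- `𝒩₃`. -/
noncomputable def N3 : Coeffs := Coeffs.mk6 (-1) 0 0 (-1) (-1) 0

/-- `𝒩₄`. -/
noncomputable def N4 : Coeffs := Coeffs.mk6 (-1) 0 0 (-1) 1 0

end TypeB

section SU

attribute [local instance] LieRing.ofAssociativeRing

/-- The real Lie algebra `𝔰𝔲(1,1)` of trace free complex matrices `A` with `A* J + J A = 0`, where
`J = diag(1, -1)`, under the commutator bracket. -/
noncomputable def su11 : LieSubalgebra ℝ (Matrix (Fin 2) (Fin 2) ℂ) where
  carrier := {A | A.trace = 0 ∧
    A.conjTranspose * Matrix.diagonal ![1, -1] + Matrix.diagonal ![1, -1] * A = 0}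
  add_mem' := by
    rintro A B ⟨hA, hA'⟩ ⟨hB, hB'⟩
    refine ⟨by rw [Matrix.trace_add, hA, hB, add_zero], ?_⟩
    rw [Matrix.conjTranspose_add, add_mul, mul_add, add_add_add_comm, hA', hB', add_zero]
  zero_mem' := by simp
  smul_mem' := by
    rintro t A ⟨hA, hA'⟩
    refine ⟨by rw [Matrix.trace_smul, hA, smul_zero], ?_⟩
    rw [Matrix.conjTranspose_smul, star_trivial, smul_mul_assoc, mul_smul_comm, ← smul_add, hA',
      smul_zero]
  lie_mem' := by
    rintro A B ⟨_, hA⟩ ⟨_, hB⟩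
    rw [add_eq_zero_iff_eq_neg] at hA hB
    refine ⟨by rw [Ring.lie_def, Matrix.trace_sub, Matrix.trace_mul_comm, sub_self], ?_⟩
    rw [Ring.lie_def, Matrix.conjTranspose_sub, Matrix.conjTranspose_mul, Matrix.conjTranspose_mul,
      sub_mul, mul_assoc, mul_assoc, hA, hB, mul_neg, mul_neg, ← mul_assoc, ← mul_assoc, hA, hB]
    noncomm_ring

noncomputable instance : LieRing su11 := LieSubalgebra.lieRing ℝ _ su11

noncomputable instance : LieAlgebra ℝ su11 := LieSubalgebra.lieAlgebra ℝ _ su11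

end SU

open AffineSurface TypeB

/-! Written in coordinates, the condition L_X ∇ = 0 expresses the second derivatives of a Killing
field X linearly through its value and its first derivatives. Hence X is determined by its 1-jet at
one point (`eq_zero_of_jet_eq_zero`), 𝔎 embeds in ℝ⁶, and statements about Killing fields become
polynomial algebra in the six constants C and the jet at (1, 0). Two Killing fields are always
present: E = x¹∂₁ + x²∂₂ (`eulerVF`) and T = ∂₂ (`transVF`), with [E, T] = -T. This relation makes
ad T nilpotent on the finite-dimensional space 𝔎, so 𝔎 can be built up from ker ad T by solving [T,
X] = Y again and again (`killing_induction`).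

Suppose that C₁₂¹, C₂₂¹, C₂₂² do not all vanish. Non-flatness then forces ker ad T = ℝT
(`eq_smul_transVF`), so 𝔎 is a single chain for ad T. It begins with T, E; it may contain a third
field X, normalised by [T, X] = 2E and [E, X] = X (`IsSpecial`); it has no fourth
(`IsSpecial.not_trans_eq`). The dimension is thus 2 or 3, and in the latter case the brackets are
those of 𝔰𝔲(1,1). With (α, σ) the value of X at (1, 0), the shear x² ↦ x² + (α/2)x¹ turns X into
X(s), s = σ + α²/4, and C₁₂¹ into t = C₁₂¹ - (α/2)C₂₂¹. The Killing equations imply s t = 0 and s (s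
C₂₂¹ + 1) = 0, and rescaling x² leads to the list 𝒩₁, ..., 𝒩₄.

Suppose that the three constants vanish. Then ρ = r (x¹)⁻² dx¹ ⊗ dx¹ with r ≠ 0. The integrability
conditions of the Killing system, divided by r, are two independent linear relations on the 1-jet
(`jet_relations_of_vanishing`), so the dimension is at most 4. Two further fields, found from linear
ODEs in x¹, show that it is 4. A shear together with a scaling of x² moves only C₁₁², which can be
made 0 or 1.

For the types, ρ and ∇ρ are affine invariants, and in dimension two ρ determines the curvature. If
the Christoffel symbols are constant, then ρ is symmetric, ∇ρ annihilates ker ρ, and ∇ρ ≠ 0 when ρ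
is non-degenerate (`not_obstructsTypeA`); each 𝒩 violates one of the three. Constant sectional
curvature gives ρ = κ g, so ρ is symmetric and either zero or non-degenerate, which fails for 𝒩₁ and
𝒩₂. For 𝒩₃ and 𝒩₄ the Ricci tensor is itself a parallel metric. -/

/-! ### The bilinear map of an array of constants -/

/-- The bilinear map `(v, w) ↦ C_{ij}^k v^i w^j ∂_k`. -/
noncomputable def Coeffs.bil (C : Coeffs) : Plane →L[ℝ] Plane →L[ℝ] Plane :=
  LinearMap.toContinuousLinearMap
    { toFun := fun v => LinearMap.toContinuousLinearMap
        { toFun := fun w k => ∑ i, ∑ j, C.c i j k * v i * w j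
          map_add' := by
            intro w w'; ext k; simp only [Pi.add_apply, Fin.sum_univ_two]; ring
          map_smul' := by
            intro a w; ext k
            simp only [Pi.smul_apply, smul_eq_mul, RingHom.id_apply, Fin.sum_univ_two]; ring }
      map_add' := by
        intro v v'; ext w k
        simp only [LinearMap.coe_toContinuousLinearMap', LinearMap.coe_mk, AddHom.coe_mk,
          add_apply, Pi.add_apply, Fin.sum_univ_two]; ring
      map_smul' := by
        intro a v; ext w k
        simp only [LinearMap.coe_toContinuousLinearMap', LinearMap.coe_mk, AddHom.coe_mk,
          smul_apply, Pi.smul_apply, smul_eq_mul, RingHom.id_apply,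
          Fin.sum_univ_two]; ring }

theorem Coeffs.bil_apply (C : Coeffs) (v w : Plane) (k : Fin 2) :
    C.bil v w k = C.c 0 0 k * v 0 * w 0 + C.c 0 1 k * (v 0 * w 1 + v 1 * w 0) +
      C.c 1 1 k * v 1 * w 1 := by
  have h : C.bil v w k = ∑ i, ∑ j, C.c i j k * v i * w j := rfl
  rw [h, Fin.sum_univ_two, Fin.sum_univ_two, Fin.sum_univ_two, C.symm 1 0 k]
  ring

theorem Coeffs.bil_comm (C : Coeffs) (v w : Plane) : C.bil v w = C.bil w v := by
  ext k; rw [C.bil_apply, C.bil_apply]; ring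

theorem conn_modelB (C : Coeffs) (p v w : Plane) :
    (modelB C).conn p v w = (p 0)⁻¹ • C.bil v w := by
  ext k
  change ∑ i, ∑ j, (p 0)⁻¹ * C.c i j k * v i * w j = (p 0)⁻¹ * ∑ i, ∑ j, C.c i j k * v i * w j
  simp only [Fin.sum_univ_two]; ring

theorem conn_modelA (C : Coeffs) (p v w : Plane) :
    (modelA C).conn p v w = C.bil v w := rfl

theorem mem_halfPlane {p : Plane} : p ∈ halfPlane ↔ 0 < p 0 := Iff.rfl

theorem hasFDerivAt_inv_fst {p : Plane} (hp : p ∈ halfPlane) :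
    HasFDerivAt (fun q : Plane => (q 0)⁻¹)
      ((-(p 0 ^ 2)⁻¹) • (ContinuousLinearMap.proj 0 : Plane →L[ℝ] ℝ)) p := by
  have h := (hasDerivAt_inv (ne_of_gt (mem_halfPlane.1 hp))).hasFDerivAt.comp p
    (ContinuousLinearMap.proj (R := ℝ) (φ := fun _ : Fin 2 => ℝ) 0).hasFDerivAt
  refine h.congr_fderiv ?_
  ext v
  simp [mul_comm]

/-- `-D²X (v, w)`, as it is determined by the first derivatives of a Killing field. -/
noncomputable def killingRHS (C : Coeffs) (p x : Plane) (A : Plane →L[ℝ] Plane) (v w : Plane) :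
    Plane :=
  (p 0)⁻¹ • (C.bil (A v) w + C.bil v (A w) - A (C.bil v w)) - ((p 0 ^ 2)⁻¹ * x 0) • C.bil v w

theorem differentiableAt_fderiv_vf {U : Opens Plane} (X : smoothVF U) {p : Plane} (hp : p ∈ U) :
    DifferentiableAt ℝ (fderiv ℝ X.1) p :=
  ((SmoothVF.contDiffAt X hp).fderiv_right (m := ∞) (by simp)).differentiableAt (by simp)

/-- The left side is the Lie derivative of ∇ along X, evaluated on Y and Z. It is tensorial: all
derivatives of Y and Z cancel, those of second order by the symmetry `hs` of D²Z. -/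
theorem killing_defect (C : Coeffs) (X Y Z : smoothVF (modelB C).U) {p : Plane}
    (hp : p ∈ (modelB C).U) :
    (⁅X, (modelB C).cov Y Z⁆ - (modelB C).cov Y ⁅X, Z⁆ - (modelB C).cov ⁅X, Y⁆ Z : 
      smoothVF (modelB C).U).1 p =
    fderiv ℝ (fderiv ℝ X.1) p (Y.1 p) (Z.1 p) +
      killingRHS C p (X.1 p) (fderiv ℝ X.1 p) (Y.1 p) (Z.1 p) := by
  have hX := (SmoothVF.differentiableAt X hp).hasFDerivAt
  have hY := (SmoothVF.differentiableAt Y hp).hasFDerivAt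
  have hZ := (SmoothVF.differentiableAt Z hp).hasFDerivAt
  have hX2 := (differentiableAt_fderiv_vf X hp).hasFDerivAt
  have hZ2 := (differentiableAt_fderiv_vf Z hp).hasFDerivAt
  have e0 : (modelB C).nabla Y.1 Z.1 =
      fun q => fderiv ℝ Z.1 q (Y.1 q) + (q 0)⁻¹ • C.bil (Y.1 q) (Z.1 q) :=
    funext fun q => by rw [nabla, conn_modelB]
  have h3 := C.bil.hasFDerivAt_of_bilinear hY hZ
  have h4 := (hasFDerivAt_inv_fst hp).fun_smul h3
  have h1 := (hZ2.clm_apply hY).fun_add h4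
  rw [← e0] at h1
  have h2 : HasFDerivAt (VectorField.lieBracket ℝ X.1 Z.1) _ p :=
    (hZ2.clm_apply hX).sub (hX2.clm_apply hZ)
  have hs : fderiv ℝ (fderiv ℝ Z.1) p (X.1 p) (Y.1 p) =
      fderiv ℝ (fderiv ℝ Z.1) p (Y.1 p) (X.1 p) :=
    (SmoothVF.contDiffAt Z hp).isSymmSndFDerivAt (by
      simpa using (WithTop.coe_le_coe.2 le_top : ((2 : ℕ∞) : ℕ∞ω) ≤ ∞)) _ _
  have e : (⁅X, (modelB C).cov Y Z⁆ - (modelB C).cov Y ⁅X, Z⁆ - (modelB C).cov ⁅X, Y⁆ Z : 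
      smoothVF (modelB C).U).1 p =
      (fderiv ℝ ((modelB C).nabla Y.1 Z.1) p (X.1 p) -
        fderiv ℝ X.1 p (fderiv ℝ Z.1 p (Y.1 p) + (modelB C).conn p (Y.1 p) (Z.1 p))) -
      (fderiv ℝ (VectorField.lieBracket ℝ X.1 Z.1) p (Y.1 p) +
        (modelB C).conn p (Y.1 p) (fderiv ℝ Z.1 p (X.1 p) - fderiv ℝ X.1 p (Z.1 p))) -
      (fderiv ℝ Z.1 p (fderiv ℝ Y.1 p (X.1 p) - fderiv ℝ X.1 p (Y.1 p)) +
        (modelB C).conn p (fderiv ℝ Y.1 p (X.1 p) - fderiv ℝ X.1 p (Y.1 p)) (Z.1 p)) := rfl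
  rw [e, h1.fderiv, h2.fderiv]
  simp only [conn_modelB, killingRHS, add_apply, sub_apply, smul_apply,
    ContinuousLinearMap.smulRight_apply, ContinuousLinearMap.comp_apply,
    ContinuousLinearMap.flip_apply, map_add, map_sub, map_smul, smul_eq_mul,
    ContinuousLinearMap.proj_apply, ContinuousLinearMap.precompR_apply,
    ContinuousLinearMap.precompL_apply, ContinuousLinearMap.compL_apply, hs]
  module

/-- Since only the values of Y and Z at p enter the defect, fields constant on the half plane
suffice as test fields. -/
theorem isKilling_iff (C : Coeffs) (X : smoothVF (modelB C).U) :
    (modelB C).IsKilling X ↔ ∀ p ∈ halfPlane, ∀ v w,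
      fderiv ℝ (fderiv ℝ X.1) p v w = -killingRHS C p (X.1 p) (fderiv ℝ X.1 p) v w := by
  constructor
  · intro h p hp v w
    have hc : ∀ u : Plane, ContDiffOn ℝ ∞ ((halfPlane : Set Plane).indicator fun _ => u)
        halfPlane := fun u => contDiffOn_const.congr fun q hq => Set.indicator_of_mem hq _
    let V : Plane → smoothVF (modelB C).U := fun u =>
      ⟨(halfPlane : Set Plane).indicator fun _ => u, hc u,
        fun q hq => Set.indicator_of_notMem hq _⟩
    have hV : ∀ u, (V u).1 p = u := by
      intro u
      exact Set.indicator_of_mem (s := (halfPlane : Set Plane)) hp fun _ => u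
    have := killing_defect C X (V v) (V w) hp
    rw [hV, hV, h (V v) (V w)] at this
    rw [eq_neg_iff_add_eq_zero]
    exact this.symm
  · intro h Y Z
    refine SmoothVF.ext_on fun p hp => ?_
    have := killing_defect C X Y Z hp
    rw [h p hp, neg_add_cancel] at this
    exact this

/-! ### Explicit vector fields -/

/-- The smooth vector field on the half plane given by a map which is smooth there. -/
noncomputable def vf (C : Coeffs) (F : Plane → Plane) (hF : ContDiffOn ℝ ∞ F halfPlane) :
    smoothVF (modelB C).U :=
  ⟨field F, hF.congr fun _ hq => Set.indicator_of_mem hq _, fun _ hq =>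
    Set.indicator_of_notMem hq _⟩

theorem field_apply {F : Plane → Plane} {p : Plane} (hp : p ∈ halfPlane) : field F p = F p :=
  Set.indicator_of_mem (s := (halfPlane : Set Plane)) hp F

theorem eventuallyEq_field (F : Plane → Plane) {p : Plane} (hp : p ∈ halfPlane) :
    field F =ᶠ[nhds p] F :=
  Filter.eventuallyEq_of_mem (halfPlane.isOpen.mem_nhds hp) fun _ hq => field_apply hq

theorem hasFDerivAt_coord (i : Fin 2) (p : Plane) :
    HasFDerivAt (fun q : Plane => q i) (ContinuousLinearMap.proj i : Plane →L[ℝ] ℝ) p :=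
  (ContinuousLinearMap.proj (R := ℝ) (φ := fun _ : Fin 2 => ℝ) i).hasFDerivAt

theorem contDiff_coord (i : Fin 2) : ContDiff ℝ ∞ fun q : Plane => q i := contDiff_apply ℝ ℝ i

theorem fderiv_fderiv_apply {X : Plane → Plane} {p : Plane}
    (h : DifferentiableAt ℝ (fderiv ℝ X) p) (v w : Plane) :
    fderiv ℝ (fun q => fderiv ℝ X q w) p v = fderiv ℝ (fderiv ℝ X) p v w := by
  rw [(h.hasFDerivAt.clm_apply (hasFDerivAt_const w p)).fderiv]
  simp

theorem isKilling_of_hasFDerivAt (C : Coeffs) {F : Plane → Plane}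
    (hF : ContDiffOn ℝ ∞ F halfPlane) {B : Plane → Plane → Plane →L[ℝ] Plane}
    {A' : Plane → Plane →L[ℝ] Plane}
    (hA : ∀ p ∈ halfPlane, HasFDerivAt F (A' p) p)
    (hB : ∀ p ∈ halfPlane, ∀ w, HasFDerivAt (fun q => A' q w) (B p w) p)
    (h : ∀ p ∈ halfPlane, ∀ v w, B p w v = -killingRHS C p (F p) (A' p) v w) :
    (modelB C).IsKilling (vf C F hF) := by
  rw [isKilling_iff]
  intro p hp v w
  have e1 : ∀ q ∈ halfPlane, fderiv ℝ (field F) q = A' q := fun q hq => by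
    rw [(eventuallyEq_field F hq).fderiv_eq, (hA q hq).fderiv]
  have e2 : (fun q => fderiv ℝ (field F) q w) =ᶠ[nhds p] fun q => A' q w :=
    Filter.eventuallyEq_of_mem (halfPlane.isOpen.mem_nhds hp) fun q hq => by
      simp only [e1 q hq]
  rw [← fderiv_fderiv_apply (differentiableAt_fderiv_vf (vf C F hF) hp)]
  change fderiv ℝ (fun q => fderiv ℝ (field F) q w) p v =
    -killingRHS C p (field F p) (fderiv ℝ (field F) p) v w
  rw [e2.fderiv_eq, (hB p hp w).fderiv, e1 p hp, field_apply hp, h p hp]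

/-- The linear map of the plane with the given rows. -/
noncomputable def ofRows (a b c d : ℝ) : Plane →L[ℝ] Plane :=
  ContinuousLinearMap.pi ![a • ContinuousLinearMap.proj 0 + b • ContinuousLinearMap.proj 1,
    c • ContinuousLinearMap.proj 0 + d • ContinuousLinearMap.proj 1]

theorem ofRows_zero (a b c d : ℝ) (v : Plane) : ofRows a b c d v 0 = a * v 0 + b * v 1 := rfl

theorem ofRows_one (a b c d : ℝ) (v : Plane) : ofRows a b c d v 1 = c * v 0 + d * v 1 := rfl

/-- The map underlying the vector fields
`(2 a x¹ x² + f) ∂₁ + (a (x²)² + b x² + g) ∂₂`, where `f` and `g` are functions of `x¹`. -/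
def quadMap (a b : ℝ) (f g : ℝ → ℝ) : Plane → Plane :=
  fun x => ![2 * a * x 0 * x 1 + f (x 0), a * x 1 ^ 2 + b * x 1 + g (x 0)]

theorem contDiffOn_quadMap (a b : ℝ) {f g : ℝ → ℝ} (hf : ContDiffOn ℝ ∞ f (Set.Ioi 0))
    (hg : ContDiffOn ℝ ∞ g (Set.Ioi 0)) : ContDiffOn ℝ ∞ (quadMap a b f g) halfPlane := by
  have h : ∀ {f : ℝ → ℝ}, ContDiffOn ℝ ∞ f (Set.Ioi 0) →
      ContDiffOn ℝ ∞ (fun x : Plane => f (x 0)) halfPlane := fun hf =>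
    hf.comp (contDiff_coord 0).contDiffOn fun _ hp => hp
  rw [contDiffOn_pi]
  intro i
  fin_cases i
  · exact (((contDiff_const.mul (contDiff_coord 0)).mul
      (contDiff_coord 1)).contDiffOn).add (h hf)
  · exact ((contDiff_const.mul ((contDiff_coord 1).pow 2)).add
      (contDiff_const.mul (contDiff_coord 1))).contDiffOn.add (h hg)

theorem hasFDerivAt_comp_fst {f : ℝ → ℝ} {f' : ℝ} {p : Plane} (hf : HasDerivAt f f' (p 0)) :
    HasFDerivAt (fun q : Plane => f (q 0)) (f' • (ContinuousLinearMap.proj 0 : Plane →L[ℝ] ℝ))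
      p := by
  refine (HasFDerivAt.comp p (g := f) hf.hasFDerivAt (hasFDerivAt_coord 0 p)).congr_fderiv ?_
  ext v; simp [mul_comm]

/-- All explicit Killing fields below have this shape: E, T, the two extra fields in dimension four
and X(σ). For them the Killing equation becomes a pointwise identity in f, g and their derivatives.
-/
theorem isKilling_quadMap (C : Coeffs) (a b : ℝ) {f g f' g' f'' g'' : ℝ → ℝ}
    (hf : ContDiffOn ℝ ∞ f (Set.Ioi 0)) (hg : ContDiffOn ℝ ∞ g (Set.Ioi 0))
    (hf' : ∀ x, 0 < x → HasDerivAt f (f' x) x) (hg' : ∀ x, 0 < x → HasDerivAt g (g' x) x)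
    (hf'' : ∀ x, 0 < x → HasDerivAt f' (f'' x) x) (hg'' : ∀ x, 0 < x → HasDerivAt g' (g'' x) x)
    (h : ∀ p ∈ halfPlane, ∀ v w : Plane,
      ![2 * a * (v 1 * w 0 + v 0 * w 1) + f'' (p 0) * v 0 * w 0,
        g'' (p 0) * v 0 * w 0 + 2 * a * v 1 * w 1] =
      -killingRHS C p (quadMap a b f g p) (ofRows (2 * a * p 1 + f' (p 0)) (2 * a * p 0)
        (g' (p 0)) (2 * a * p 1 + b)) v w) :
    (modelB C).IsKilling (vf C (quadMap a b f g) (contDiffOn_quadMap a b hf hg)) := by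
  refine isKilling_of_hasFDerivAt C _
    (B := fun p w => ofRows (2 * a * w 1 + f'' (p 0) * w 0) (2 * a * w 0)
      (g'' (p 0) * w 0) (2 * a * w 1)) (A' := fun p =>
      ofRows (2 * a * p 1 + f' (p 0)) (2 * a * p 0) (g' (p 0)) (2 * a * p 1 + b)) ?_ ?_ ?_
  · intro p hp
    have h0 := hasFDerivAt_coord 0 p
    have h1 := hasFDerivAt_coord 1 p
    rw [hasFDerivAt_pi']
    intro i
    fin_cases i
    · refine (((h0.const_mul (2 * a)).fun_mul h1).fun_add
        (hasFDerivAt_comp_fst (hf' _ hp))).congr_fderiv ?_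
      ext v
      simp [ofRows_zero]; ring
    · refine ((((h1.pow 2).const_mul a).fun_add (h1.const_mul b)).fun_add
        (hasFDerivAt_comp_fst (hg' _ hp))).congr_fderiv ?_
      ext v
      simp [ofRows_one]; ring
  · intro p hp w
    have h0 := hasFDerivAt_coord 0 p
    have h1 := hasFDerivAt_coord 1 p
    rw [hasFDerivAt_pi']
    intro i
    fin_cases i
    · refine ((((h1.const_mul (2 * a)).fun_add (hasFDerivAt_comp_fst (hf'' _ hp))).mul_const
        (w 0)).fun_add ((h0.const_mul (2 * a)).mul_const (w 1))).congr_fderiv ?_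
      ext v
      simp [ofRows_zero]; ring
    · refine (((hasFDerivAt_comp_fst (hg'' _ hp)).mul_const
        (w 0)).fun_add (((h1.const_mul (2 * a)).fun_add
          (hasFDerivAt_const b p)).mul_const (w 1))).congr_fderiv ?_
      ext v
      simp [ofRows_one]; ring
  · intro p hp v w
    rw [← h p hp v w]
    ext k
    fin_cases k
    · simp [ofRows_zero]; ring
    · simp [ofRows_one]; ring

/-! ### A Killing field is determined by its value and its derivative at one point -/

/-- The base point `(1, 0)` of the half plane. -/
def basePt : Plane := ![1, 0]

theorem basePt_mem : basePt ∈ halfPlane := by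
  rw [mem_halfPlane]; simp [basePt]

/-- A bound that is linear in the 1-jet (x, A), as Grönwall's inequality requires. -/
theorem norm_killingRHS_le (C : Coeffs) {s : ℝ} {p : Plane} (hp : p ∈ halfPlane)
    (hs : (p 0)⁻¹ ≤ s) (x : Plane) (A : Plane →L[ℝ] Plane) (v w : Plane) :
    ‖killingRHS C p x A v w‖ ≤ (3 * s * ‖C.bil‖ * ‖A‖ + s ^ 2 * ‖C.bil‖ * ‖x‖) * ‖v‖ * ‖w‖ := by
  have hp0 : 0 < (p 0)⁻¹ := inv_pos.2 (mem_halfPlane.1 hp)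
  have hs0 : 0 < s := hp0.trans_le hs
  have h1 : ‖C.bil (A v) w‖ ≤ ‖C.bil‖ * ‖A‖ * ‖v‖ * ‖w‖ :=
    (C.bil.le_opNorm₂ _ _).trans (by
      rw [mul_assoc ‖C.bil‖ ‖A‖]; gcongr; exact A.le_opNorm v)
  have h2 : ‖C.bil v (A w)‖ ≤ ‖C.bil‖ * ‖A‖ * ‖v‖ * ‖w‖ :=
    (C.bil.le_opNorm₂ _ _).trans (by
      have := A.le_opNorm w
      calc ‖C.bil‖ * ‖v‖ * ‖A w‖ ≤ ‖C.bil‖ * ‖v‖ * (‖A‖ * ‖w‖) := by gcongr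
        _ = _ := by ring)
  have h3' : ‖C.bil v w‖ ≤ ‖C.bil‖ * ‖v‖ * ‖w‖ := C.bil.le_opNorm₂ _ _
  have h3 : ‖A (C.bil v w)‖ ≤ ‖C.bil‖ * ‖A‖ * ‖v‖ * ‖w‖ :=
    (A.le_opNorm _).trans (by
      calc ‖A‖ * ‖C.bil v w‖ ≤ ‖A‖ * (‖C.bil‖ * ‖v‖ * ‖w‖) := by gcongr
        _ = _ := by ring)
  have h4 : ‖(p 0 ^ 2)⁻¹ * x 0‖ ≤ s ^ 2 * ‖x‖ := by
    rw [norm_mul, ← inv_pow, norm_pow, Real.norm_of_nonneg hp0.le]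
    gcongr
    exact norm_le_pi_norm x 0
  rw [killingRHS]
  calc _ ≤ ‖(p 0)⁻¹ • (C.bil (A v) w + C.bil v (A w) - A (C.bil v w))‖ +
        ‖((p 0 ^ 2)⁻¹ * x 0) • C.bil v w‖ := norm_sub_le _ _
    _ ≤ s * (3 * (‖C.bil‖ * ‖A‖ * ‖v‖ * ‖w‖)) +
        (s ^ 2 * ‖x‖) * (‖C.bil‖ * ‖v‖ * ‖w‖) := by
      rw [norm_smul, norm_smul, Real.norm_of_nonneg hp0.le]
      gcongr
      refine (norm_sub_le _ _).trans ?_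
      have := norm_add_le (C.bil (A v) w) (C.bil v (A w))
      linarith
    _ = _ := by ring

/-- The half plane is convex. Along the segment from the base point to p the 1-jet Φ of X satisfies
‖Φ'‖ ≤ K‖Φ‖ and starts at zero, so it vanishes by Grönwall's inequality. -/
theorem eq_zero_of_jet_eq_zero {C : Coeffs} {X : smoothVF (modelB C).U}
    (hX : (modelB C).IsKilling X) (h0 : X.1 basePt = 0) (h1 : fderiv ℝ X.1 basePt = 0) :
    X = 0 := by
  rw [isKilling_iff] at hX
  refine SmoothVF.ext_on fun p hp => ?_
  set d := p - basePt with hd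
  have hp' : 0 < p 0 := hp
  set γ : ℝ → Plane := fun t => basePt + t • d
  have hγ0 : ∀ t, γ t 0 = 1 + t * (p 0 - 1) := fun t => by
    have hb : basePt 0 = 1 := rfl
    simp [γ, hd, hb]
  -- On the segment x¹ ≥ m, so the singular coefficient 1/x¹ is bounded there by m⁻¹.
  set m := min 1 (p 0)
  have hm : 0 < m := lt_min one_pos hp'
  have hγm : ∀ t ∈ Set.Icc (0 : ℝ) 1, m ≤ γ t 0 := by
    intro t ht
    rw [hγ0]
    have e1 : m ≤ 1 := min_le_left _ _
    have e2 : m ≤ p 0 := min_le_right _ _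
    nlinarith [ht.1, ht.2, mul_nonneg ht.1 (sub_nonneg.2 e2),
      mul_nonneg (sub_nonneg.2 ht.2) (sub_nonneg.2 e1)]
  have hγU : ∀ t ∈ Set.Icc (0 : ℝ) 1, γ t ∈ halfPlane := fun t ht => hm.trans_le (hγm t ht)
  have hγ : ∀ t, HasDerivAt γ d t := fun t => by
    have h := ((hasDerivAt_id t).smul_const d).const_add basePt
    rw [one_smul] at h
    exact h
  set Φ : ℝ → Plane × (Plane →L[ℝ] Plane) := fun t => (X.1 (γ t), fderiv ℝ X.1 (γ t))
  set Φ' : ℝ → Plane × (Plane →L[ℝ] Plane) := fun t =>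
    (fderiv ℝ X.1 (γ t) d, fderiv ℝ (fderiv ℝ X.1) (γ t) d)
  have hΦ : ∀ t ∈ Set.Icc (0 : ℝ) 1, HasDerivAt Φ (Φ' t) t := fun t ht =>
    ((SmoothVF.differentiableAt X (hγU t ht)).hasFDerivAt.comp_hasDerivAt t (hγ t)).prodMk
      ((differentiableAt_fderiv_vf X (hγU t ht)).hasFDerivAt.comp_hasDerivAt t (hγ t))
  set K := ‖d‖ + (3 * m⁻¹ * ‖C.bil‖ + (m⁻¹) ^ 2 * ‖C.bil‖) * ‖d‖
  have key := eq_zero_of_abs_deriv_le_mul_abs_self_of_eq_zero_right (f := Φ) (f' := Φ') (K := K)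
    (a := 0) (b := 1) (fun t ht => (hΦ t ht).continuousAt.continuousWithinAt)
    (fun t ht => (hΦ t ⟨ht.1, ht.2.le⟩).hasDerivWithinAt)
    (by simp [Φ, γ, h0, h1]) ?_ 1 ⟨zero_le_one, le_rfl⟩
  · have : X.1 (γ 1) = 0 := congrArg Prod.fst key
    have e : γ 1 = p := by simp [γ, hd]
    rw [e] at this
    exact this
  · intro t ht
    have ht' : t ∈ Set.Icc (0 : ℝ) 1 := ⟨ht.1, ht.2.le⟩
    have b1 : ‖X.1 (γ t)‖ ≤ ‖Φ t‖ := norm_fst_le (Φ t)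
    have b2 : ‖fderiv ℝ X.1 (γ t)‖ ≤ ‖Φ t‖ := norm_snd_le (Φ t)
    have hs : (γ t 0)⁻¹ ≤ m⁻¹ := inv_anti₀ hm (hγm t ht')
    have hm' : 0 ≤ m⁻¹ := inv_nonneg.2 hm.le
    have c1 : ‖fderiv ℝ X.1 (γ t) d‖ ≤ ‖d‖ * ‖Φ t‖ :=
      (ContinuousLinearMap.le_opNorm _ _).trans (by rw [mul_comm]; gcongr)
    have c2 : ‖fderiv ℝ (fderiv ℝ X.1) (γ t) d‖ ≤
        (3 * m⁻¹ * ‖C.bil‖ + (m⁻¹) ^ 2 * ‖C.bil‖) * ‖d‖ * ‖Φ t‖ := by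
      refine ContinuousLinearMap.opNorm_le_bound _ (by positivity) fun w => ?_
      rw [hX _ (hγU t ht'), norm_neg]
      refine (norm_killingRHS_le C (hγU t ht') hs _ _ _ _).trans ?_
      calc _ ≤ (3 * m⁻¹ * ‖C.bil‖ * ‖Φ t‖ + m⁻¹ ^ 2 * ‖C.bil‖ * ‖Φ t‖) * ‖d‖ * ‖w‖ := by gcongr
        _ = _ := by ring
    have k1 : 0 ≤ ‖d‖ * ‖Φ t‖ := by positivity
    have k2 : 0 ≤ (3 * m⁻¹ * ‖C.bil‖ + (m⁻¹) ^ 2 * ‖C.bil‖) * ‖d‖ * ‖Φ t‖ := by positivity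
    refine max_le ?_ ?_
    · refine c1.trans ?_
      simp only [K, add_mul]; simp only [add_mul] at k2; linarith
    · refine c2.trans ?_
      simp only [K, add_mul]; linarith

/-! ### Jets at the base point -/

/-- The `k`-th component at the base point. -/
noncomputable def jv {C : Coeffs} (X : smoothVF (modelB C).U) (k : Fin 2) : ℝ := X.1 basePt k

/-- The `i`-th partial derivative of the `k`-th component at the base point. -/
noncomputable def jd {C : Coeffs} (X : smoothVF (modelB C).U) (i k : Fin 2) : ℝ :=
  fderiv ℝ X.1 basePt (Pi.single i 1) k

section Jets

variable {C : Coeffs}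

theorem jv_add (X X' : smoothVF (modelB C).U) (k : Fin 2) : jv (X + X') k = jv X k + jv X' k :=
  rfl

theorem jv_smul (a : ℝ) (X : smoothVF (modelB C).U) (k : Fin 2) : jv (a • X) k = a * jv X k := rfl

theorem jv_sub (X X' : smoothVF (modelB C).U) (k : Fin 2) : jv (X - X') k = jv X k - jv X' k :=
  rfl

theorem jd_add (X X' : smoothVF (modelB C).U) (i k : Fin 2) :
    jd (X + X') i k = jd X i k + jd X' i k := by
  have h : fderiv ℝ (X.1 + X'.1) basePt = fderiv ℝ X.1 basePt + fderiv ℝ X'.1 basePt :=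
    fderiv_add (SmoothVF.differentiableAt X basePt_mem) (SmoothVF.differentiableAt X' basePt_mem)
  change fderiv ℝ (X.1 + X'.1) basePt _ k = _
  rw [h]; rfl

theorem jd_smul (a : ℝ) (X : smoothVF (modelB C).U) (i k : Fin 2) :
    jd (a • X) i k = a * jd X i k := by
  have h : fderiv ℝ (a • X.1) basePt = a • fderiv ℝ X.1 basePt :=
    fderiv_const_smul (SmoothVF.differentiableAt X basePt_mem) a
  change fderiv ℝ (a • X.1) basePt _ k = _
  rw [h]; rfl

theorem jd_sub (X X' : smoothVF (modelB C).U) (i k : Fin 2) :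
    jd (X - X') i k = jd X i k - jd X' i k := by
  have h := jd_add (X - X') X' i k
  rw [sub_add_cancel] at h
  linarith

theorem plane_eq_sum (v : Plane) : v = v 0 • Pi.single 0 1 + v 1 • Pi.single 1 1 := by
  ext k; fin_cases k <;> simp

theorem eq_zero_of_jets {X : smoothVF (modelB C).U} (hX : (modelB C).IsKilling X)
    (h0 : ∀ k, jv X k = 0) (h1 : ∀ i k, jd X i k = 0) : X = 0 := by
  refine eq_zero_of_jet_eq_zero hX (funext h0) ?_
  ext v k
  have e : ∀ i, fderiv ℝ X.1 basePt (Pi.single i 1) = 0 := fun i => funext (h1 i)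
  rw [plane_eq_sum v, map_add, map_smul, map_smul, e, e]
  simp

theorem eq_of_jets {X X' : smoothVF (modelB C).U} (hX : (modelB C).IsKilling X)
    (hX' : (modelB C).IsKilling X') (h0 : ∀ k, jv X k = jv X' k)
    (h1 : ∀ i k, jd X i k = jd X' i k) : X = X' := by
  have h := (modelB C).killing.sub_mem hX hX'
  rw [← sub_eq_zero]
  exact eq_zero_of_jets h (fun k => by rw [jv_sub, h0, sub_self])
    (fun i k => by rw [jd_sub, h1, sub_self])

/-- The vector field `x¹ ∂₁ + x² ∂₂`. -/
noncomputable def eulerVF (C : Coeffs) : smoothVF (modelB C).U :=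
  vf C (fun x => ![x 0, x 1]) (by
    rw [contDiffOn_pi]; intro i; fin_cases i
    exacts [(contDiff_coord 0).contDiffOn, (contDiff_coord 1).contDiffOn])

/-- The vector field `∂₂`. -/
noncomputable def transVF (C : Coeffs) : smoothVF (modelB C).U :=
  vf C (fun _ => ![0, 1]) contDiffOn_const

theorem isKilling_eulerVF (C : Coeffs) : (modelB C).IsKilling (eulerVF C) := by
  have h := isKilling_quadMap C 0 1 (f := fun x => x) (g := fun _ => 0) (f' := fun _ => 1)
    (g' := fun _ => 0) (f'' := fun _ => 0) (g'' := fun _ => 0) contDiffOn_id contDiffOn_const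
    (fun x _ => hasDerivAt_id x) (fun x _ => hasDerivAt_const x 0)
    (fun x _ => hasDerivAt_const x 1) (fun x _ => hasDerivAt_const x 0) ?_
  · have e : (fun x : Plane => ![x 0, x 1]) = quadMap 0 1 (fun x => x) fun _ => 0 := by
      funext x; simp [quadMap]
    exact (congrArg _ (Subtype.ext (congrArg field e))).mpr h
  · intro p hp v w
    have hp' : p 0 ≠ 0 := ne_of_gt hp
    ext k
    fin_cases k <;>
    · simp [killingRHS, C.bil_apply, ofRows_zero, ofRows_one, quadMap]
      field_simp
      ring

theorem isKilling_transVF (C : Coeffs) : (modelB C).IsKilling (transVF C) := by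
  have h := isKilling_quadMap C 0 0 (f := fun _ => 0) (g := fun _ => 1) (f' := fun _ => 0)
    (g' := fun _ => 0) (f'' := fun _ => 0) (g'' := fun _ => 0) contDiffOn_const contDiffOn_const
    (fun x _ => hasDerivAt_const x 0) (fun x _ => hasDerivAt_const x 1)
    (fun x _ => hasDerivAt_const x 0) (fun x _ => hasDerivAt_const x 0) ?_
  · have e : (fun _ : Plane => ![0, 1]) = quadMap 0 0 (fun _ => 0) fun _ => 1 := by
      funext x; simp [quadMap]
    exact (congrArg _ (Subtype.ext (congrArg field e))).mpr h
  · intro p hp v w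
    ext k
    fin_cases k <;> simp [killingRHS, C.bil_apply, ofRows_zero, ofRows_one, quadMap]

theorem eulerVF_apply {p : Plane} (hp : p ∈ halfPlane) : (eulerVF C).1 p = p := by
  change field (fun x => ![x 0, x 1]) p = p
  rw [field_apply hp]
  ext k; fin_cases k <;> rfl

theorem transVF_apply {p : Plane} (hp : p ∈ halfPlane) :
    (transVF C).1 p = Pi.single 1 1 := by
  change field (fun _ => ![0, 1]) p = _
  rw [field_apply hp]
  ext k; fin_cases k <;> simp

theorem fderiv_eulerVF {p : Plane} (hp : p ∈ halfPlane) :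
    fderiv ℝ (eulerVF C).1 p = ContinuousLinearMap.id ℝ Plane := by
  have h : (eulerVF C).1 =ᶠ[nhds p] fun q => q :=
    Filter.eventuallyEq_of_mem (halfPlane.isOpen.mem_nhds hp) fun q hq => eulerVF_apply hq
  rw [h.fderiv_eq]; exact fderiv_fun_id

theorem fderiv_transVF {p : Plane} (hp : p ∈ halfPlane) :
    fderiv ℝ (transVF C).1 p = 0 := by
  have h : (transVF C).1 =ᶠ[nhds p] fun _ => Pi.single 1 1 :=
    Filter.eventuallyEq_of_mem (halfPlane.isOpen.mem_nhds hp) fun q hq => transVF_apply hq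
  rw [h.fderiv_eq]; simp

theorem bracket_transVF_apply (X : smoothVF (modelB C).U) {p : Plane} (hp : p ∈ halfPlane) :
    (⁅transVF C, X⁆ : smoothVF (modelB C).U).1 p = fderiv ℝ X.1 p (Pi.single 1 1) := by
  rw [SmoothVF.bracket_apply, VectorField.lieBracket, transVF_apply hp, fderiv_transVF hp]
  simp

theorem bracket_eulerVF_apply (X : smoothVF (modelB C).U) {p : Plane} (hp : p ∈ halfPlane) :
    (⁅eulerVF C, X⁆ : smoothVF (modelB C).U).1 p = fderiv ℝ X.1 p p - X.1 p := by
  rw [SmoothVF.bracket_apply, VectorField.lieBracket, eulerVF_apply hp, fderiv_eulerVF hp]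
  simp

theorem bracket_eulerVF_transVF : ⁅eulerVF C, transVF C⁆ = -transVF C := by
  refine SmoothVF.ext_on fun p hp => ?_
  rw [bracket_eulerVF_apply _ hp, fderiv_transVF hp]
  simp

theorem fderiv_bracket_transVF (X : smoothVF (modelB C).U) {p : Plane} (hp : p ∈ halfPlane)
    (v : Plane) : fderiv ℝ (⁅transVF C, X⁆ : smoothVF (modelB C).U).1 p v =
      fderiv ℝ (fderiv ℝ X.1) p v (Pi.single 1 1) := by
  have h : (⁅transVF C, X⁆ : smoothVF (modelB C).U).1 =ᶠ[nhds p]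
      fun q => fderiv ℝ X.1 q (Pi.single 1 1) :=
    Filter.eventuallyEq_of_mem (halfPlane.isOpen.mem_nhds hp) fun q hq =>
      bracket_transVF_apply X hq
  rw [h.fderiv_eq, fderiv_fderiv_apply (differentiableAt_fderiv_vf X hp)]

theorem fderiv_bracket_eulerVF (X : smoothVF (modelB C).U) {p : Plane} (hp : p ∈ halfPlane)
    (v : Plane) : fderiv ℝ (⁅eulerVF C, X⁆ : smoothVF (modelB C).U).1 p v =
      fderiv ℝ (fderiv ℝ X.1) p v p := by
  have h : (⁅eulerVF C, X⁆ : smoothVF (modelB C).U).1 =ᶠ[nhds p]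
      fun q => fderiv ℝ X.1 q q - X.1 q :=
    Filter.eventuallyEq_of_mem (halfPlane.isOpen.mem_nhds hp) fun q hq =>
      bracket_eulerVF_apply X hq
  have h2 := ((differentiableAt_fderiv_vf X hp).hasFDerivAt.clm_apply (hasFDerivAt_id p)).fun_sub
    (SmoothVF.differentiableAt X hp).hasFDerivAt
  rw [h.fderiv_eq]
  simp only [id_eq] at h2
  rw [h2.fderiv]
  simp

/-- The second partial derivative `∂_i ∂_j X^k` at the base point of a Killing field, in terms of
its first derivatives. -/
noncomputable def jdd (X : smoothVF (modelB C).U) (i j k : Fin 2) : ℝ :=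
  C.c i j k * jv X 0 + (C.c i j 0 * jd X 0 k + C.c i j 1 * jd X 1 k) -
    (C.c 0 j k * jd X i 0 + C.c 1 j k * jd X i 1) - (C.c i 0 k * jd X j 0 + C.c i 1 k * jd X j 1)

theorem Coeffs.bil_single (C : Coeffs) (i j k : Fin 2) :
    C.bil (Pi.single i 1) (Pi.single j 1) k = C.c i j k := by
  rw [C.bil_apply]
  fin_cases i <;> fin_cases j <;> simp [C.symm 1 0]

theorem second_eq_jdd {X : smoothVF (modelB C).U} (hX : (modelB C).IsKilling X) (i j k : Fin 2) :
    fderiv ℝ (fderiv ℝ X.1) basePt (Pi.single i 1) (Pi.single j 1) k = jdd X i j k := by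
  rw [(isKilling_iff C X).1 hX basePt basePt_mem]
  have hb : basePt 0 = 1 := rfl
  have e := plane_eq_sum (C.bil (Pi.single i 1) (Pi.single j 1))
  have e1 := plane_eq_sum (fderiv ℝ X.1 basePt (Pi.single i 1))
  have e2 := plane_eq_sum (fderiv ℝ X.1 basePt (Pi.single j 1))
  rw [C.bil_single, C.bil_single] at e
  simp only [killingRHS, hb]
  rw [e1, e2, e]
  simp only [map_add, map_smul, add_apply, smul_apply, Pi.neg_apply, Pi.sub_apply, Pi.add_apply,
    Pi.smul_apply, smul_eq_mul, C.bil_single]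
  simp only [jdd, jv, jd]
  fin_cases k <;> simp <;> ring

/-- With the Killing equation eliminating second derivatives through `jdd`, ad T and ad E act on
1-jets by explicit formulas. This lemma, `jv_euler`, `jd_trans` and `jd_euler` are their components;
all later bracket computations rest on them. -/
theorem jv_trans (X : smoothVF (modelB C).U) (k : Fin 2) : jv ⁅transVF C, X⁆ k = jd X 1 k :=
  congrFun (bracket_transVF_apply X basePt_mem) k

theorem basePt_eq : basePt = Pi.single 0 1 := by
  ext k; fin_cases k <;> simp [basePt]

theorem jv_euler (X : smoothVF (modelB C).U) (k : Fin 2) :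
    jv ⁅eulerVF C, X⁆ k = jd X 0 k - jv X k := by
  refine (congrFun (bracket_eulerVF_apply X basePt_mem) k).trans ?_
  rw [jd, ← basePt_eq]; rfl

theorem jd_trans {X : smoothVF (modelB C).U} (hX : (modelB C).IsKilling X) (i k : Fin 2) :
    jd ⁅transVF C, X⁆ i k = jdd X i 1 k := by
  rw [← second_eq_jdd hX, ← fderiv_bracket_transVF X basePt_mem]; rfl

theorem jd_euler {X : smoothVF (modelB C).U} (hX : (modelB C).IsKilling X) (i k : Fin 2) :
    jd ⁅eulerVF C, X⁆ i k = jdd X i 0 k := by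
  rw [← second_eq_jdd hX, ← basePt_eq, ← fderiv_bracket_eulerVF X basePt_mem]; rfl

theorem isKilling_trans {X : smoothVF (modelB C).U} (hX : (modelB C).IsKilling X) :
    (modelB C).IsKilling ⁅transVF C, X⁆ := (modelB C).killing.lie_mem (isKilling_transVF C) hX

theorem isKilling_euler {X : smoothVF (modelB C).U} (hX : (modelB C).IsKilling X) :
    (modelB C).IsKilling ⁅eulerVF C, X⁆ := (modelB C).killing.lie_mem (isKilling_eulerVF C) hX

end Jets

/-! ### Finite dimensionality and nilpotency of the translation -/

/-- By induction H Dⁿ - Dⁿ H = -n Dⁿ. If no power of D vanished, the powers would be eigenvectors of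
ad H for infinitely many eigenvalues, impossible in finite dimension. -/
theorem Module.End.isNilpotent_of_commutator {V : Type*} [AddCommGroup V] [Module ℝ V]
    [FiniteDimensional ℝ V] {H D : Module.End ℝ V} (h : H * D - D * H = -D) : IsNilpotent D := by
  have hn : ∀ n : ℕ, H * D ^ n - D ^ n * H = (-(n : ℝ)) • D ^ n := by
    intro n
    induction n with
    | zero => simp
    | succ n ih =>
      have e : H * D ^ (n + 1) - D ^ (n + 1) * H =
          (H * D ^ n - D ^ n * H) * D + D ^ n * (H * D - D * H) := by
        rw [pow_succ]; noncomm_ring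
      rw [e, ih, h, smul_mul_assoc, mul_neg, ← pow_succ]
      push_cast
      module
  by_contra hD
  let A : Module.End ℝ (Module.End ℝ V) := LinearMap.mulLeft ℝ H - LinearMap.mulRight ℝ H
  have hA : ∀ n : ℕ, A.HasEigenvalue (-(n : ℝ)) := by
    intro n
    refine Module.End.hasEigenvalue_of_hasEigenvector (x := D ^ n) ⟨?_, ?_⟩
    · rw [Module.End.mem_eigenspace_iff]; exact hn n
    · exact fun h0 => hD ⟨n, h0⟩
  have hfin : {μ : ℝ | A.HasEigenvalue μ}.Finite := Module.End.finite_hasEigenvalue A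
  refine Set.infinite_of_injective_forall_mem (f := fun n : ℕ => -(n : ℝ)) ?_ hA hfin
  intro m n hmn
  exact_mod_cast neg_injective hmn

section Structure

variable {C : Coeffs}

/-- The jet of a Killing field at the base point. -/
noncomputable def jetMap (C : Coeffs) :
    (modelB C).killing →ₗ[ℝ] (Fin 2 → ℝ) × (Fin 2 → Fin 2 → ℝ) where
  toFun X := (jv X.1, jd X.1)
  map_add' X X' := Prod.ext (funext fun k => jv_add X.1 X'.1 k)
    (funext fun i => funext fun k => jd_add X.1 X'.1 i k)
  map_smul' a X := Prod.ext (funext fun k => jv_smul a X.1 k)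
    (funext fun i => funext fun k => jd_smul a X.1 i k)

theorem jetMap_injective (C : Coeffs) : Function.Injective (jetMap C) := by
  intro X X' h
  have h0 : jv X.1 = jv X'.1 := congrArg Prod.fst h
  have h1 : jd X.1 = jd X'.1 := congrArg Prod.snd h
  exact Subtype.ext (eq_of_jets X.2 X'.2 (fun k => by rw [h0]) (fun i k => by rw [h1]))

instance finiteDimensional_killing (C : Coeffs) : FiniteDimensional ℝ (modelB C).killing :=
  FiniteDimensional.of_injective (jetMap C) (jetMap_injective C)

/-- A property of Killing fields which is inherited from `[∂₂, X]` to `X` and which holds for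
`X = 0` holds for all Killing fields. -/
theorem killing_induction {T : smoothVF (modelB C).U → Prop} (h0 : T 0)
    (h : ∀ X, (modelB C).IsKilling X → T ⁅transVF C, X⁆ → T X) {X : smoothVF (modelB C).U}
    (hX : (modelB C).IsKilling X) : T X := by
  let Y : (modelB C).killing := ⟨transVF C, isKilling_transVF C⟩
  let E : (modelB C).killing := ⟨eulerVF C, isKilling_eulerVF C⟩
  let D : Module.End ℝ (modelB C).killing := LieModule.toEnd ℝ _ _ Y
  let H : Module.End ℝ (modelB C).killing := LieModule.toEnd ℝ _ _ E
  have hc : H * D - D * H = -D := by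
    have e : ⁅E, Y⁆ = -Y := Subtype.ext bracket_eulerVF_transVF
    refine LinearMap.ext fun X => ?_
    change ⁅E, ⁅Y, X⁆⁆ - ⁅Y, ⁅E, X⁆⁆ = -⁅Y, X⁆
    rw [← lie_lie, e, neg_lie]
  obtain ⟨n, hn⟩ := Module.End.isNilpotent_of_commutator hc
  have key : ∀ n : ℕ, ∀ X : (modelB C).killing, (D ^ n) X = 0 → T X.1 := by
    intro n
    induction n with
    | zero => intro X hX; rw [show X = 0 from hX]; exact h0
    | succ n ih =>
      intro X hX
      exact h X.1 X.2 (ih (D X) (by rw [← hX, pow_succ]; rfl))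
  exact key n ⟨X, hX⟩ (by rw [hn]; rfl)

theorem jv_eulerVF (k : Fin 2) : jv (eulerVF C) k = basePt k :=
  congrFun (eulerVF_apply basePt_mem) k

theorem jd_eulerVF (i k : Fin 2) : jd (eulerVF C) i k = (Pi.single i 1 : Plane) k := by
  rw [jd, fderiv_eulerVF basePt_mem]; rfl

theorem jv_transVF (k : Fin 2) : jv (transVF C) k = (Pi.single 1 1 : Plane) k :=
  congrFun (transVF_apply basePt_mem) k

theorem jd_transVF (i k : Fin 2) : jd (transVF C) i k = 0 := by
  rw [jd, fderiv_transVF basePt_mem]; rfl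

theorem jv_zero (k : Fin 2) : jv (0 : smoothVF (modelB C).U) k = 0 := rfl

theorem jd_zero (i k : Fin 2) : jd (0 : smoothVF (modelB C).U) i k = 0 := by
  have := jd_smul (C := C) 0 0 i k
  rwa [zero_smul, zero_mul] at this

/-- The components of the Ricci tensor of `(ℝ⁺ × ℝ, (x¹)⁻¹ C)` at the points with `x¹ = 1`. -/
def ricciConst (C : Coeffs) : Fin 2 → Fin 2 → ℝ :=
  ![fun k => C.c 0 1 1 * C.c 0 k 0 + C.c 1 1 1 * C.c 0 k 1 + C.c 1 k 1 -
      (C.c 1 k 0 * C.c 0 0 1 + C.c 1 k 1 * C.c 0 1 1),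
    fun k => C.c 1 k 0 * C.c 0 0 0 + C.c 1 k 1 * C.c 0 1 0 - C.c 1 k 0 -
      (C.c 0 k 0 * C.c 0 1 0 + C.c 0 k 1 * C.c 1 1 0)]

/-- The letters p, q, c, d, e, f stand for C₁₁¹, C₁₁², C₁₂¹, C₁₂², C₂₂¹, C₂₂², and x, u, g for X¹,
∂₁X¹, ∂₁X² at the base point. The hypotheses `h1`–`h4` are Killing equations of a field X with [T,
X] = 0, and `k1`–`k3` those of [E, X]; `hR` says that the Ricci tensor is not zero. -/
theorem trans_ker_jet_zero {p q c d e f x u g : ℝ} (hV : ¬ (c = 0 ∧ e = 0 ∧ f = 0))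
    (hR : ¬ (d * p + f * q + d - (c * q + d * d) = 0 ∧ d * c + f * d + f - (e * q + f * d) = 0 ∧
      c * p + d * c - c - (p * c + q * e) = 0 ∧ e * p + f * c - e - (c * c + d * e) = 0))
    (h1 : e * (u + x) = 0) (h2 : e * g + f * x = 0) (h3 : e * g = c * x)
    (h4 : d * (u - x) + (f - c) * g = 0)
    (k1 : e * (-p * (u - x) - 2 * c * g + (u - x)) = 0)
    (k2 : e * (-2 * q * u - (2 * d - p) * g + q * x) + f * (u - x) = 0)
    (k3 : e * (-2 * q * u - (2 * d - p) * g + q * x) = c * (u - x)) : x = 0 ∧ u = 0 := by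
  by_cases he : e = 0
  · subst he
    have : x = 0 := by grind
    grind
  · have hu : u = -x := by grind
    subst hu
    by_cases hx : x = 0
    · grind
    · exfalso
      -- Cancelling x expresses all coefficients through e and the ratio m = g/x. The resulting
      -- two-parameter family is flat, against `hR`.
      obtain ⟨m, rfl⟩ : ∃ m, g = m * x := ⟨g / x, by field_simp⟩
      have e1 : c = e * m := by grind
      subst e1
      have e2 : f = - (e * m) := by grind
      subst e2
      have e3 : d = - (e * m * m) := by grind
      subst e3
      have e4 : p = 1 + e * m * m := by grind
      subst e4
      have e5 : q = -m * (1 + e * m * m) := by grind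
      subst e5
      exact hR ⟨by ring, by ring, by ring, by ring⟩

/-- The kernel of ad T is stable under ad E because [T, E] = T. Each equation found for X in the
kernel therefore holds for [E, X] as well. -/
theorem trans_bracket_euler_eq_zero {X : smoothVF (modelB C).U} (hY : ⁅transVF C, X⁆ = 0) :
    ⁅transVF C, ⁅eulerVF C, X⁆⁆ = 0 := by
  have e : ⁅transVF C, eulerVF C⁆ = transVF C := by
    rw [← lie_skew, bracket_eulerVF_transVF, neg_neg]
  rw [leibniz_lie, e, hY, lie_zero, add_zero]

theorem jet_fst_eq_zero (hV : ¬ Vanishing C) (hR : ¬ ∀ i j, ricciConst C i j = 0)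
    {X : smoothVF (modelB C).U} (hX : (modelB C).IsKilling X) (hY : ⁅transVF C, X⁆ = 0) :
    jv X 0 = 0 ∧ jd X 0 0 = 0 := by
  have hEX := isKilling_euler hX
  have hYE := trans_bracket_euler_eq_zero hY
  have a1 : ∀ k, jd X 1 k = 0 := fun k => by rw [← jv_trans, hY, jv_zero]
  have b1 : ∀ k, jd ⁅eulerVF C, X⁆ 1 k = 0 := fun k => by rw [← jv_trans, hYE, jv_zero]
  have a2 : ∀ i k, jdd X i 1 k = 0 := fun i k => by rw [← jd_trans hX, hY, jd_zero]
  have b2 : ∀ i k, jdd ⁅eulerVF C, X⁆ i 1 k = 0 := fun i k => by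
    rw [← jd_trans hEX, hYE, jd_zero]
  have s0 := C.symm 1 0 0
  have s1 := C.symm 1 0 1
  have ej : ∀ i k, jd ⁅eulerVF C, X⁆ i k = jdd X i 0 k := jd_euler hX
  have ev : ∀ k, jv ⁅eulerVF C, X⁆ k = jd X 0 k - jv X k := jv_euler X
  have a00 := a2 0 0
  have a01 := a2 0 1
  have a10 := a2 1 0
  have a11 := a2 1 1
  have b00 := b2 0 0
  have b10 := b2 1 0
  have b11 := b2 1 1
  simp only [jdd, b1, ev] at b00 b10 b11
  simp only [ej] at b00 b10 b11
  simp only [jdd, a1, s0, s1] at a00 a01 a10 a11 b00 b10 b11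
  exact trans_ker_jet_zero (p := C.c 0 0 0) (q := C.c 0 0 1) (c := C.c 0 1 0)
    (d := C.c 0 1 1) (e := C.c 1 1 0) (f := C.c 1 1 1) (x := jv X 0) (u := jd X 0 0)
    (g := jd X 0 1) hV (fun h => hR (by
      intro i j
      fin_cases i <;> fin_cases j
      · simpa [ricciConst, s0, s1] using h.1
      · simpa [ricciConst, s0, s1] using h.2.1
      · simpa [ricciConst, s0, s1] using h.2.2.1
      · simpa [ricciConst, s0, s1] using h.2.2.2)) (by linarith) (by linarith) (by linarith)
    (by linarith) (by linarith) (by linarith) (by linarith)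

/-- If `C₁₂¹, C₂₂¹, C₂₂²` do not all vanish and the surface is not flat, then the Killing fields
which do not depend on `x²` are the multiples of `∂₂`. -/
theorem eq_smul_transVF (hV : ¬ Vanishing C) (hR : ¬ ∀ i j, ricciConst C i j = 0)
    {X : smoothVF (modelB C).U} (hX : (modelB C).IsKilling X) (hY : ⁅transVF C, X⁆ = 0) :
    ∃ b : ℝ, X = b • transVF C := by
  have a1 : ∀ k, jd X 1 k = 0 := fun k => by rw [← jv_trans, hY, jv_zero]
  have a2 : ∀ i k, jdd X i 1 k = 0 := fun i k => by rw [← jd_trans hX, hY, jd_zero]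
  obtain ⟨z0, z1⟩ := jet_fst_eq_zero hV hR hX hY
  -- For [E, X] the vanishing of this jet component reads C₁₂¹ ∂₁X² = 0 once X¹ and ∂₁X¹ are known
  -- to vanish. The equations `a01` and `a11` add (C₁₂¹ - C₂₂²) ∂₁X² = 0 and C₂₂¹ ∂₁X² = 0.
  have z3 := (jet_fst_eq_zero hV hR (isKilling_euler hX) (trans_bracket_euler_eq_zero hY)).2
  rw [jd_euler hX] at z3
  have a01 := a2 0 1
  have a11 := a2 1 1
  have s0 := C.symm 1 0 0
  simp only [jdd, a1, z0, z1, s0] at a01 a11 z3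
  have z2 : jd X 0 1 = 0 := by
    by_contra hg
    have r0 : C.c 0 1 0 = 0 := by
      have : C.c 0 1 0 * jd X 0 1 = 0 := by linarith
      exact (mul_eq_zero.1 this).resolve_right hg
    have r1 : C.c 1 1 0 = 0 := by
      have : C.c 1 1 0 * jd X 0 1 = 0 := by linarith
      exact (mul_eq_zero.1 this).resolve_right hg
    have r2 : C.c 1 1 1 = 0 := by
      have : C.c 1 1 1 * jd X 0 1 = 0 := by rw [r0] at a01; linarith
      exact (mul_eq_zero.1 this).resolve_right hg
    exact hV ⟨r0, r1, r2⟩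
  refine ⟨jv X 1, eq_of_jets hX ((modelB C).killing.smul_mem _ (isKilling_transVF C)) ?_ ?_⟩
  · intro k
    rw [jv_smul, jv_transVF]
    fin_cases k <;> simp [z0]
  · intro i k
    rw [jd_smul, jd_transVF, mul_zero]
    fin_cases i <;> fin_cases k <;> simp [z1, z2, a1]

end Structure

/-! ### Surfaces for which `C₁₂¹, C₂₂¹, C₂₂²` do not all vanish -/

/-- Here (α, σ) is the value at the base point of a field X as in `IsSpecial`, and the hypotheses
come from `IsSpecial.coeff_eqs`. The factors σ + α²/4 and c - (α/2)e are the values of σ and C₁₂¹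
after the shear x² ↦ x² + (α/2)x¹, which removes α. The same combinations govern
`special_scale_eq_zero`. -/
theorem special_shear_eq_zero {p q c d e f α σ : ℝ} (h1 : 4 * c - 2 * f - 3 * α * e = 0)
    (h2 : 2 + 4 * d - 2 * σ * e - α * f = 0) (h3 : 2 + 2 * p - 2 * d + 2 * σ * e - α * c = 0)
    (h4 : α * d + 2 * σ * (f - c) + 2 * q = 0) (h5 : 2 * α + α * p + 4 * σ * c - 2 * q = 0) :
    (σ + α ^ 2 / 4) * (c - α / 2 * e) = 0 := by
  grind

theorem special_scale_eq_zero {p q c d e f α σ : ℝ} (h1 : 4 * c - 2 * f - 3 * α * e = 0)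
    (h2 : 2 + 4 * d - 2 * σ * e - α * f = 0) (h3 : 2 + 2 * p - 2 * d + 2 * σ * e - α * c = 0)
    (h4 : α * d + 2 * σ * (f - c) + 2 * q = 0) (h5 : 2 * α + α * p + 4 * σ * c - 2 * q = 0)
    (h6 : 2 * σ + 3 * α * q + 2 * σ * (2 * d - p) = 0) :
    (σ + α ^ 2 / 4) * ((σ + α ^ 2 / 4) * e + 1) = 0 := by
  grind

/-- In addition to the special field, (x, y) is the value at the base point of a hypothetical W with
[T, W] = X and [E, W] = 2W, and `k1`–`k5` are Killing equations of W. In the sheared parameters s, t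
either s = 0, or s e = -1 and then t = 0; both contradict these equations. -/
theorem not_special_of_trans {p q c d e f α σ x y : ℝ} (h1 : 4 * c - 2 * f - 3 * α * e = 0)
    (h2 : 2 + 4 * d - 2 * σ * e - α * f = 0) (h3 : 2 + 2 * p - 2 * d + 2 * σ * e - α * c = 0)
    (h4 : α * d + 2 * σ * (f - c) + 2 * q = 0) (h5 : 2 * α + α * p + 4 * σ * c - 2 * q = 0)
    (h6 : 2 * σ + 3 * α * q + 2 * σ * (2 * d - p) = 0)
    (k1 : 2 + 2 * α * c + 2 * σ * e - α * f - 4 * x * e = 0)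
    (k2 : 2 * α * d + σ * f - 3 * y * e - x * f = 0)
    (k3 : 2 * α + (3 * y * e + p * α + c * σ - d * α) - x * c = 0)
    (k4 : 2 * σ + (2 * x * d + 3 * y * f + q * α - 3 * y * c) = 0)
    (k5 : 6 * x + 2 * x * p + 6 * y * c - q * α = 0) : False := by
  have u1 := special_shear_eq_zero h1 h2 h3 h4 h5
  have u2 := special_scale_eq_zero h1 h2 h3 h4 h5 h6
  obtain ⟨s, hs⟩ : ∃ s, s = σ+α^2/4 := ⟨_, rfl⟩
  obtain ⟨t, ht⟩ : ∃ t, t = c-α/2*e := ⟨_, rfl⟩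
  rw [← hs, ← ht] at u1
  rw [← hs] at u2
  obtain rfl : σ = s - α^2/4 := by linarith
  obtain rfl : c = t + α/2*e := by linarith
  obtain rfl : f = 2*t-α/2*e := by linarith
  obtain rfl : d = (-2 +2*(s - α^2/4)*e+α*(2*t-α/2*e))/4 := by linarith
  rcases mul_eq_zero.1 u2 with h | h
  · subst h
    obtain rfl : p = (-2 + 2 * (0 - α ^ 2 / 4) * e + α * (2 * t - α / 2 * e)) / 4 - 1 -
      (0 - α ^ 2 / 4) * e + α / 2 * (t + α / 2 * e) := by linarith
    -- X and Y are the components of W at the base point after the shear, which eliminates α. Then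
    -- `m1` gives X ≠ 0, so t = 0 by `m3`, and `m4` yields X = 0.
    obtain ⟨X, rfl⟩ : ∃ X, x = X + α ^ 2 / 4 := ⟨x - α ^ 2 / 4, by ring⟩
    obtain ⟨Y, rfl⟩ : ∃ Y, y = Y - α ^ 3 / 12 - α / 2 * X := ⟨y + α ^ 3 / 12 + α / 2 * X, by ring⟩
    have m1 : 1 = 2 * e * X := by linarith
    have m3 : t * X = 0 := by grind
    have m2 : 3 * Y * e = t * X := by grind
    have m4 : X = 3 * t * Y := by grind
    grind
  · have : t = 0 := by grind
    subst this
    grind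

section Structure

variable {C : Coeffs}

/-- The Killing fields `X` with `[∂₂, X] = 2 (x¹ ∂₁ + x² ∂₂)` and `[x¹ ∂₁ + x² ∂₂, X] = X`. -/
structure IsSpecial (X : smoothVF (modelB C).U) : Prop where
  isKilling : (modelB C).IsKilling X
  trans : ⁅transVF C, X⁆ = (2 : ℝ) • eulerVF C
  euler : ⁅eulerVF C, X⁆ = X

theorem bracket_transVF_eulerVF : ⁅transVF C, eulerVF C⁆ = transVF C := by
  rw [← lie_skew, bracket_eulerVF_transVF, neg_neg]

/-- The field [E, X] - X commutes with T, hence equals c T. As [E, T] = -T, adding (c/2) T to X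
absorbs it. -/
theorem exists_isSpecial (hV : ¬ Vanishing C) (hR : ¬ ∀ i j, ricciConst C i j = 0)
    {X : smoothVF (modelB C).U} (hX : (modelB C).IsKilling X)
    (h : ⁅transVF C, X⁆ = (2 : ℝ) • eulerVF C) : ∃ s : ℝ, IsSpecial (X + s • transVF C) := by
  have hk : (modelB C).IsKilling (⁅eulerVF C, X⁆ - X) :=
    (modelB C).killing.sub_mem (isKilling_euler hX) hX
  obtain ⟨c, hc⟩ := eq_smul_transVF hV hR hk (by
    rw [lie_sub, leibniz_lie, bracket_transVF_eulerVF, h, lie_smul, lie_self, smul_zero, add_zero,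
      sub_self])
  rw [sub_eq_iff_eq_add] at hc
  refine ⟨c / 2, (modelB C).killing.add_mem hX
    ((modelB C).killing.smul_mem _ (isKilling_transVF C)), ?_, ?_⟩
  · rw [lie_add, h, lie_smul, lie_self, smul_zero, add_zero]
  · rw [lie_add, hc, lie_smul, bracket_eulerVF_transVF]
    module

theorem isKilling_comb {a b : ℝ} {X X' : smoothVF (modelB C).U} (hX : (modelB C).IsKilling X)
    (hX' : (modelB C).IsKilling X') : (modelB C).IsKilling (a • X + b • X') :=
  (modelB C).killing.add_mem ((modelB C).killing.smul_mem _ hX)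
    ((modelB C).killing.smul_mem _ hX')

namespace IsSpecial

variable {X : smoothVF (modelB C).U}

theorem jd_one_zero (hX : IsSpecial X) : jd X 1 0 = 2 := by
  rw [← jv_trans, hX.trans, jv_smul, jv_eulerVF]; simp [basePt]

theorem jd_one_one (hX : IsSpecial X) : jd X 1 1 = 0 := by
  rw [← jv_trans, hX.trans, jv_smul, jv_eulerVF]; simp [basePt]

theorem jd_zero_eq (hX : IsSpecial X) (k : Fin 2) : jd X 0 k = 2 * jv X k := by
  have h := jv_euler X k
  rw [hX.euler] at h
  linarith

theorem jdd_one (hX : IsSpecial X) (i k : Fin 2) :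
    jdd X i 1 k = 2 * (Pi.single i 1 : Plane) k := by
  rw [← jd_trans hX.isKilling, hX.trans, jd_smul, jd_eulerVF]

theorem jdd_zero (hX : IsSpecial X) (i k : Fin 2) : jdd X i 0 k = jd X i k := by
  rw [← jd_euler hX.isKilling, hX.euler]

/-- At the base point the bracket relations force ∂₂X = (2, 0) and ∂₁X = 2X, so the value of X is
all that is left of its jet. The Killing equations become equations between C and these two numbers.
-/
theorem coeff_eqs (hX : IsSpecial X) :
    4 * C.c 0 1 0 - 2 * C.c 1 1 1 - 3 * jv X 0 * C.c 1 1 0 = 0 ∧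
    2 + 4 * C.c 0 1 1 - 2 * jv X 1 * C.c 1 1 0 - jv X 0 * C.c 1 1 1 = 0 ∧
    2 + 2 * C.c 0 0 0 - 2 * C.c 0 1 1 + 2 * jv X 1 * C.c 1 1 0 - jv X 0 * C.c 0 1 0 = 0 ∧
    jv X 0 * C.c 0 1 1 + 2 * jv X 1 * (C.c 1 1 1 - C.c 0 1 0) + 2 * C.c 0 0 1 = 0 ∧
    2 * jv X 0 + jv X 0 * C.c 0 0 0 + 4 * jv X 1 * C.c 0 1 0 - 2 * C.c 0 0 1 = 0 ∧
    2 * jv X 1 + 3 * jv X 0 * C.c 0 0 1 + 2 * jv X 1 * (2 * C.c 0 1 1 - C.c 0 0 0) = 0 := by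
  have a1 := hX.jdd_one
  have a0 := hX.jdd_zero
  have s0 := C.symm 1 0 0
  have s1 := C.symm 1 0 1
  have a00 := a1 0 0
  have a01 := a1 0 1
  have a10 := a1 1 0
  have a11 := a1 1 1
  have b00 := a0 0 0
  have b01 := a0 0 1
  simp only [jdd, hX.jd_one_zero, hX.jd_one_one, hX.jd_zero_eq, s0, s1, Pi.single_eq_same, ne_eq,
    one_ne_zero, zero_ne_one, not_false_eq_true, Pi.single_eq_of_ne] at a00 a01 a10 a11 b00 b01
  refine ⟨?_, ?_, ?_, ?_, ?_, ?_⟩ <;> linarith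

/-- The chain T, E, X does not continue. A preimage of X under ad T could be corrected by a multiple
of T to have weight exactly 2 under ad E; its jet is then again fixed by two numbers, and the
coefficient equations become inconsistent. -/
theorem not_trans_eq (hX : IsSpecial X) (hV : ¬ Vanishing C)
    (hR : ¬ ∀ i j, ricciConst C i j = 0) {Z : smoothVF (modelB C).U}
    (hZ : (modelB C).IsKilling Z) : ⁅transVF C, Z⁆ ≠ X := by
  intro h
  have hk : (modelB C).IsKilling (⁅eulerVF C, Z⁆ - (2 : ℝ) • Z) :=
    (modelB C).killing.sub_mem (isKilling_euler hZ) ((modelB C).killing.smul_mem _ hZ)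
  obtain ⟨s, hs⟩ := eq_smul_transVF hV hR hk (by
    rw [lie_sub, leibniz_lie, bracket_transVF_eulerVF, h, lie_smul, h, hX.euler]
    module)
  rw [sub_eq_iff_eq_add] at hs
  obtain ⟨W, hW, hWY, hWE⟩ : ∃ W, (modelB C).IsKilling W ∧ ⁅transVF C, W⁆ = X ∧
      ⁅eulerVF C, W⁆ = (2 : ℝ) • W := by
    -- From [E, Z] = 2Z + sT and [E, T] = -T, the multiple k of T to be added satisfies s - k = 2k.
    refine ⟨Z + (s / 3) • transVF C, (modelB C).killing.add_mem hZ
      ((modelB C).killing.smul_mem _ (isKilling_transVF C)), ?_, ?_⟩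
    · rw [lie_add, h, lie_smul, lie_self, smul_zero, add_zero]
    · rw [lie_add, hs, lie_smul, bracket_eulerVF_transVF]
      module
  have w1 : ∀ k, jd W 1 k = jv X k := fun k => by rw [← jv_trans, hWY]
  have w0 : ∀ k, jd W 0 k = 3 * jv W k := fun k => by
    have h := jv_euler W k
    rw [hWE, jv_smul] at h
    linarith
  have a1 : ∀ i k, jdd W i 1 k = jd X i k := fun i k => by rw [← jd_trans hW, hWY]
  have a0 : ∀ i k, jdd W i 0 k = 2 * jd W i k := fun i k => by
    rw [← jd_euler hW, hWE, jd_smul]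
  have s0 := C.symm 1 0 0
  have s1 := C.symm 1 0 1
  have a00 := a1 0 0
  have a01 := a1 0 1
  have a10 := a1 1 0
  have a11 := a1 1 1
  have b00 := a0 0 0
  obtain ⟨h1, h2, h3, h4, h5, h6⟩ := hX.coeff_eqs
  simp only [jdd, w0, w1, hX.jd_one_zero, hX.jd_one_one, hX.jd_zero_eq, s0, s1]
    at a00 a01 a10 a11 b00
  exact not_special_of_trans (x := jv W 0) (y := jv W 1) h1 h2 h3 h4 h5 h6 (by linarith)
    (by linarith) (by linarith) (by linarith) (by linarith)

end IsSpecial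

/-- Induction along the nilpotent ad T: let [T, [T, X]] = aE + bT. If a = 0, then [T, X] - bE lies
in ker ad T = ℝT. If a ≠ 0, a multiple of [T, X] - bE becomes special after adding a multiple of T,
and X furnishes a preimage of it under ad T, which `IsSpecial.not_trans_eq` excludes. -/
theorem exists_trans_eq (hV : ¬ Vanishing C) (hR : ¬ ∀ i j, ricciConst C i j = 0)
    {X : smoothVF (modelB C).U} (hX : (modelB C).IsKilling X) :
    ∃ a b : ℝ, ⁅transVF C, X⁆ = a • eulerVF C + b • transVF C := by
  refine killing_induction (T := fun X => ∃ a b : ℝ, ⁅transVF C, X⁆ = a • eulerVF C +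
    b • transVF C) ⟨0, 0, by simp⟩ ?_ hX
  rintro X hX ⟨a, b, hab⟩
  have hW := isKilling_trans hX
  have hWb : (modelB C).IsKilling (⁅transVF C, X⁆ - b • eulerVF C) :=
    (modelB C).killing.sub_mem hW ((modelB C).killing.smul_mem _ (isKilling_eulerVF C))
  have hYW : ⁅transVF C, ⁅transVF C, X⁆ - b • eulerVF C⁆ = a • eulerVF C := by
    rw [lie_sub, hab, lie_smul, bracket_transVF_eulerVF]; module
  rcases eq_or_ne a 0 with rfl | ha
  · rw [zero_smul] at hYW
    obtain ⟨c, hc⟩ := eq_smul_transVF hV hR hWb hYW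
    exact ⟨b, c, by rw [← hc]; abel⟩
  · exfalso
    obtain ⟨s, hs⟩ := exists_isSpecial hV hR (X := (2 / a) • (⁅transVF C, X⁆ - b • eulerVF C))
      ((modelB C).killing.smul_mem _ hWb)
      (by rw [lie_smul, hYW, smul_smul, div_mul_cancel₀ _ ha])
    -- The term in X produces (2/a)[T, X]; the second term supplies the missing -(2b/a)E, and s E
    -- supplies s T because [T, E] = T.
    refine hs.not_trans_eq hV hR (Z := (2 / a) • X -
      (b / a) • ((2 / a) • (⁅transVF C, X⁆ - b • eulerVF C)) + s • eulerVF C) ?_ ?_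
    · exact (modelB C).killing.add_mem ((modelB C).killing.sub_mem
        ((modelB C).killing.smul_mem _ hX) ((modelB C).killing.smul_mem _
          ((modelB C).killing.smul_mem _ hWb)))
        ((modelB C).killing.smul_mem _ (isKilling_eulerVF C))
    · rw [lie_add, lie_sub, lie_smul, lie_smul, lie_smul, lie_smul, hYW, bracket_transVF_eulerVF,
        smul_smul (2 / a) a, div_mul_cancel₀ _ ha]
      match_scalars <;> ring

theorem IsSpecial.exists_eq (hV : ¬ Vanishing C) (hR : ¬ ∀ i j, ricciConst C i j = 0)
    {X : smoothVF (modelB C).U} (hX : IsSpecial X) {Z : smoothVF (modelB C).U}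
    (hZ : (modelB C).IsKilling Z) :
    ∃ a b c : ℝ, Z = a • eulerVF C + b • transVF C + c • X := by
  obtain ⟨a, b, hab⟩ := exists_trans_eq hV hR hZ
  obtain ⟨c, hc⟩ := eq_smul_transVF hV hR (X := Z - (b • eulerVF C + (a / 2) • X))
    ((modelB C).killing.sub_mem hZ (isKilling_comb (isKilling_eulerVF C) hX.isKilling)) (by
      rw [lie_sub, lie_add, lie_smul, lie_smul, hX.trans, hab, bracket_transVF_eulerVF]
      module)
  exact ⟨b, c, a / 2, by rw [sub_eq_iff_eq_add] at hc; rw [hc]; abel⟩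

/-- The Killing fields of a surface that is not flat and for which `C₁₂¹, C₂₂¹, C₂₂²` do not all
vanish. -/
theorem killing_structure (hV : ¬ Vanishing C) (hR : ¬ ∀ i j, ricciConst C i j = 0) :
    (∀ X, (modelB C).IsKilling X → ∃ a b : ℝ, X = a • eulerVF C + b • transVF C) ∨
    ∃ X, IsSpecial X ∧ ∀ Z, (modelB C).IsKilling Z →
      ∃ a b c : ℝ, Z = a • eulerVF C + b • transVF C + c • X := by
  by_cases h : ∃ X, (modelB C).IsKilling X ∧ ⁅transVF C, X⁆ = (2 : ℝ) • eulerVF C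
  · right
    obtain ⟨X, hX, hY⟩ := h
    obtain ⟨s, hs⟩ := exists_isSpecial hV hR hX hY
    exact ⟨_, hs, fun Z hZ => hs.exists_eq hV hR hZ⟩
  · left
    intro X hX
    obtain ⟨a, b, hab⟩ := exists_trans_eq hV hR hX
    have hXb : (modelB C).IsKilling (X - b • eulerVF C) :=
      (modelB C).killing.sub_mem hX ((modelB C).killing.smul_mem _ (isKilling_eulerVF C))
    have hYX : ⁅transVF C, X - b • eulerVF C⁆ = a • eulerVF C := by
      rw [lie_sub, hab, lie_smul, bracket_transVF_eulerVF]; module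
    rcases eq_or_ne a 0 with rfl | ha
    · rw [zero_smul] at hYX
      obtain ⟨c, hc⟩ := eq_smul_transVF hV hR hXb hYX
      exact ⟨b, c, by rw [← hc]; abel⟩
    · exact absurd ⟨(2 / a) • (X - b • eulerVF C), (modelB C).killing.smul_mem _ hXb,
        by rw [lie_smul, hYX, smul_smul, div_mul_cancel₀ _ ha]⟩ h

end Structure

/-! ### Surfaces with `C₁₂¹ = C₂₂¹ = C₂₂² = 0` -/

section VanishingStructure

variable {C : Coeffs}

/-- The Jacobi identity for T, E, X read off on first derivatives. Since ad T and ad E differentiate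
X, this equates mixed third derivatives, so it is an integrability condition of the Killing system.
-/
theorem jet_integrability {X : smoothVF (modelB C).U} (hX : (modelB C).IsKilling X)
    (i k : Fin 2) :
    jdd ⁅eulerVF C, X⁆ i 1 k - jdd ⁅transVF C, X⁆ i 0 k = jdd X i 1 k := by
  rw [← jd_trans hX, ← jd_trans (isKilling_euler hX), ← jd_euler (isKilling_trans hX), ← jd_sub]
  congr 1
  rw [leibniz_lie, bracket_transVF_eulerVF]; abel

/-- Both integrability conditions carry the Ricci constant as a factor. As it is non-zero, two of
the six jet coordinates are determined by the others, which bounds the dimension by four. -/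
theorem jet_relations_of_vanishing (hV : Vanishing C)
    (hr : (1 + C.c 0 0 0 - C.c 0 1 1) * C.c 0 1 1 ≠ 0) {X : smoothVF (modelB C).U}
    (hX : (modelB C).IsKilling X) : jd X 1 0 = 0 ∧ jd X 0 0 = jv X 0 := by
  obtain ⟨v1, v2, v3⟩ := hV
  have s0 : C.c 1 0 0 = 0 := (C.symm 1 0 0).trans v1
  have s1 := C.symm 1 0 1
  have e1 := jet_integrability hX 0 0
  have e2 := jet_integrability hX 0 1
  simp only [jdd, jd_trans hX, jd_euler hX, jv_trans, jv_euler, s0, s1, v1, v2, v3] at e1 e2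
  have w : jd X 1 0 = 0 := by
    have : (1 + C.c 0 0 0 - C.c 0 1 1) * C.c 0 1 1 * jd X 1 0 = 0 := by linarith
    exact (mul_eq_zero.1 this).resolve_left hr
  rw [w] at e2
  refine ⟨w, ?_⟩
  have : (1 + C.c 0 0 0 - C.c 0 1 1) * C.c 0 1 1 * (jd X 0 0 - jv X 0) = 0 := by linarith
  exact sub_eq_zero.1 ((mul_eq_zero.1 this).resolve_left hr)

theorem jv_quadMap {a b : ℝ} {f g : ℝ → ℝ} (hF : ContDiffOn ℝ ∞ (quadMap a b f g) halfPlane) :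
    jv (vf C _ hF) 0 = f 1 ∧ jv (vf C _ hF) 1 = g 1 := by
  have h : ∀ k, jv (vf C _ hF) k = quadMap a b f g basePt k := fun k =>
    congrFun (field_apply basePt_mem) k
  rw [h, h]
  constructor <;> simp [quadMap, basePt]

theorem jd_quadMap {a b f' g' : ℝ} {f g : ℝ → ℝ}
    (hF : ContDiffOn ℝ ∞ (quadMap a b f g) halfPlane)
    (hf : HasDerivAt f f' 1) (hg : HasDerivAt g g' 1) :
    jd (vf C _ hF) 0 0 = f' ∧ jd (vf C _ hF) 0 1 = g' ∧ jd (vf C _ hF) 1 0 = 2 * a ∧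
      jd (vf C _ hF) 1 1 = b := by
  have hb0 : basePt 0 = 1 := rfl
  have hb1 : basePt 1 = 0 := rfl
  have h : HasFDerivAt (quadMap a b f g) (ofRows f' (2 * a) g' b) basePt := by
    have h0 := hasFDerivAt_coord 0 basePt
    have h1 := hasFDerivAt_coord 1 basePt
    rw [← hb0] at hf hg
    rw [hasFDerivAt_pi']
    intro i
    fin_cases i
    · refine (((h0.const_mul (2 * a)).fun_mul h1).fun_add
        (hasFDerivAt_comp_fst hf)).congr_fderiv ?_
      ext v
      simp [ofRows_zero, hb0, hb1]; ring
    · refine ((((h1.pow 2).const_mul a).fun_add (h1.const_mul b)).fun_add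
        (hasFDerivAt_comp_fst hg)).congr_fderiv ?_
      ext v
      simp [ofRows_one, hb1]; ring
  have e : ∀ i k, jd (vf C _ hF) i k = ofRows f' (2 * a) g' b (Pi.single i 1) k := fun i k => by
    change fderiv ℝ (field _) basePt _ k = _
    rw [(eventuallyEq_field _ basePt_mem).fderiv_eq, h.fderiv]
  refine ⟨?_, ?_, ?_, ?_⟩ <;> rw [e] <;> simp [ofRows_zero, ofRows_one]

/-- The function `h` for which `x¹ ∂₁ + h(x¹) ∂₂` is a Killing field. -/
noncomputable def particular (p q d : ℝ) : ℝ → ℝ :=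
  if p = 2 * d then fun x => -(q * (x * Real.log x)) else fun x => q / (p - 2 * d) * x

/-- The function `G` for which `G(x¹) ∂₂` is a Killing field. -/
noncomputable def homogeneous (a : ℝ) : ℝ → ℝ := if a = 0 then Real.log else fun x => x ^ a

theorem contDiffOn_log : ContDiffOn ℝ ∞ Real.log (Set.Ioi 0) :=
  Real.contDiffOn_log.mono fun _ hx => ne_of_gt hx

theorem contDiffOn_particular (p q d : ℝ) : ContDiffOn ℝ ∞ (particular p q d) (Set.Ioi 0) := by
  unfold particular
  split_ifs
  · exact (contDiffOn_const.mul (contDiffOn_id.mul contDiffOn_log)).neg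
  · exact contDiffOn_const.mul contDiffOn_id

theorem contDiffOn_homogeneous (a : ℝ) : ContDiffOn ℝ ∞ (homogeneous a) (Set.Ioi 0) := by
  unfold homogeneous
  split_ifs
  · exact contDiffOn_log
  · exact fun x hx => (Real.contDiffAt_rpow_const_of_ne (ne_of_gt hx)).contDiffWithinAt

/-- With p, q, d for C₁₁¹, C₁₁², C₁₂² the ODE is the Killing equation of x¹∂₁ + h(x¹)∂₂. A linear h
solves it except in the resonant case p = 2d, where the logarithm enters. -/
theorem particular_derivs (p q d : ℝ) : ∃ h' h'' : ℝ → ℝ,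
    (∀ x, 0 < x → HasDerivAt (particular p q d) (h' x) x) ∧
    (∀ x, 0 < x → HasDerivAt h' (h'' x) x) ∧
    ∀ x, 0 < x → x * h'' x + (2 * d - p) * h' x + q = 0 := by
  unfold particular
  split_ifs with h
  · refine ⟨fun x => -(q * (Real.log x + 1)), fun x => -(q * x⁻¹), ?_, ?_, ?_⟩
    · intro x hx
      refine (((hasDerivAt_id x).mul (Real.hasDerivAt_log hx.ne')).const_mul q).neg.congr_deriv ?_
      simp [hx.ne']
    · intro x hx
      exact ((((Real.hasDerivAt_log hx.ne').add_const 1).const_mul q).neg)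
    · intro x hx
      rw [h]; field_simp; ring
  · refine ⟨fun x => q / (p - 2 * d), fun x => 0, ?_, fun x _ => hasDerivAt_const x _, ?_⟩
    · intro x hx
      simpa using (hasDerivAt_id x).const_mul (q / (p - 2 * d))
    · intro x hx
      have : p - 2 * d ≠ 0 := sub_ne_zero.2 h
      field_simp
      ring

/-- This is the homogeneous ODE, the Killing equation of h(x¹)∂₂, with a = 1 + C₁₁¹ - 2C₁₂².
Constant solutions give only multiples of T; the condition h'(1) ≠ 0 makes the new field independent
of T. -/
theorem homogeneous_derivs (a : ℝ) : ∃ h' h'' : ℝ → ℝ,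
    (∀ x, 0 < x → HasDerivAt (homogeneous a) (h' x) x) ∧
    (∀ x, 0 < x → HasDerivAt h' (h'' x) x) ∧
    (∀ x, 0 < x → x * h'' x + (1 - a) * h' x = 0) ∧ h' 1 ≠ 0 := by
  unfold homogeneous
  split_ifs with h
  · refine ⟨fun x => x⁻¹, fun x => -(x ^ 2)⁻¹, fun x hx => Real.hasDerivAt_log hx.ne',
      fun x hx => hasDerivAt_inv hx.ne', ?_, by simp⟩
    intro x hx
    rw [h]; field_simp; ring
  · refine ⟨fun x => a * x ^ (a - 1), fun x => a * ((a - 1) * x ^ (a - 1 - 1)),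
      fun x hx => Real.hasDerivAt_rpow_const (Or.inl hx.ne'),
      fun x hx => (Real.hasDerivAt_rpow_const (Or.inl hx.ne')).const_mul a, ?_, by simpa using h⟩
    intro x hx
    simp only [Real.rpow_sub_one hx.ne' (a - 1)]
    field_simp; ring

/-- The Killing field `x¹ ∂₁ + h(x¹) ∂₂`. -/
noncomputable def scaleVF (C : Coeffs) : smoothVF (modelB C).U :=
  vf C _ (contDiffOn_quadMap 0 0 contDiffOn_id
    (contDiffOn_particular (C.c 0 0 0) (C.c 0 0 1) (C.c 0 1 1)))

/-- The Killing field `G(x¹) ∂₂`. -/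
noncomputable def vertVF (C : Coeffs) : smoothVF (modelB C).U :=
  vf C _ (contDiffOn_quadMap 0 0 (f := fun _ => 0) contDiffOn_const
    (contDiffOn_homogeneous (1 + C.c 0 0 0 - 2 * C.c 0 1 1)))

theorem isKilling_scaleVF (hV : Vanishing C) : (modelB C).IsKilling (scaleVF C) := by
  obtain ⟨h', h'', d1, d2, h⟩ := particular_derivs (C.c 0 0 0) (C.c 0 0 1) (C.c 0 1 1)
  refine isKilling_quadMap C 0 0 contDiffOn_id (contDiffOn_particular _ _ _) (f' := fun _ => 1) (f'' := fun _ => 0)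
    (fun x _ => hasDerivAt_id x) d1 (fun x _ => hasDerivAt_const x 1) d2 ?_
  intro p hp v w
  have hp' : p 0 ≠ 0 := ne_of_gt hp
  have e : h'' (p 0) = -((2 * C.c 0 1 1 - C.c 0 0 0) * h' (p 0) + C.c 0 0 1) / p 0 := by
    rw [eq_div_iff hp']; linarith [h _ hp]
  obtain ⟨v1, v2, v3⟩ := hV
  ext k
  fin_cases k
  · simp [killingRHS, C.bil_apply, ofRows_zero, ofRows_one, quadMap, v1, v2, v3, e]
    field_simp
    ring
  · simp [killingRHS, C.bil_apply, ofRows_zero, ofRows_one, quadMap, v1, v2, v3, e]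
    field_simp
    ring

theorem isKilling_vertVF (hV : Vanishing C) : (modelB C).IsKilling (vertVF C) := by
  obtain ⟨h', h'', d1, d2, h, -⟩ := homogeneous_derivs (1 + C.c 0 0 0 - 2 * C.c 0 1 1)
  refine isKilling_quadMap C 0 0 contDiffOn_const (contDiffOn_homogeneous _) (f' := fun _ => 0) (f'' := fun _ => 0)
    (fun x _ => hasDerivAt_const x 0) d1 (fun x _ => hasDerivAt_const x 0) d2 ?_
  intro p hp v w
  have hp' : p 0 ≠ 0 := ne_of_gt hp
  have e : h'' (p 0) = -((2 * C.c 0 1 1 - C.c 0 0 0) * h' (p 0)) / p 0 := by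
    rw [eq_div_iff hp']; linarith [h _ hp]
  obtain ⟨v1, v2, v3⟩ := hV
  ext k
  fin_cases k
  · simp [killingRHS, C.bil_apply, ofRows_zero, ofRows_one, quadMap, v1, v2, v3]
  · simp [killingRHS, C.bil_apply, ofRows_zero, ofRows_one, quadMap, v1, v2, v3, e]
    field_simp
    ring

theorem scaleVF_jets : jv (scaleVF C) 0 = 1 ∧ jd (scaleVF C) 0 0 = 1 ∧ jd (scaleVF C) 1 0 = 0 ∧
    jd (scaleVF C) 1 1 = 0 := by
  obtain ⟨h', h'', d1, -, -⟩ := particular_derivs (C.c 0 0 0) (C.c 0 0 1) (C.c 0 1 1)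
  have hF := contDiffOn_quadMap 0 0 contDiffOn_id
    (contDiffOn_particular (C.c 0 0 0) (C.c 0 0 1) (C.c 0 1 1))
  obtain ⟨e0, e1, e2, e3⟩ := jd_quadMap (C := C) hF (hasDerivAt_id 1) (d1 1 one_pos)
  exact ⟨(jv_quadMap (C := C) hF).1, e0, e2.trans (by simp), e3⟩

theorem vertVF_jets : jv (vertVF C) 0 = 0 ∧ jd (vertVF C) 0 0 = 0 ∧ jd (vertVF C) 1 0 = 0 ∧
    jd (vertVF C) 1 1 = 0 ∧ jd (vertVF C) 0 1 ≠ 0 := by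
  obtain ⟨h', h'', d1, -, -, hne⟩ := homogeneous_derivs (1 + C.c 0 0 0 - 2 * C.c 0 1 1)
  have hF := contDiffOn_quadMap 0 0 (f := fun _ => 0) contDiffOn_const
    (contDiffOn_homogeneous (1 + C.c 0 0 0 - 2 * C.c 0 1 1))
  obtain ⟨e0, e1, e2, e3⟩ := jd_quadMap (C := C) hF (hasDerivAt_const 1 0) (d1 1 one_pos)
  refine ⟨(jv_quadMap (C := C) hF).1, e0, e2.trans (by simp), e3, ?_⟩
  rw [show jd (vertVF C) 0 1 = h' 1 from e1]
  exact hne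

theorem killing_structure_of_vanishing (hV : Vanishing C)
    (hr : (1 + C.c 0 0 0 - C.c 0 1 1) * C.c 0 1 1 ≠ 0) {X : smoothVF (modelB C).U}
    (hX : (modelB C).IsKilling X) : ∃ a b c e : ℝ,
      X = (c • scaleVF C + e • vertVF C) + (a • eulerVF C + b • transVF C) := by
  obtain ⟨w0, w1⟩ := jet_relations_of_vanishing hV hr hX
  obtain ⟨s0, s1, s2, s3⟩ := scaleVF_jets (C := C)
  obtain ⟨t0, t1, t2, t3, t4⟩ := vertVF_jets (C := C)
  -- Four jet coordinates are free. Only E contributes to ∂₂X²; `scaleVF` accounts for the rest of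
  -- X¹, `vertVF` for the rest of ∂₁X² (its own ∂₁-derivative being non-zero), and T for the rest of
  -- X².
  set c := jv X 0 - jd X 1 1
  set e := (jd X 0 1 - c * jd (scaleVF C) 0 1) / jd (vertVF C) 0 1 with he
  rw [eq_div_iff t4] at he
  refine ⟨jd X 1 1, jv X 1 - c * jv (scaleVF C) 1 - e * jv (vertVF C) 1, c, e,
    eq_of_jets hX ((modelB C).killing.add_mem
      (isKilling_comb (isKilling_scaleVF hV) (isKilling_vertVF hV))
      (isKilling_comb (isKilling_eulerVF C) (isKilling_transVF C))) ?_ ?_⟩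
  · intro k
    rw [jv_add, jv_add, jv_add, jv_smul, jv_smul, jv_smul, jv_smul, jv_eulerVF, jv_transVF]
    fin_cases k
    · simp [s0, t0, basePt, c]
    · simp [basePt]
  · intro i k
    rw [jd_add, jd_add, jd_add, jd_smul, jd_smul, jd_smul, jd_smul, jd_eulerVF, jd_transVF]
    fin_cases i <;> fin_cases k
    · simp [s1, t1, w1, c]
    · simp; linarith
    · simp [s2, t2, w0]
    · simp [s3, t3]

end VanishingStructure

/-! ### Bases of the space of Killing fields -/

section Bases

variable {C : Coeffs}

/-- E and T are always there, so S lists only the additional fields. The dimensions two, three and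
four are the cases of S empty, a single special field, and the pair `scaleVF`, `vertVF`. -/
theorem killing_basis {ι : Type*} [Fintype ι] (S : ι → smoothVF (modelB C).U)
    (hS : ∀ i, (modelB C).IsKilling (S i))
    (hli : ∀ (c : ι → ℝ) (a b : ℝ),
      ∑ i, c i • S i + (a • eulerVF C + b • transVF C) = 0 → (∀ i, c i = 0) ∧ a = 0 ∧ b = 0)
    (hsp : ∀ X, (modelB C).IsKilling X → ∃ (c : ι → ℝ) (a b : ℝ),
      X = ∑ i, c i • S i + (a • eulerVF C + b • transVF C)) :
    KillingIs C (Set.range fun i => (S i).1) ∧ dimK C = Fintype.card ι + 2 ∧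
      ∃ B : Module.Basis (ι ⊕ Fin 2) ℝ (modelB C).killing,
        ∀ i, (B i).1 = Sum.elim S ![eulerVF C, transVF C] i := by
  have hb : ∀ i, (modelB C).IsKilling (Sum.elim S ![eulerVF C, transVF C] i) := by
    rintro (i | i)
    · exact hS i
    · fin_cases i
      exacts [isKilling_eulerVF C, isKilling_transVF C]
  set b : ι ⊕ Fin 2 → (modelB C).killing := fun i => ⟨Sum.elim S ![eulerVF C, transVF C] i, hb i⟩
    with hbdef
  have hsum : ∀ g : ι ⊕ Fin 2 → ℝ, ((∑ i, g i • b i : (modelB C).killing) : smoothVF _) =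
      ∑ i, g (.inl i) • S i + (g (.inr 0) • eulerVF C + g (.inr 1) • transVF C) := by
    intro g
    rw [show ((∑ i, g i • b i : (modelB C).killing) : smoothVF _) =
      (modelB C).killing.toSubmodule.subtype (∑ i, g i • b i) from rfl, map_sum,
      Fintype.sum_sum_type, Fin.sum_univ_two]
    rfl
  have li : LinearIndependent ℝ b := by
    rw [Fintype.linearIndependent_iff]
    intro g hg
    have h := hsum g
    rw [hg] at h
    obtain ⟨h1, h2, h3⟩ := hli _ _ _ h.symm
    rintro (i | i)
    · exact h1 i
    · fin_cases i
      exacts [h2, h3]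
  have sp : ⊤ ≤ Submodule.span ℝ (Set.range b) := by
    intro X _
    obtain ⟨c, a, a', hX⟩ := hsp X.1 X.2
    have : X = ∑ i, Sum.elim c ![a, a'] i • b i := by
      apply Subtype.ext
      rw [hsum, hX]
      rfl
    rw [this]
    exact Submodule.sum_mem _ fun i _ =>
      Submodule.smul_mem _ _ (Submodule.subset_span ⟨i, rfl⟩)
  let B := Module.Basis.mk li sp
  have hB : ∀ i, (B i).1 = Sum.elim S ![eulerVF C, transVF C] i := fun i => by
    rw [Module.Basis.mk_apply]
  refine ⟨?_, ?_, B, hB⟩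
  · let L : (modelB C).killing →ₗ[ℝ] (Plane → Plane) :=
      (smoothVF (modelB C).U).subtype.comp (modelB C).killing.toSubmodule.subtype
    have hL : Function.Injective L :=
      (Subtype.val_injective (p := (· ∈ smoothVF (modelB C).U))).comp Subtype.val_injective
    have li' : LinearIndependent ℝ (L ∘ b) := li.map' L (LinearMap.ker_eq_bot.2 hL)
    have hr : Set.range ((L ∘ b) ∘ Sum.inr) =
        {field fun x => ![x 0, x 1], field fun _ => ![0, 1]} := by
      ext F
      constructor
      · rintro ⟨i, rfl⟩
        fin_cases i
        exacts [Or.inl rfl, Or.inr rfl]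
      · rintro (rfl | rfl)
        exacts [⟨0, rfl⟩, ⟨1, rfl⟩]
    have hl : Set.range ((L ∘ b) ∘ Sum.inl) = Set.range fun i => (S i).1 := rfl
    have hd := (linearIndependent_sum.1 li').2.2
    rw [hr, hl] at hd
    refine ⟨?_, hd⟩
    have h1 : (modelB C).killingSpace = LinearMap.range L := by
      rw [LinearMap.range_comp, Submodule.range_subtype]; rfl
    rw [h1, ← hl, K0, ← hr, ← Submodule.span_union, ← Set.Sum.elim_range, Sum.elim_comp_inl_inr,
      LinearMap.range_eq_map, ← top_le_iff.1 sp, Submodule.map_span, ← Set.range_comp]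
  · rw [dimK, Module.finrank_eq_card_basis B]
    simp

theorem two_le_dimK (C : Coeffs) : 2 ≤ dimK C := by
  have li : LinearIndependent ℝ (![⟨eulerVF C, isKilling_eulerVF C⟩,
      ⟨transVF C, isKilling_transVF C⟩] : Fin 2 → (modelB C).killing) := by
    rw [LinearIndependent.pair_iff]
    intro s t h
    have h' : s • eulerVF C + t • transVF C = 0 := congrArg Subtype.val h
    have h0 : jv (s • eulerVF C + t • transVF C) 0 = 0 := by rw [h', jv_zero]
    have h1 : jv (s • eulerVF C + t • transVF C) 1 = 0 := by rw [h', jv_zero]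
    rw [jv_add, jv_smul, jv_smul, jv_eulerVF, jv_transVF] at h0 h1
    simp [basePt] at h0 h1
    exact ⟨h0, h1⟩
  have h := li.fintype_card_le_finrank
  rwa [Fintype.card_fin] at h

theorem killingIs_of_vanishing (hV : Vanishing C)
    (hr : (1 + C.c 0 0 0 - C.c 0 1 1) * C.c 0 1 1 ≠ 0) :
    KillingIs C {(scaleVF C).1, (vertVF C).1} ∧ dimK C = 4 := by
  obtain ⟨h1, h2, -⟩ := killing_basis (C := C) ![scaleVF C, vertVF C]
    (by intro i; fin_cases i; exacts [isKilling_scaleVF hV, isKilling_vertVF hV]) (by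
      intro c a b h
      rw [Fin.sum_univ_two] at h
      simp only [Matrix.cons_val_zero, Matrix.cons_val_one] at h
      obtain ⟨s0, s1, s2, s3⟩ := scaleVF_jets (C := C)
      obtain ⟨t0, t1, t2, t3, t4⟩ := vertVF_jets (C := C)
      have g0 := congrArg (fun X => jv X 0) h
      have g1 := congrArg (fun X => jv X 1) h
      have g2 := congrArg (fun X => jd X 0 1) h
      have g3 := congrArg (fun X => jd X 1 1) h
      simp only [jv_add, jd_add, jv_smul, jd_smul, jv_eulerVF, jd_eulerVF, jv_transVF, jd_transVF,
        jv_zero, jd_zero, s0, s3, t0, t3] at g0 g1 g2 g3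
      simp [basePt] at g0 g1 g2 g3
      have c0 : c 0 = 0 := by linarith
      have c1 : c 1 = 0 := by simpa [c0, t4] using g2
      refine ⟨?_, g3, by simpa [c0, c1] using g1⟩
      intro i; fin_cases i
      exacts [c0, c1]) (by
      intro X hX
      obtain ⟨a, b, c, e, h⟩ := killing_structure_of_vanishing hV hr hX
      exact ⟨![c, e], a, b, by rw [h, Fin.sum_univ_two]; rfl⟩)
  refine ⟨?_, by simpa using h2⟩
  convert h1 using 1
  ext F
  constructor
  · rintro (rfl | rfl)
    exacts [⟨0, rfl⟩, ⟨1, rfl⟩]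
  · rintro ⟨i, rfl⟩
    fin_cases i
    exacts [Or.inl rfl, Or.inr rfl]

theorem dimK_eq_two (h : ∀ X, (modelB C).IsKilling X →
    ∃ a b : ℝ, X = a • eulerVF C + b • transVF C) : dimK C = 2 := by
  obtain ⟨-, h2, -⟩ := killing_basis (C := C) (Fin.elim0 : Fin 0 → _) (fun i => i.elim0) (by
      intro c a b h
      rw [Finset.univ_eq_empty, Finset.sum_empty, zero_add] at h
      have g0 := congrArg (fun X => jv X 0) h
      have g1 := congrArg (fun X => jv X 1) h
      simp only [jv_add, jv_smul, jv_eulerVF, jv_transVF, jv_zero] at g0 g1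
      simp [basePt] at g0 g1
      exact ⟨fun i => i.elim0, g0, g1⟩) (by
      intro X hX
      obtain ⟨a, b, h⟩ := h X hX
      exact ⟨fun i => i.elim0, a, b, by simpa using h⟩)
  simpa using h2

theorem IsSpecial.killing_basis {X : smoothVF (modelB C).U} (hX : IsSpecial X)
    (h : ∀ Z, (modelB C).IsKilling Z →
      ∃ a b c : ℝ, Z = a • eulerVF C + b • transVF C + c • X) :
    KillingIs C {X.1} ∧ dimK C = 3 ∧
      ∃ B : Module.Basis (Fin 1 ⊕ Fin 2) ℝ (modelB C).killing,
        (B (.inl 0)).1 = X ∧ (B (.inr 0)).1 = eulerVF C ∧ (B (.inr 1)).1 = transVF C := by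
  obtain ⟨h1, h2, B, hB⟩ := _root_.killing_basis (C := C) (fun _ : Fin 1 => X)
    (fun _ => hX.isKilling) (by
      intro c a b h
      rw [Fin.sum_univ_one] at h
      have g0 := congrArg (fun X => jv X 0) h
      have g1 := congrArg (fun X => jv X 1) h
      have g2 := congrArg (fun X => jd X 1 0) h
      simp only [jv_add, jd_add, jv_smul, jd_smul, jv_eulerVF, jd_eulerVF, jv_transVF, jd_transVF,
        jv_zero, jd_zero, hX.jd_one_zero] at g0 g1 g2
      simp [basePt] at g0 g1 g2
      refine ⟨?_, by simpa [g2] using g0, by simpa [g2] using g1⟩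
      intro i; fin_cases i; exact g2) (by
      intro Z hZ
      obtain ⟨a, b, c, h⟩ := h Z hZ
      exact ⟨fun _ => c, a, b, by rw [h, Fin.sum_univ_one]; abel⟩)
  refine ⟨?_, by simpa using h2, B, hB _, hB _, hB _⟩
  rwa [Set.range_const] at h1

end Bases

/-! ### The Lie algebra `𝔰𝔲(1,1)` -/

section SpecialUnitary

attribute [local instance] LieRing.ofAssociativeRing

/-- Both sides of the bracket identity are bilinear, so pairs of basis vectors suffice. -/
theorem LieEquiv.nonempty_of_bases {L L' ι : Type*} [LieRing L] [LieAlgebra ℝ L] [LieRing L']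
    [LieAlgebra ℝ L'] (b : Module.Basis ι ℝ L) (e : L ≃ₗ[ℝ] L')
    (h : ∀ i j, e ⁅b i, b j⁆ = ⁅e (b i), e (b j)⁆) : Nonempty (L ≃ₗ⁅ℝ⁆ L') := by
  let f : L →ₗ[ℝ] L →ₗ[ℝ] L' := LinearMap.mk₂ ℝ (fun x y => e ⁅x, y⁆) (by simp) (by simp) (by simp)
    (by simp)
  let g : L →ₗ[ℝ] L →ₗ[ℝ] L' := LinearMap.mk₂ ℝ (fun x y => ⁅e x, e y⁆) (by simp) (by simp)
    (by simp) (by simp)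
  have hfg : f = g := b.ext fun i => b.ext fun j => h i j
  exact ⟨{ e with map_lie' := fun {x y} => LinearMap.congr_fun₂ hfg x y }⟩

theorem mem_su11_iff {A : Matrix (Fin 2) (Fin 2) ℂ} : A ∈ su11 ↔
    (A 0 0).re = 0 ∧ A 1 1 = -A 0 0 ∧ A 1 0 = star (A 0 1) := by
  have h : A ∈ su11 ↔ A.trace = 0 ∧
    A.conjTranspose * Matrix.diagonal ![1, -1] + Matrix.diagonal ![1, -1] * A = 0 := Iff.rfl
  rw [h, Matrix.trace_fin_two, ← Matrix.ext_iff]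
  simp [Fin.forall_fin_two, Complex.ext_iff, Matrix.mul_diagonal, Matrix.diagonal_mul]
  constructor
  · rintro ⟨⟨h1, h2⟩, ⟨h3, h4, h5⟩, -, h6⟩
    exact ⟨h3, ⟨by linarith, by linarith⟩, by linarith, by linarith⟩
  · rintro ⟨h1, ⟨h2, h3⟩, h4, h5⟩
    rw [h1] at h2
    simp [h1, h2, h3, h4, h5]

/-- The linear equivalence of `ℝ³` and `𝔰𝔲(1,1)` for which the images `x, e, y` of the
basis satisfy `[y, e] = y`, `[y, x] = 2 e` and `[e, x] = x`. -/
noncomputable def su11Equiv : (Fin 1 ⊕ Fin 2 → ℝ) ≃ₗ[ℝ] su11 where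
  toFun c := ⟨!![⟨0, c (.inl 0) / 4 + c (.inr 1)⟩, ⟨c (.inr 0) / 2, -c (.inl 0) / 4 + c (.inr 1)⟩;
    ⟨c (.inr 0) / 2, c (.inl 0) / 4 - c (.inr 1)⟩, ⟨0, -c (.inl 0) / 4 - c (.inr 1)⟩], by
    rw [mem_su11_iff]
    simp [Complex.ext_iff]
    constructor <;> ring⟩
  map_add' c c' := by
    apply Subtype.ext
    ext i j
    fin_cases i <;> fin_cases j <;> simp [Complex.ext_iff] <;> ring_nf <;> simp
  map_smul' a c := by
    apply Subtype.ext
    ext i j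
    fin_cases i <;> fin_cases j <;> simp [Complex.ext_iff] <;> ring_nf <;> simp
  invFun A := Sum.elim (fun _ => 2 * ((A.1 0 0).im - (A.1 0 1).im))
    ![2 * (A.1 0 1).re, ((A.1 0 0).im + (A.1 0 1).im) / 2]
  left_inv c := by
    funext i
    rcases i with i | i <;> fin_cases i <;> simp <;> ring
  right_inv A := by
    obtain ⟨h1, h2, h3⟩ := mem_su11_iff.1 A.2
    apply Subtype.ext
    ext i j
    fin_cases i <;> fin_cases j <;> simp [Complex.ext_iff, h1, h2, h3] <;> ring_nf

theorem su11Equiv_inl : (su11Equiv (Pi.single (.inl 0) 1)).1 =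
    !![⟨0, 1 / 4⟩, ⟨0, -1 / 4⟩; ⟨0, 1 / 4⟩, ⟨0, -1 / 4⟩] := by
  ext i j
  fin_cases i <;> fin_cases j <;> simp [su11Equiv]

theorem su11Equiv_inr_zero : (su11Equiv (Pi.single (.inr 0) 1)).1 =
    !![0, ⟨1 / 2, 0⟩; ⟨1 / 2, 0⟩, 0] := by
  ext i j
  fin_cases i <;> fin_cases j <;> simp [su11Equiv, Complex.ext_iff]

theorem su11Equiv_inr_one : (su11Equiv (Pi.single (.inr 1) 1)).1 =
    !![⟨0, 1⟩, ⟨0, 1⟩; ⟨0, -1⟩, ⟨0, -1⟩] := by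
  ext i j
  fin_cases i <;> fin_cases j <;> simp [su11Equiv]

theorem su11_bracket_zero_inl :
    ⁅su11Equiv (Pi.single (.inr 0) 1), su11Equiv (Pi.single (.inl 0) 1)⁆ =
      su11Equiv (Pi.single (.inl 0) 1) := by
  apply Subtype.ext
  rw [LieSubalgebra.coe_bracket, Ring.lie_def, su11Equiv_inl, su11Equiv_inr_zero]
  ext i j
  fin_cases i <;> fin_cases j <;> simp [Complex.ext_iff] <;> norm_num

theorem su11_bracket_one_inl :
    ⁅su11Equiv (Pi.single (.inr 1) 1), su11Equiv (Pi.single (.inl 0) 1)⁆ =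
      (2 : ℝ) • su11Equiv (Pi.single (.inr 0) 1) := by
  apply Subtype.ext
  change ⁅(su11Equiv (Pi.single (.inr 1) 1)).1, (su11Equiv (Pi.single (.inl 0) 1)).1⁆ =
    (2 : ℝ) • (su11Equiv (Pi.single (.inr 0) 1)).1
  rw [Ring.lie_def, su11Equiv_inl, su11Equiv_inr_zero, su11Equiv_inr_one]
  ext i j
  fin_cases i <;> fin_cases j <;> simp [Complex.ext_iff] <;> norm_num

theorem su11_bracket_one_zero :
    ⁅su11Equiv (Pi.single (.inr 1) 1), su11Equiv (Pi.single (.inr 0) 1)⁆ =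
      su11Equiv (Pi.single (.inr 1) 1) := by
  apply Subtype.ext
  rw [LieSubalgebra.coe_bracket, Ring.lie_def, su11Equiv_inr_zero, su11Equiv_inr_one]
  ext i j
  fin_cases i <;> fin_cases j <;> simp [Complex.ext_iff] <;> norm_num

theorem IsSpecial.nonempty_lieEquiv {C : Coeffs} {X : smoothVF (modelB C).U} (hX : IsSpecial X)
    {B : Module.Basis (Fin 1 ⊕ Fin 2) ℝ (modelB C).killing} (h0 : (B (.inl 0)).1 = X)
    (h1 : (B (.inr 0)).1 = eulerVF C) (h2 : (B (.inr 1)).1 = transVF C) :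
    Nonempty ((modelB C).killing ≃ₗ⁅ℝ⁆ su11) := by
  obtain ⟨e, he⟩ : ∃ e : (modelB C).killing ≃ₗ[ℝ] su11,
      ∀ i, e (B i) = su11Equiv (Pi.single i 1) := by
    refine ⟨B.equivFun.trans su11Equiv, fun i => ?_⟩
    rw [LinearEquiv.trans_apply]
    congr 1
    funext j
    rw [Module.Basis.equivFun_self, Pi.single_apply]
    simp [eq_comm]
  have b10 : ⁅B (.inr 0), B (.inl 0)⁆ = B (.inl 0) := Subtype.ext (by
    change ⁅(B (.inr 0)).1, (B (.inl 0)).1⁆ = (B (.inl 0)).1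
    rw [h0, h1, hX.euler])
  have b20 : ⁅B (.inr 1), B (.inl 0)⁆ = (2 : ℝ) • B (.inr 0) := Subtype.ext (by
    change ⁅(B (.inr 1)).1, (B (.inl 0)).1⁆ = (2 : ℝ) • (B (.inr 0)).1
    rw [h0, h1, h2, hX.trans])
  have b21 : ⁅B (.inr 1), B (.inr 0)⁆ = B (.inr 1) := Subtype.ext (by
    change ⁅(B (.inr 1)).1, (B (.inr 0)).1⁆ = (B (.inr 1)).1
    rw [h1, h2, bracket_transVF_eulerVF])
  have key : ∀ i j, e ⁅B i, B j⁆ = ⁅e (B i), e (B j)⁆ → e ⁅B j, B i⁆ = ⁅e (B j), e (B i)⁆ := by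
    intro i j h
    rw [← lie_skew, map_neg, h, lie_skew]
  have k10 : e ⁅B (.inr 0), B (.inl 0)⁆ = ⁅e (B (.inr 0)), e (B (.inl 0))⁆ := by
    rw [b10, he, he, su11_bracket_zero_inl]
  have k20 : e ⁅B (.inr 1), B (.inl 0)⁆ = ⁅e (B (.inr 1)), e (B (.inl 0))⁆ := by
    rw [b20, map_smul, he, he, he, su11_bracket_one_inl]
  have k21 : e ⁅B (.inr 1), B (.inr 0)⁆ = ⁅e (B (.inr 1)), e (B (.inr 0))⁆ := by
    rw [b21, he, he, su11_bracket_one_zero]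
  have kself : ∀ i, e ⁅B i, B i⁆ = ⁅e (B i), e (B i)⁆ := fun i => by
    rw [lie_self, lie_self, map_zero]
  refine LieEquiv.nonempty_of_bases B e ?_
  rw [Sum.forall]
  simp only [Sum.forall, Fin.forall_fin_two, Fin.forall_fin_one]
  exact ⟨⟨kself _, key _ _ k10, key _ _ k20⟩, ⟨k10, kself _, key _ _ k21⟩, k20, k21, kself _⟩

end SpecialUnitary

/-! ### Curvature and Ricci tensor of the models -/

/-- The Ricci form of the connection `h C` at points where `h = 1` and `dh = -ε dx¹`. -/
def ricciEps (C : Coeffs) (ε : ℝ) : Fin 2 → Fin 2 → ℝ :=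
  ![fun k => C.c 0 1 1 * C.c 0 k 0 + C.c 1 1 1 * C.c 0 k 1 + ε * C.c 1 k 1 -
      (C.c 1 k 0 * C.c 0 0 1 + C.c 1 k 1 * C.c 0 1 1),
    fun k => C.c 1 k 0 * C.c 0 0 0 + C.c 1 k 1 * C.c 0 1 0 - ε * C.c 1 k 0 -
      (C.c 0 k 0 * C.c 0 1 0 + C.c 0 k 1 * C.c 1 1 0)]

theorem ricciEps_one (C : Coeffs) : ricciEps C 1 = ricciConst C := by
  funext i k
  fin_cases i <;> simp [ricciEps, ricciConst]

/-- The bilinear form with the given matrix. -/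
def formOf (r : Fin 2 → Fin 2 → ℝ) (v w : Plane) : ℝ :=
  r 0 0 * v 0 * w 0 + r 0 1 * v 0 * w 1 + r 1 0 * v 1 * w 0 + r 1 1 * v 1 * w 1

/-- The connection of `M` is given by `h C`, where `dh = -ε h² dx¹`. -/
structure IsModel (M : AffineSurface) (C : Coeffs) (ε : ℝ) (h : Plane → ℝ) : Prop where
  conn : ∀ p v w, M.conn p v w = h p • C.bil v w
  deriv : ∀ p ∈ M.U, HasFDerivAt h
    ((-(ε * h p ^ 2)) • (ContinuousLinearMap.proj 0 : Plane →L[ℝ] ℝ)) p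

theorem isModel_modelB (C : Coeffs) : IsModel (modelB C) C 1 fun p => (p 0)⁻¹ where
  conn := conn_modelB C
  deriv p hp := by
    have h := hasFDerivAt_inv_fst (p := p) hp
    rwa [← inv_pow, ← one_mul ((p 0)⁻¹ ^ 2)] at h

theorem isModel_modelA (C : Coeffs) : IsModel (modelA C) C 0 fun _ => 1 where
  conn p v w := by rw [conn_modelA, one_smul]
  deriv p _ := by
    simpa using hasFDerivAt_const (1 : ℝ) p

/-- The curvature of a model at points where `h = 1`. -/
noncomputable def curvEps (C : Coeffs) (ε : ℝ) (u v w : Plane) : Plane :=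
  -(ε * u 0) • C.bil v w + (ε * v 0) • C.bil u w + (C.bil u (C.bil v w) - C.bil v (C.bil u w))

/-- In dimension two the curvature is R(∂₁, ∂₂)w alone, a vector whose two components are ρ(∂₂, w)
and -ρ(∂₁, w). Keeping ε as a parameter treats constant Christoffel symbols (ε = 0) and 1/x¹ times
constants (ε = 1) together. -/
theorem curvEps_eq (C : Coeffs) (ε : ℝ) (u v w : Plane) :
    curvEps C ε u v w = formOf (ricciEps C ε) v w • u - formOf (ricciEps C ε) u w • v := by
  have s0 := C.symm 1 0 0
  have s1 := C.symm 1 0 1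
  ext k
  fin_cases k <;>
  · simp [curvEps, C.bil_apply, formOf, ricciEps, s0, s1]
    ring

/-- The covariant derivative of the Ricci tensor of a model at points where `h = 1`. -/
noncomputable def nablaRicciEps (C : Coeffs) (ε : ℝ) (u v w : Plane) : ℝ :=
  -(2 * ε * u 0) * formOf (ricciEps C ε) v w - formOf (ricciEps C ε) (C.bil u v) w -
    formOf (ricciEps C ε) v (C.bil u w)

theorem curvature_modelB (C : Coeffs) {p : Plane} (hp : p ∈ halfPlane) (i j k : Fin 2) :
    (modelB C).curvature (coordField i) (coordField j) (coordField k) p =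
      (p 0 ^ 2)⁻¹ • (ricciConst C j k • coordField i p - ricciConst C i k • coordField j p) := by
  have e : ∀ v w : Plane, (modelB C).nabla (fun _ => v) (fun _ => w) =
      fun q => (q 0)⁻¹ • C.bil v w := fun v w => by
    funext q
    rw [nabla, conn_modelB]; simp
  have e2 : ∀ u v w : Plane, (modelB C).nabla (fun _ => u)
      ((modelB C).nabla (fun _ => v) (fun _ => w)) p =
      (p 0 ^ 2)⁻¹ • (-(u 0) • C.bil v w + C.bil u (C.bil v w)) := fun u v w => by
    rw [e, nabla, conn_modelB, ((hasFDerivAt_inv_fst hp).smul_const (C.bil v w)).fderiv]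
    simp only [ContinuousLinearMap.smulRight_apply, smul_apply, ContinuousLinearMap.proj_apply,
      map_smul, smul_smul, smul_add, smul_eq_mul]
    rw [← mul_inv, ← sq]
    module
  have e3 : VectorField.lieBracket ℝ (coordField i) (coordField j) = 0 := by
    have h : ∀ (i : Fin 2) (q : Plane), fderiv ℝ (coordField i) q = 0 := fun i q =>
      fderiv_const_apply _
    funext q
    simp [VectorField.lieBracket, h]
  have e4 : (modelB C).nabla 0 (coordField k) p = 0 := nabla_eq_zero _ _ _ rfl
  rw [curvature, e3, Pi.sub_apply, Pi.sub_apply, e4, sub_zero]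
  have h := curvEps_eq C 1 (Pi.single i 1) (Pi.single j 1) (Pi.single k 1)
  have hf : ∀ i j : Fin 2, formOf (ricciEps C 1) (Pi.single i 1) (Pi.single j 1) =
      ricciConst C i j := fun i j => by
    rw [ricciEps_one]
    fin_cases i <;> fin_cases j <;> simp [formOf]
  rw [hf, hf] at h
  refine Eq.trans (congrArg₂ (· - ·) (e2 (Pi.single i 1) (Pi.single j 1) (Pi.single k 1))
    (e2 (Pi.single j 1) (Pi.single i 1) (Pi.single k 1))) ?_
  change _ = (p 0 ^ 2)⁻¹ • (ricciConst C j k • (Pi.single i 1 : Plane) -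
    ricciConst C i k • (Pi.single j 1 : Plane))
  rw [← h, curvEps, ← smul_sub]
  congr 1
  module

theorem ricci_modelB (C : Coeffs) {p : Plane} (hp : p ∈ halfPlane) (i j : Fin 2) :
    (modelB C).ricci p i j = (p 0 ^ 2)⁻¹ * ricciConst C i j := by
  simp only [ricci, curvature_modelB C hp, Fin.sum_univ_two]
  fin_cases i <;> simp [coordField]

theorem isFlat_modelB_iff (C : Coeffs) :
    (modelB C).IsFlat ↔ ∀ i j, ricciConst C i j = 0 := by
  constructor
  · intro h i j
    have h1 := ricci_modelB C basePt_mem i j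
    have hb : basePt 0 = 1 := rfl
    rw [ricci, hb] at h1
    simp only [h basePt basePt_mem] at h1
    simpa using h1.symm
  · intro h p hp i j k
    rw [curvature_modelB C hp, h, h]
    simp

/-! ### Affine maps preserve the Ricci tensor and its covariant derivative -/

theorem formOf_add_left (r : Fin 2 → Fin 2 → ℝ) (v v' w : Plane) :
    formOf r (v + v') w = formOf r v w + formOf r v' w := by simp [formOf]; ring

theorem formOf_smul_left (r : Fin 2 → Fin 2 → ℝ) (a : ℝ) (v w : Plane) :
    formOf r (a • v) w = a * formOf r v w := by simp [formOf]; ring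

theorem formOf_add_right (r : Fin 2 → Fin 2 → ℝ) (v w w' : Plane) :
    formOf r v (w + w') = formOf r v w + formOf r v w' := by simp [formOf]; ring

theorem formOf_smul_right (r : Fin 2 → Fin 2 → ℝ) (a : ℝ) (v w : Plane) :
    formOf r v (a • w) = a * formOf r v w := by simp [formOf]; ring

theorem formOf_sub_left (r : Fin 2 → Fin 2 → ℝ) (v v' w : Plane) :
    formOf r (v - v') w = formOf r v w - formOf r v' w := by simp [formOf]; ring

theorem formOf_sub_right (r : Fin 2 → Fin 2 → ℝ) (v w w' : Plane) :
    formOf r v (w - w') = formOf r v w - formOf r v w' := by simp [formOf]; ring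

theorem HasFDerivAt.formOf {r : Fin 2 → Fin 2 → ℝ} {a b : Plane → Plane}
    {a' b' : Plane →L[ℝ] Plane} {p : Plane} (ha : HasFDerivAt a a' p) (hb : HasFDerivAt b b' p)
    (u : Plane) : fderiv ℝ (fun q => _root_.formOf r (a q) (b q)) p u =
      _root_.formOf r (a' u) (b p) + _root_.formOf r (a p) (b' u) ∧
      DifferentiableAt ℝ (fun q => _root_.formOf r (a q) (b q)) p := by
  have ha0 := hasFDerivAt_pi'.1 ha 0
  have ha1 := hasFDerivAt_pi'.1 ha 1
  have hb0 := hasFDerivAt_pi'.1 hb 0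
  have hb1 := hasFDerivAt_pi'.1 hb 1
  have h := ((((ha0.const_mul (r 0 0)).fun_mul hb0).fun_add
    ((ha0.const_mul (r 0 1)).fun_mul hb1)).fun_add
    ((ha1.const_mul (r 1 0)).fun_mul hb0)).fun_add ((ha1.const_mul (r 1 1)).fun_mul hb1)
  refine ⟨?_, h.differentiableAt⟩
  rw [show (fun q => _root_.formOf r (a q) (b q)) = _ from rfl]
  refine (congrArg (· u) h.fderiv).trans ?_
  simp [_root_.formOf]
  ring

section Transport

variable {M N : AffineSurface} {CM CN : Coeffs} {εM εN : ℝ} {hM hN : Plane → ℝ}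
  {f : Plane → Plane} {V : Opens Plane}

theorem fderiv_fderiv_of_isAffineMap (mM : IsModel M CM εM hM) (mN : IsModel N CN εN hN)
    (hf : ContDiffOn ℝ ∞ f V) (haff : IsAffineMap M N f V) {p : Plane} (hp : p ∈ V)
    (v w : Plane) : fderiv ℝ (fderiv ℝ f) p v w =
      hM p • fderiv ℝ f p (CM.bil v w) -
        hN (f p) • CN.bil (fderiv ℝ f p v) (fderiv ℝ f p w) := by
  have c1 : ContDiffAt ℝ ∞ (fderiv ℝ f) p :=
    (hf.contDiffAt (V.isOpen.mem_nhds hp)).fderiv_right (m := ∞) (by simp)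
  have h := haff p hp v w
  rw [fderiv_fderiv_apply (c1.differentiableAt (by simp)), mM.conn, mN.conn, map_smul] at h
  rw [← h]; abel

/-- The transformation law gives D²f; differentiating it once more gives D³f, where dh = -ε h² dx¹
produces the ε-terms. Symmetry of D³f in its first two arguments, after D²f is replaced by the law,
is the invariance of curvature. -/
theorem curvEps_of_isAffineMap (mM : IsModel M CM εM hM) (mN : IsModel N CN εN hN)
    (hf : ContDiffOn ℝ ∞ f V) (hVM : V ≤ M.U) (hVN : ∀ p ∈ V, f p ∈ N.U)
    (haff : IsAffineMap M N f V) {p : Plane} (hp : p ∈ V) (u v w : Plane) :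
    hN (f p) ^ 2 • curvEps CN εN (fderiv ℝ f p u) (fderiv ℝ f p v) (fderiv ℝ f p w) =
      hM p ^ 2 • fderiv ℝ f p (curvEps CM εM u v w) := by
  have c0 : ∀ q ∈ V, ContDiffAt ℝ ∞ f q := fun q hq => hf.contDiffAt (V.isOpen.mem_nhds hq)
  have c1 : ∀ q ∈ V, ContDiffAt ℝ ∞ (fderiv ℝ f) q := fun q hq =>
    (c0 q hq).fderiv_right (m := ∞) (by simp)
  have c2 : ContDiffAt ℝ ∞ (fderiv ℝ (fderiv ℝ f)) p := (c1 p hp).fderiv_right (m := ∞) (by simp)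
  have d0 : ∀ q ∈ V, HasFDerivAt f (fderiv ℝ f q) q := fun q hq =>
    ((c0 q hq).differentiableAt (by simp)).hasFDerivAt
  have d1 : ∀ q ∈ V, HasFDerivAt (fderiv ℝ f) (fderiv ℝ (fderiv ℝ f) q) q := fun q hq =>
    ((c1 q hq).differentiableAt (by simp)).hasFDerivAt
  have d2 := (c2.differentiableAt (by simp)).hasFDerivAt
  have haff' : ∀ q ∈ V, ∀ v w, fderiv ℝ (fderiv ℝ f) q v w =
      hM q • fderiv ℝ f q (CM.bil v w) -
        hN (f q) • CN.bil (fderiv ℝ f q v) (fderiv ℝ f q w) := fun q hq v w =>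
    fderiv_fderiv_of_isAffineMap mM mN hf haff hq v w
  have third : ∀ u v w, fderiv ℝ (fderiv ℝ (fderiv ℝ f)) p u v w =
      hM p • fderiv ℝ (fderiv ℝ f) p u (CM.bil v w) -
        (εM * hM p ^ 2 * u 0) • fderiv ℝ f p (CM.bil v w) -
      hN (f p) • (CN.bil (fderiv ℝ (fderiv ℝ f) p u v) (fderiv ℝ f p w) +
        CN.bil (fderiv ℝ f p v) (fderiv ℝ (fderiv ℝ f) p u w)) +
      (εN * hN (f p) ^ 2 * fderiv ℝ f p u 0) • CN.bil (fderiv ℝ f p v) (fderiv ℝ f p w) := by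
    intro u v w
    have l1 := (d2.clm_apply (hasFDerivAt_const v p)).clm_apply (hasFDerivAt_const w p)
    have a1 := (d1 p hp).clm_apply (hasFDerivAt_const (CM.bil v w) p)
    have a2 := (mM.deriv p (hVM hp)).fun_smul a1
    have b1 := (d1 p hp).clm_apply (hasFDerivAt_const v p)
    have b2 := (d1 p hp).clm_apply (hasFDerivAt_const w p)
    have b3 := CN.bil.hasFDerivAt_of_bilinear b1 b2
    have b4 := HasFDerivAt.comp p (g := hN) (mN.deriv _ (hVN p hp)) (d0 p hp)
    have b5 := b4.fun_smul b3
    have r1 := a2.fun_sub b5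
    have ev : (fun q => fderiv ℝ (fderiv ℝ f) q v w) =ᶠ[nhds p] fun q =>
        hM q • fderiv ℝ f q (CM.bil v w) -
        (hN ∘ f) q • CN.bil (fderiv ℝ f q v) (fderiv ℝ f q w) :=
      Filter.eventuallyEq_of_mem (V.isOpen.mem_nhds hp) fun q hq => haff' q hq v w
    have h := congrArg (fun L => L u) (l1.unique (r1.congr_of_eventuallyEq ev))
    simp only [add_apply, sub_apply, smul_apply, ContinuousLinearMap.comp_apply,
      ContinuousLinearMap.smulRight_apply, ContinuousLinearMap.flip_apply, zero_apply, map_zero,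
      zero_add, smul_eq_mul, ContinuousLinearMap.proj_apply,
      ContinuousLinearMap.precompR_apply, ContinuousLinearMap.precompL_apply,
      ContinuousLinearMap.compL_apply, Function.comp_apply] at h
    rw [h]
    module
  have sym3 : fderiv ℝ (fderiv ℝ (fderiv ℝ f)) p u v w =
      fderiv ℝ (fderiv ℝ (fderiv ℝ f)) p v u w := by
    have h : IsSymmSndFDerivAt ℝ (fderiv ℝ f) p := (c1 p hp).isSymmSndFDerivAt (by
      simpa using (WithTop.coe_le_coe.2 le_top : ((2 : ℕ∞) : ℕ∞ω) ≤ ∞))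
    rw [h u v]
  have sym2 := haff' p hp
  rw [third, third] at sym3
  simp only [sym2, map_sub, map_smul, sub_apply, smul_apply] at sym3
  simp only [curvEps, map_add, map_sub, map_smul]
  rw [CN.bil_comm (CN.bil (fderiv ℝ f p u) (fderiv ℝ f p v)) (fderiv ℝ f p w),
    CN.bil_comm (CN.bil (fderiv ℝ f p v) (fderiv ℝ f p u)) (fderiv ℝ f p w),
    CN.bil_comm (fderiv ℝ f p v) (fderiv ℝ f p u),
    CM.bil_comm v u] at sym3
  rw [← sub_eq_zero] at sym3 ⊢
  rw [← neg_eq_zero, ← sym3]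
  module

/-- No trace is needed: R(∂₁, ∂₂)w = ρ(∂₂, w)∂₁ - ρ(∂₁, w)∂₂, and injectivity of df permits
comparing the coefficients of df(∂₁) and df(∂₂). -/
theorem ricciEps_of_isAffineMap (mM : IsModel M CM εM hM) (mN : IsModel N CN εN hN)
    (hf : ContDiffOn ℝ ∞ f V) (hVM : V ≤ M.U) (hVN : ∀ p ∈ V, f p ∈ N.U)
    (haff : IsAffineMap M N f V) {p : Plane} (hp : p ∈ V)
    (hinj : Function.Injective (fderiv ℝ f p)) (v w : Plane) :
    hM p ^ 2 * formOf (ricciEps CM εM) v w =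
      hN (f p) ^ 2 * formOf (ricciEps CN εN) (fderiv ℝ f p v) (fderiv ℝ f p w) := by
  have h := curvEps_of_isAffineMap mM mN hf hVM hVN haff hp (Pi.single 0 1) (Pi.single 1 1) w
  rw [curvEps_eq, curvEps_eq] at h
  set a := hN (f p) ^ 2 * formOf (ricciEps CN εN) (fderiv ℝ f p (Pi.single 1 1)) (fderiv ℝ f p w) -
    hM p ^ 2 * formOf (ricciEps CM εM) (Pi.single 1 1) w with ha
  set b := hN (f p) ^ 2 * formOf (ricciEps CN εN) (fderiv ℝ f p (Pi.single 0 1)) (fderiv ℝ f p w) -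
    hM p ^ 2 * formOf (ricciEps CM εM) (Pi.single 0 1) w with hb
  have h2 : fderiv ℝ f p (a • Pi.single 0 1 - b • Pi.single 1 1) = fderiv ℝ f p 0 := by
    simp only [map_sub, map_smul, smul_sub, smul_smul] at h
    rw [map_sub, map_smul, map_smul, map_zero, ha, hb, sub_smul, sub_smul, sub_sub_sub_comm, h,
      sub_self]
  have h3 := hinj h2
  have ha0 : a = 0 := by simpa using congrFun h3 0
  have hb0 : b = 0 := by simpa using congrFun h3 1
  have e := congrArg (fun x => formOf (ricciEps CN εN) x (fderiv ℝ f p w))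
    (congrArg (fderiv ℝ f p) (plane_eq_sum v))
  have e' := congrArg (fun x => formOf (ricciEps CM εM) x w) (plane_eq_sum v)
  simp only [map_add, map_smul, formOf_add_left, formOf_smul_left] at e e'
  rw [e, e']
  linear_combination (-v 0) * (hb.symm.trans hb0) - v 1 * (ha.symm.trans ha0)

/-- The invariance of ρ is differentiated along u; the second derivatives of f are eliminated by the
transformation law and the remaining terms by invariance of ρ itself. -/
theorem nablaRicciEps_of_isAffineMap (mM : IsModel M CM εM hM) (mN : IsModel N CN εN hN)
    (hf : ContDiffOn ℝ ∞ f V) (hVM : V ≤ M.U) (hVN : ∀ p ∈ V, f p ∈ N.U)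
    (haff : IsAffineMap M N f V) (hinj : ∀ p ∈ V, Function.Injective (fderiv ℝ f p))
    {p : Plane} (hp : p ∈ V) (u v w : Plane) :
    hM p ^ 3 * nablaRicciEps CM εM u v w =
      hN (f p) ^ 3 * nablaRicciEps CN εN (fderiv ℝ f p u) (fderiv ℝ f p v) (fderiv ℝ f p w) := by
  have c0 := hf.contDiffAt (V.isOpen.mem_nhds hp)
  have d0 := (c0.differentiableAt (by simp)).hasFDerivAt
  have d1 := ((c0.fderiv_right (m := ∞) (by simp)).differentiableAt (by simp)).hasFDerivAt
  have b1 := d1.clm_apply (hasFDerivAt_const v p)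
  have b2 := d1.clm_apply (hasFDerivAt_const w p)
  obtain ⟨e1, e2⟩ := HasFDerivAt.formOf (r := ricciEps CN εN) b1 b2 u
  have l := ((mM.deriv p (hVM hp)).pow 2).mul_const (formOf (ricciEps CM εM) v w)
  have r := ((HasFDerivAt.comp p (g := hN) (mN.deriv _ (hVN p hp)) d0).pow 2).fun_mul
    e2.hasFDerivAt
  have ev : (fun q => hM q ^ 2 * formOf (ricciEps CM εM) v w) =ᶠ[nhds p] fun q =>
      (hN ∘ f) q ^ 2 * formOf (ricciEps CN εN) (fderiv ℝ f q v) (fderiv ℝ f q w) :=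
    Filter.eventuallyEq_of_mem (V.isOpen.mem_nhds hp) fun q hq =>
      ricciEps_of_isAffineMap mM mN hf hVM hVN haff hq (hinj q hq) v w
  have h := congrArg (fun L => L u) (l.unique (r.congr_of_eventuallyEq ev))
  simp only [add_apply, smul_apply, e1, ContinuousLinearMap.comp_apply,
    ContinuousLinearMap.flip_apply, zero_apply, map_zero, zero_add, smul_eq_mul,
    ContinuousLinearMap.proj_apply, Function.comp_apply,
    fderiv_fderiv_of_isAffineMap mM mN hf haff hp, formOf_sub_left, formOf_sub_right,
    formOf_smul_left, formOf_smul_right] at h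
  have k1 := ricciEps_of_isAffineMap mM mN hf hVM hVN haff hp (hinj p hp) (CM.bil u v) w
  have k2 := ricciEps_of_isAffineMap mM mN hf hVM hVN haff hp (hinj p hp) v (CM.bil u w)
  simp only [nablaRicciEps]
  push_cast at h
  linear_combination h - hM p * k1 - hM p * k2

end Transport

/-! ### Surfaces that are of Type `𝒜` or `𝒞` -/

theorem isAffineMap_of_hasFDerivAt {M N : AffineSurface} {f : Plane → Plane} {V : Set Plane}
    (hV : IsOpen V) {A : Plane → Plane →L[ℝ] Plane} {B : Plane → Plane → Plane →L[ℝ] Plane}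
    (hA : ∀ p ∈ V, HasFDerivAt f (A p) p)
    (hB : ∀ p ∈ V, ∀ w, HasFDerivAt (fun q => A q w) (B p w) p)
    (h : ∀ p ∈ V, ∀ v w, B p w v + N.conn (f p) (A p v) (A p w) = A p (M.conn p v w)) :
    IsAffineMap M N f V := by
  intro p hp v w
  have ev : (fun q => fderiv ℝ f q w) =ᶠ[nhds p] fun q => A q w :=
    Filter.eventuallyEq_of_mem (hV.mem_nhds hp) fun q hq => by simp only [(hA q hq).fderiv]
  rw [ev.fderiv_eq, (hB p hp w).fderiv, (hA p hp).fderiv, h p hp]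

/-- The homeomorphism `x ↦ t x + (0, b)` of the half plane. -/
noncomputable def dilation (t b : ℝ) (ht : 0 < t) : OpenPartialHomeomorph Plane Plane where
  toFun x := t • x + b • Pi.single 1 1
  invFun x := t⁻¹ • (x - b • Pi.single 1 1)
  source := halfPlane
  target := halfPlane
  map_source' x hx := by
    rw [SetLike.mem_coe, mem_halfPlane] at hx ⊢
    simpa using mul_pos ht hx
  map_target' x hx := by
    rw [SetLike.mem_coe, mem_halfPlane] at hx ⊢
    simpa using mul_pos (inv_pos.2 ht) hx
  left_inv' x _ := by simp [smul_smul, inv_mul_cancel₀ ht.ne']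
  right_inv' x _ := by simp [smul_smul, mul_inv_cancel₀ ht.ne']
  open_source := halfPlane.isOpen
  open_target := halfPlane.isOpen
  continuousOn_toFun := by fun_prop
  continuousOn_invFun := by fun_prop

/-- The flows of E and T generate the maps x ↦ t x + (0, b), t > 0, which are affine and act
transitively on the half plane. -/
theorem isLocallyHomogeneous_modelB (C : Coeffs) : (modelB C).IsLocallyHomogeneous := by
  intro p hp q hq
  have hp' : 0 < p 0 := hp
  have hq' : 0 < q 0 := hq
  have ht : 0 < q 0 / p 0 := div_pos hq' hp'
  set t := q 0 / p 0 with htdef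
  refine ⟨dilation t (q 1 - t * p 1) ht, ⟨le_rfl, le_rfl, ?_, ?_, ?_⟩, hp, ?_⟩
  · exact ((contDiff_id.const_smul t).add contDiff_const).contDiffOn
  · exact ((contDiff_id.sub contDiff_const).const_smul t⁻¹).contDiffOn
  · refine isAffineMap_of_hasFDerivAt halfPlane.isOpen
      (A := fun _ => t • ContinuousLinearMap.id ℝ Plane) (B := fun _ _ => 0)
      (fun x _ => ((hasFDerivAt_id x).const_smul t).add_const _)
      (fun x _ w => hasFDerivAt_const _ x) ?_
    intro x hx v w
    have hx' : x 0 ≠ 0 := ne_of_gt hx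
    have e : dilation t (q 1 - t * p 1) ht x 0 = t * x 0 := by
      change (t • x + (q 1 - t * p 1) • (Pi.single 1 1 : Plane)) 0 = _
      simp
    simp only [conn_modelB, e, smul_apply, ContinuousLinearMap.id_apply, map_smul, zero_apply,
      zero_add, smul_smul]
    congr 1
    field_simp
  · ext k
    change (t • p + (q 1 - t * p 1) • (Pi.single 1 1 : Plane)) k = q k
    fin_cases k
    · simp [htdef, hp'.ne']
    · simp

/-- The coordinates `(log x¹, x² - h(x¹))`. -/
noncomputable def logChart (h : ℝ → ℝ) (hc : ContinuousOn h (Set.Ioi 0)) :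
    OpenPartialHomeomorph Plane Plane where
  toFun x := ![Real.log (x 0), x 1 - h (x 0)]
  invFun x := ![Real.exp (x 0), x 1 + h (Real.exp (x 0))]
  source := halfPlane
  target := Set.univ
  map_source' _ _ := trivial
  map_target' x _ := by
    rw [SetLike.mem_coe, mem_halfPlane]
    simpa using Real.exp_pos (x 0)
  left_inv' x hx := by
    have hx' : 0 < x 0 := hx
    ext k; fin_cases k <;> simp [Real.exp_log hx']
  right_inv' x _ := by ext k; fin_cases k <;> simp
  open_source := halfPlane.isOpen
  open_target := isOpen_univ
  continuousOn_toFun := by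
    rw [continuousOn_pi]
    intro k
    fin_cases k
    · exact Real.continuousOn_log.comp (continuous_apply 0).continuousOn fun x hx => ne_of_gt hx
    · exact (continuous_apply 1).continuousOn.sub
        (hc.comp (continuous_apply 0).continuousOn fun x hx => hx)
  continuousOn_invFun := by
    rw [continuousOn_pi]
    intro k
    fin_cases k
    · exact (Real.continuous_exp.comp (continuous_apply 0)).continuousOn
    · exact (continuous_apply 1).continuousOn.add
        (hc.comp (Real.continuous_exp.comp (continuous_apply 0)).continuousOn
          fun x _ => Real.exp_pos _)

/-- The coordinate fields of this chart are x¹∂₁ + x¹h'(x¹)∂₂ and ∂₂. Passing to log x¹ removes the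
factor 1/x¹, and the ODE for h makes the remaining Christoffel symbol Γ₁₁² vanish. -/
theorem isTypeA_of_vanishing {C : Coeffs} (hV : Vanishing C) (hF : ¬ (modelB C).IsFlat) :
    (modelB C).IsTypeA := by
  refine ⟨isLocallyHomogeneous_modelB C, hF, fun p hp => ?_⟩
  obtain ⟨h', h'', d1, d2, hode⟩ := particular_derivs (C.c 0 0 0) (C.c 0 0 1) (C.c 0 1 1)
  have hs := contDiffOn_particular (C.c 0 0 0) (C.c 0 0 1) (C.c 0 1 1)
  set h := particular (C.c 0 0 0) (C.c 0 0 1) (C.c 0 1 1)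
  obtain ⟨v1, v2, v3⟩ := hV
  refine ⟨Coeffs.mk6 (1 + C.c 0 0 0) 0 0 (C.c 0 1 1) 0 0, logChart h hs.continuousOn, hp,
    le_rfl, fun _ _ => trivial, ?_, ?_, ?_⟩
  · change ContDiffOn ℝ ∞ (fun x : Plane => ![Real.log (x 0), x 1 - h (x 0)]) halfPlane
    rw [contDiffOn_pi]
    intro k
    fin_cases k
    · exact contDiffOn_log.comp (contDiff_coord 0).contDiffOn fun x hx => hx
    · exact (contDiff_coord 1).contDiffOn.sub
        (hs.comp (contDiff_coord 0).contDiffOn fun x hx => hx)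
  · change ContDiffOn ℝ ∞ (fun x : Plane => ![Real.exp (x 0), x 1 + h (Real.exp (x 0))]) Set.univ
    rw [contDiffOn_pi]
    intro k
    have he : ContDiff ℝ ∞ fun x : Plane => Real.exp (x 0) := (contDiff_coord 0).exp
    fin_cases k
    · exact he.contDiffOn
    · exact (contDiff_coord 1).contDiffOn.add (hs.comp he.contDiffOn fun x _ => Real.exp_pos _)
  · refine isAffineMap_of_hasFDerivAt halfPlane.isOpen
      (A := fun x => ofRows (x 0)⁻¹ 0 (-h' (x 0)) 1)
      (B := fun x w => ofRows (-(x 0 ^ 2)⁻¹ * w 0) 0 (-h'' (x 0) * w 0) 0) ?_ ?_ ?_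
    · intro x hx
      change HasFDerivAt (fun x : Plane => ![Real.log (x 0), x 1 - h (x 0)]) _ x
      rw [hasFDerivAt_pi']
      intro k
      fin_cases k
      · refine (hasFDerivAt_comp_fst (Real.hasDerivAt_log (ne_of_gt hx))).congr_fderiv ?_
        ext v; simp [ofRows_zero]
      · refine ((hasFDerivAt_coord 1 x).fun_sub
          (hasFDerivAt_comp_fst (d1 _ hx))).congr_fderiv ?_
        ext v; simp [ofRows_one]; ring
    · intro x hx w
      rw [hasFDerivAt_pi']
      intro k
      fin_cases k
      · refine (((hasFDerivAt_comp_fst (hasDerivAt_inv (ne_of_gt hx))).mul_const (w 0)).add_const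
          (0 * w 1)).congr_fderiv ?_
        ext v; simp [ofRows_zero]; ring
      · refine (((hasFDerivAt_comp_fst (d2 _ hx)).fun_neg.mul_const (w 0)).add_const
          (1 * w 1)).congr_fderiv ?_
        ext v; simp [ofRows_one]; ring
    · intro x hx v w
      have hx' : x 0 ≠ 0 := ne_of_gt hx
      have e : h'' (x 0) = -((2 * C.c 0 1 1 - C.c 0 0 0) * h' (x 0) + C.c 0 0 1) / x 0 := by
        rw [eq_div_iff hx']; linarith [hode _ hx]
      rw [conn_modelA, conn_modelB]
      ext k
      fin_cases k
      · simp [ofRows_zero, ofRows_one, Coeffs.bil_apply, Coeffs.mk6, v1, v2, v3]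
        field_simp
        ring
      · simp [ofRows_zero, ofRows_one, Coeffs.bil_apply, Coeffs.mk6, v1, v2, v3, e]
        field_simp
        ring

/-! ### Obstructions to being of Type `𝒜` or `𝒞` -/

theorem ricciEps_zero_symm (C : Coeffs) (v w : Plane) :
    formOf (ricciEps C 0) v w = formOf (ricciEps C 0) w v := by
  simp [formOf, ricciEps, C.symm 1 0]
  ring

/-- For w in ker ρ only the term ρ(C(u, w), z) survives, so the claim is that ker ρ is stable under
all C(u, ·). -/
theorem nablaRicciEps_zero_of_ker (C : Coeffs) {w : Plane}
    (hw : ∀ z, formOf (ricciEps C 0) w z = 0) (u z : Plane) :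
    nablaRicciEps C 0 u w z = 0 := by
  rw [nablaRicciEps, hw, hw]
  have h0 := hw (Pi.single 0 1)
  have h1 := hw (Pi.single 1 1)
  have s0 := C.symm 1 0 0
  have s1 := C.symm 1 0 1
  simp [formOf, ricciEps, s0, s1] at h0 h1
  simp only [formOf, ricciEps, C.bil_apply, s0, s1, Matrix.cons_val_zero, Matrix.cons_val_one]
  generalize C.c 0 0 0 = p at *
  generalize C.c 0 0 1 = q at *
  generalize C.c 0 1 0 = c at *
  generalize C.c 0 1 1 = d at *
  generalize C.c 1 1 0 = e at *
  generalize C.c 1 1 1 = f at *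
  rcases eq_or_ne (w 1) 0 with hw1 | hw1
  · simp only [hw1, mul_zero, add_zero] at h0 h1 ⊢
    linear_combination
      (-(u 0 * p + u 1 * c) * z 0 - (u 0 * c + u 1 * e) * z 1) * h0 +
      (-(u 0 * q + u 1 * d) * z 0 - (u 0 * (d - p) + u 1 * (f - c)) * z 1 -
        (u 0 * p + u 1 * c) * z 1) * h1
  · obtain ⟨s, hs⟩ : ∃ s, w 0 = s * w 1 := ⟨w 0 / w 1, by field_simp⟩
    rw [hs] at h0 h1 ⊢
    have h0' : (d * p + f * q - (c * q + d * d)) * s + (d * c - e * q) = 0 :=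
      mul_right_cancel₀ hw1 (by linear_combination h0)
    have h1' : (d * c - e * q) * s + (e * p + f * c - (c * c + d * e)) = 0 :=
      mul_right_cancel₀ hw1 (by linear_combination h1)
    -- Here w is proportional to (s, 1). The identities `k1` and `k2` say that either ρ(∂₁, ∂₁) = 0
    -- or both C(∂₁, w) and C(w, w) are multiples of w.
    have k1 : (d * p + f * q - (c * q + d * d)) * (s * p + c - s * (s * q + d)) = 0 := by
      clear h0 h1 hw
      grind
    have k2 : (d * p + f * q - (c * q + d * d)) *
        (s ^ 2 * p + 2 * s * c + e - s * (s ^ 2 * q + 2 * s * d + f)) = 0 := by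
      clear h0 h1 hw
      grind
    linear_combination -w 1 * ((z 0 - s * z 1) * ((u 0 - s * u 1) * k1 + u 1 * k2) +
      ((u 0 * (s * p + c) + u 1 * (s * c + e)) * z 1 + (u 0 * (s * q + d) + u 1 * (s * d + f)) * z 0 -
        s * (u 0 * (s * q + d) + u 1 * (s * d + f)) * z 1) * h0' +
      (u 0 * (s * q + d) + u 1 * (s * d + f)) * z 1 * h1')

/-- If ρ, which has constant coefficients, were parallel, then ρ(C(u, v), w) would be symmetric in
u, v and skew in v, w, hence zero. Non-degeneracy gives C = 0, and then ρ = 0. -/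
theorem nablaRicciEps_zero_ne_zero (C : Coeffs)
    (hnd : ∀ v, (∀ w, formOf (ricciEps C 0) v w = 0) → v = 0) :
    ∃ u v w, nablaRicciEps C 0 u v w ≠ 0 := by
  by_contra! h
  set T : Plane → Plane → Plane → ℝ := fun u v w => formOf (ricciEps C 0) (C.bil u v) w with hT
  have h1 : ∀ u v w, T u v w = -T u w v := fun u v w => by
    have := h u v w
    simp only [nablaRicciEps] at this
    rw [ricciEps_zero_symm C v (C.bil u w)] at this
    simp only [hT]; linarith
  have h2 : ∀ u v w, T u v w = T v u w := fun u v w => by simp only [hT, C.bil_comm u v]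
  have h3 : ∀ u v w, T u v w = 0 := fun u v w => by
    have := h1 u v w; have := h2 u v w; have := h1 v u w; have := h2 v w u
    have := h1 w v u; have := h2 w u v
    linarith
  have h4 : ∀ u v, C.bil u v = 0 := fun u v => hnd _ (h3 u v)
  have h5 : ∀ i j k, C.c i j k = 0 := fun i j k => by rw [← C.bil_single, h4]; rfl
  have h6 := hnd (Pi.single 0 1) fun w => by simp [formOf, ricciEps, h5]
  simpa using congrFun h6 0

/-- An obstruction to being of Type `𝒜`, in terms of the Ricci tensor `r` and of its covariant
derivative `n`. -/
def ObstructsTypeA (r : Plane → Plane → ℝ) (n : Plane → Plane → Plane → ℝ) : Prop :=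
  (∃ v w, r v w ≠ r w v) ∨ (∃ u w z, (∀ x, r w x = 0) ∧ n u w z ≠ 0) ∨
    ((∀ u v w, n u v w = 0) ∧ ∀ v, (∀ w, r v w = 0) → v = 0)

theorem not_obstructsTypeA (C : Coeffs) :
    ¬ ObstructsTypeA (formOf (ricciEps C 0)) (nablaRicciEps C 0) := by
  rintro (⟨v, w, h⟩ | ⟨u, w, z, h1, h2⟩ | ⟨h1, h2⟩)
  · exact h (ricciEps_zero_symm C v w)
  · exact h2 (nablaRicciEps_zero_of_ker C h1 u z)
  · obtain ⟨u, v, w, h⟩ := nablaRicciEps_zero_ne_zero C h2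
    exact h (h1 u v w)

theorem ObstructsTypeA.transport {r r' : Plane → Plane → ℝ} {n n' : Plane → Plane → Plane → ℝ}
    {s t : ℝ} (hs : s ≠ 0) (ht : t ≠ 0) (e : Plane ≃ₗ[ℝ] Plane)
    (hr : ∀ v w, r v w = s * r' (e v) (e w)) (hn : ∀ u v w, n u v w = t * n' (e u) (e v) (e w))
    (h : ObstructsTypeA r n) : ObstructsTypeA r' n' := by
  rcases h with ⟨v, w, h⟩ | ⟨u, w, z, h1, h2⟩ | ⟨h1, h2⟩
  · refine Or.inl ⟨e v, e w, fun h' => h ?_⟩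
    rw [hr, hr, h']
  · refine Or.inr (Or.inl ⟨e u, e w, e z, fun x => ?_, fun h' => h2 ?_⟩)
    · have := h1 (e.symm x)
      rw [hr, e.apply_symm_apply] at this
      exact (mul_eq_zero.1 this).resolve_left hs
    · rw [hn, h', mul_zero]
  · refine Or.inr (Or.inr ⟨fun u v w => ?_, fun v hv => ?_⟩)
    · have := h1 (e.symm u) (e.symm v) (e.symm w)
      rw [hn, e.apply_symm_apply, e.apply_symm_apply, e.apply_symm_apply] at this
      exact (mul_eq_zero.1 this).resolve_left ht
    · have := h2 (e.symm v) fun w => by rw [hr, e.apply_symm_apply, hv, mul_zero]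
      simpa using this

/-- Invariance at a single point: the differential matches ρ and ∇ρ up to non-zero scalars, to which
the obstructions are insensitive. -/
theorem exists_transport {M N : AffineSurface} {CM CN : Coeffs} {εM εN : ℝ} {hM hN : Plane → ℝ}
    {f : Plane → Plane} {V : Opens Plane} (mM : IsModel M CM εM hM) (mN : IsModel N CN εN hN)
    (hf : ContDiffOn ℝ ∞ f V) (hVM : V ≤ M.U) (hVN : ∀ p ∈ V, f p ∈ N.U)
    (haff : IsAffineMap M N f V) (hinj : ∀ p ∈ V, Function.Injective (fderiv ℝ f p))
    {p : Plane} (hp : p ∈ V) (hMp : hM p ≠ 0) (hNp : hN (f p) ≠ 0) :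
    ∃ (e : Plane ≃ₗ[ℝ] Plane) (s t : ℝ), s ≠ 0 ∧ t ≠ 0 ∧
      (∀ v w, formOf (ricciEps CM εM) v w = s * formOf (ricciEps CN εN) (e v) (e w)) ∧
      ∀ u v w, nablaRicciEps CM εM u v w = t * nablaRicciEps CN εN (e u) (e v) (e w) := by
  refine ⟨LinearEquiv.ofInjectiveEndo (fderiv ℝ f p).toLinearMap (hinj p hp),
    hN (f p) ^ 2 / hM p ^ 2, hN (f p) ^ 3 / hM p ^ 3, div_ne_zero (pow_ne_zero _ hNp)
    (pow_ne_zero _ hMp), div_ne_zero (pow_ne_zero _ hNp) (pow_ne_zero _ hMp),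
    fun v w => ?_, fun u v w => ?_⟩
  · have h := ricciEps_of_isAffineMap mM mN hf hVM hVN haff hp (hinj p hp) v w
    rw [div_mul_eq_mul_div, eq_div_iff (pow_ne_zero _ hMp), mul_comm]
    exact h
  · have h := nablaRicciEps_of_isAffineMap mM mN hf hVM hVN haff hinj hp u v w
    rw [div_mul_eq_mul_div, eq_div_iff (pow_ne_zero _ hMp), mul_comm]
    exact h

/-- Up to powers of x¹, ρ and ∇ρ have the same components at every point. One constant-coefficient
chart at one point of V is therefore already contradictory. -/
theorem nowhereTypeA_of_obstructs {C : Coeffs}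
    (h : ObstructsTypeA (formOf (ricciEps C 1)) (nablaRicciEps C 1)) :
    (modelB C).NowhereTypeA := by
  rintro V hV ⟨p, hp⟩ ⟨-, -, hA⟩
  obtain ⟨C', φ, hpφ, hφ⟩ := hA p hp
  have mM : IsModel ((modelB C).restrict V hV) C 1 fun p => (p 0)⁻¹ :=
    ⟨(isModel_modelB C).conn, fun q hq => (isModel_modelB C).deriv q (hV hq)⟩
  have hinj : ∀ q ∈ φ.source, Function.Injective (fderiv ℝ φ q) := by
    intro q hq
    have d1 := ((hφ.smooth.contDiffAt (φ.open_source.mem_nhds hq)).differentiableAt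
      (by simp)).hasFDerivAt
    have d2 := ((hφ.smooth_symm.contDiffAt (φ.open_target.mem_nhds
      (φ.map_source hq))).differentiableAt (by simp)).hasFDerivAt
    have d3 := d2.comp q d1
    have ev : φ.symm ∘ φ =ᶠ[nhds q] id :=
      Filter.eventuallyEq_of_mem (φ.open_source.mem_nhds hq) fun x hx => φ.left_inv hx
    have d4 := d3.unique ((hasFDerivAt_id q).congr_of_eventuallyEq ev)
    intro v w hvw
    have := congrArg (fderiv ℝ φ.symm (φ q)) hvw
    rw [← ContinuousLinearMap.comp_apply, ← ContinuousLinearMap.comp_apply, d4] at this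
    exact this
  obtain ⟨e, s, t, hs, ht, hr, hn⟩ := exists_transport (V := ⟨φ.source, φ.open_source⟩) mM
    (isModel_modelA C') hφ.smooth hφ.source_subset (fun _ _ => trivial) hφ.affine hinj hpφ
    (inv_ne_zero (ne_of_gt (hV hp))) one_ne_zero
  exact not_obstructsTypeA C' (h.transport hs ht e hr hn)

/-! ### Linear equivalences and their effect on the Ricci tensor -/

theorem hasFDerivAt_shear (t u v w : ℝ) (p : Plane) :
    HasFDerivAt (shear t u v w) (ofRows t 0 u v) p := by
  have h0 := hasFDerivAt_coord 0 p
  have h1 := hasFDerivAt_coord 1 p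
  rw [hasFDerivAt_pi']
  intro k
  fin_cases k
  · refine (h0.const_mul t).congr_fderiv ?_
    ext x; simp [ofRows_zero]
  · refine (((h0.const_mul u).fun_add (h1.const_mul v)).add_const w).congr_fderiv ?_
    ext x; simp [ofRows_one]

/-- With t = 1 and w = 0 the map is linear and fixes x¹, so equivalence means that it intertwines
the bilinear maps. These maps suffice for all normal forms. -/
theorem linEquiv_of_bil {C C' : Coeffs} {u v : ℝ} (hv : v ≠ 0)
    (h : ∀ x y : Plane, C'.bil (ofRows 1 0 u v x) (ofRows 1 0 u v y) =
      ofRows 1 0 u v (C.bil x y)) : LinEquiv C C' := by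
  refine ⟨1, u, v, 0, one_pos, hv, isAffineMap_of_hasFDerivAt halfPlane.isOpen
    (B := fun _ _ => 0) (fun p _ => hasFDerivAt_shear 1 u v 0 p)
    (fun p _ w => hasFDerivAt_const _ p) ?_⟩
  intro p hp x y
  have e : shear 1 u v 0 p 0 = p 0 := by simp [shear]
  rw [conn_modelB, conn_modelB, e, h, map_smul]
  simp

theorem TypeB.LinEquiv.exists_transport {C C' : Coeffs} (h : LinEquiv C C') :
    ∃ (e : Plane ≃ₗ[ℝ] Plane) (s t : ℝ), s ≠ 0 ∧ t ≠ 0 ∧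
      (∀ v w, formOf (ricciEps C' 1) v w = s * formOf (ricciEps C 1) (e v) (e w)) ∧
      ∀ u v w, nablaRicciEps C' 1 u v w = t * nablaRicciEps C 1 (e u) (e v) (e w) := by
  obtain ⟨t, u, v, w, ht, hv, haff⟩ := h
  have e0 : ∀ p : Plane, shear t u v w p 0 = t * p 0 := fun p => by simp [shear]
  have hsm : ContDiff ℝ ∞ (shear t u v w) := by
    rw [contDiff_pi]
    intro k
    fin_cases k
    · exact contDiff_const.mul (contDiff_coord 0)
    · exact ((contDiff_const.mul (contDiff_coord 0)).add
        (contDiff_const.mul (contDiff_coord 1))).add contDiff_const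
  obtain ⟨e, a, b, ha, hb, hr, hn⟩ := _root_.exists_transport (isModel_modelB C)
    (isModel_modelB C') hsm.contDiffOn (le_refl halfPlane)
    (fun p hp => by
      have : 0 < shear t u v w p 0 := by rw [e0]; exact mul_pos ht hp
      exact this) haff
    (fun p _ => by
      rw [(hasFDerivAt_shear t u v w p).fderiv]
      intro x y hxy
      have h0 := congrFun hxy 0
      have h1 := congrFun hxy 1
      rw [ofRows_zero, ofRows_zero, zero_mul, zero_mul, add_zero, add_zero] at h0
      have h0' := mul_left_cancel₀ ht.ne' h0
      rw [ofRows_one, ofRows_one, h0'] at h1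
      have h1' := mul_left_cancel₀ hv (add_left_cancel h1)
      ext k; fin_cases k
      exacts [h0', h1']) basePt_mem (inv_ne_zero (ne_of_gt basePt_mem))
    (inv_ne_zero (by
      rw [e0]; exact (mul_pos ht basePt_mem).ne'))
  -- The inverse is taken because obstructions are checked on the normal form C' and carried back to
  -- C.
  refine ⟨e.symm, a⁻¹, b⁻¹, inv_ne_zero ha, inv_ne_zero hb, fun v w => ?_, fun u v w => ?_⟩
  · rw [hr, e.apply_symm_apply, e.apply_symm_apply, inv_mul_cancel_left₀ ha]
  · rw [hn, e.apply_symm_apply, e.apply_symm_apply, e.apply_symm_apply,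
      inv_mul_cancel_left₀ hb]

/-- An obstruction to being of Type `𝒞`, in terms of the Ricci tensor. -/
def ObstructsTypeC (r : Plane → Plane → ℝ) : Prop :=
  (∃ v w, r v w ≠ r w v) ∨ ((∃ v w, r v w ≠ 0) ∧ ∃ v ≠ 0, ∀ w, r v w = 0)

theorem ObstructsTypeC.transport {r r' : Plane → Plane → ℝ} {s : ℝ} (hs : s ≠ 0)
    (e : Plane ≃ₗ[ℝ] Plane) (hr : ∀ v w, r v w = s * r' (e v) (e w))
    (h : ObstructsTypeC r) : ObstructsTypeC r' := by
  rcases h with ⟨v, w, h⟩ | ⟨⟨v, w, h⟩, x, hx, h2⟩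
  · refine Or.inl ⟨e v, e w, fun h' => h ?_⟩
    rw [hr, hr, h']
  · refine Or.inr ⟨⟨e v, e w, fun h' => h (by rw [hr, h', mul_zero])⟩, e x, ?_, fun w => ?_⟩
    · simpa using hx
    · have := h2 (e.symm w)
      rw [hr, e.apply_symm_apply] at this
      exact (mul_eq_zero.1 this).resolve_left hs

/-- Contracting R(X, Y)Z = κ(g(Y, Z)X - g(X, Z)Y) in dimension two gives ρ = κ g. So ρ is symmetric,
and it is zero or non-degenerate according to κ. -/
theorem nowhereTypeC_of_obstructs {C : Coeffs} (h : ObstructsTypeC (formOf (ricciEps C 1))) :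
    (modelB C).NowhereTypeC := by
  rintro V hV ⟨p, hp⟩ ⟨-, -, g, κ, hg, -, hκ⟩
  have hp0 : (p 0 ^ 2)⁻¹ ≠ 0 := inv_ne_zero (pow_ne_zero 2 (ne_of_gt (hV hp)))
  have h1 : ∀ i j, (p 0 ^ 2)⁻¹ * ricciEps C 1 i j = κ * g p i j := by
    intro i j
    rw [ricciEps_one, ← ricci_modelB C (hV hp)]
    change ((modelB C).restrict V hV).ricci p i j = _
    simp only [ricci, hκ p hp, Fin.sum_univ_two]
    fin_cases i <;> simp [coordField]
  have hsymm : g p 0 1 = g p 1 0 := (hg.symm p hp).apply 1 0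
  have h2 : ∀ v w, (p 0 ^ 2)⁻¹ * formOf (ricciEps C 1) v w = κ * formOf (g p) v w := by
    intro v w
    simp only [formOf]
    linear_combination v 0 * w 0 * h1 0 0 + v 0 * w 1 * h1 0 1 + v 1 * w 0 * h1 1 0 +
      v 1 * w 1 * h1 1 1
  rcases h with ⟨v, w, h⟩ | ⟨⟨v, w, h⟩, x, hx, h3⟩
  · refine h (mul_left_cancel₀ hp0 ?_)
    rw [h2, h2]
    simp only [formOf, hsymm]
    ring
  · have hκ0 : κ ≠ 0 := by
      rintro rfl
      have := h2 v w
      rw [zero_mul] at this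
      exact h ((mul_eq_zero.1 this).resolve_left hp0)
    have h4 : ∀ w, formOf (g p) x w = 0 := fun w => by
      have := h2 x w
      rw [h3, mul_zero] at this
      exact (mul_eq_zero.1 this.symm).resolve_left hκ0
    have k0 := h4 (Pi.single 0 1)
    have k1 := h4 (Pi.single 1 1)
    simp [formOf] at k0 k1
    have hd := hg.nondegenerate p hp
    rw [Matrix.det_fin_two] at hd
    refine hx ?_
    ext k
    fin_cases k
    · exact (mul_eq_zero.1 (show (g p 0 0 * g p 1 1 - g p 0 1 * g p 1 0) * x 0 = 0 by
        linear_combination g p 1 1 * k0 - g p 1 0 * k1)).resolve_left hd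
    · exact (mul_eq_zero.1 (show (g p 0 0 * g p 1 1 - g p 0 1 * g p 1 0) * x 1 = 0 by
        linear_combination g p 0 0 * k1 - g p 0 1 * k0)).resolve_left hd

/-- The Ricci tensor `r` is symmetric, non-degenerate and parallel. -/
structure IsParallelMetric (r : Plane → Plane → ℝ) (n : Plane → Plane → Plane → ℝ) : Prop where
  symm : ∀ v w, r v w = r w v
  nondegenerate : ∀ v, (∀ w, r v w = 0) → v = 0
  parallel : ∀ u v w, n u v w = 0

theorem IsParallelMetric.transport {r r' : Plane → Plane → ℝ}
    {n n' : Plane → Plane → Plane → ℝ} {s t : ℝ} (hs : s ≠ 0) (ht : t ≠ 0)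
    (e : Plane ≃ₗ[ℝ] Plane) (hr : ∀ v w, r v w = s * r' (e v) (e w))
    (hn : ∀ u v w, n u v w = t * n' (e u) (e v) (e w))
    (h : IsParallelMetric r n) : IsParallelMetric r' n' where
  symm v w := by
    have := h.symm (e.symm v) (e.symm w)
    rw [hr, hr, e.apply_symm_apply, e.apply_symm_apply] at this
    exact mul_left_cancel₀ hs this
  nondegenerate v hv := by
    have := h.nondegenerate (e.symm v) fun w => by rw [hr, e.apply_symm_apply, hv, mul_zero]
    simpa using this
  parallel u v w := by
    have := h.parallel (e.symm u) (e.symm v) (e.symm w)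
    rw [hn, e.apply_symm_apply, e.apply_symm_apply, e.apply_symm_apply] at this
    exact (mul_eq_zero.1 this).resolve_left ht

theorem formOf_single (r : Fin 2 → Fin 2 → ℝ) (i j : Fin 2) :
    formOf r (Pi.single i 1) (Pi.single j 1) = r i j := by
  fin_cases i <;> fin_cases j <;> simp [formOf]

/-- The metric is ρ itself, with κ = 1: parallelism is the Levi-Civita condition, and the formula
for R in terms of ρ is the curvature condition. -/
theorem isTypeC_of_isParallelMetric {C : Coeffs}
    (h : IsParallelMetric (formOf (ricciEps C 1)) (nablaRicciEps C 1)) :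
    (modelB C).IsTypeC := by
  set r := ricciEps C 1 with hr
  have hsymm : r 0 1 = r 1 0 := by
    have := h.symm (Pi.single 0 1) (Pi.single 1 1)
    rwa [formOf_single, formOf_single] at this
  have hdet : r 0 0 * r 1 1 - r 0 1 * r 1 0 ≠ 0 := by
    intro hd
    -- If the determinant vanished, vectors formed from the cofactors would lie in the kernel, so
    -- all entries of ρ would be zero.
    have e1 := h.nondegenerate ![r 1 1, -r 0 1] fun w => by
      simp [formOf]
      linear_combination w 0 * hd
    have e2 := h.nondegenerate ![-r 1 0, r 0 0] fun w => by
      simp [formOf]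
      linear_combination w 1 * hd
    have z11 : r 1 1 = 0 := by simpa using congrFun e1 0
    have z01 : r 0 1 = 0 := by simpa using congrFun e1 1
    have z10 : r 1 0 = 0 := by simpa using congrFun e2 0
    have z00 : r 0 0 = 0 := by simpa using congrFun e2 1
    have := h.nondegenerate (Pi.single 0 1) fun w => by simp [formOf, z00, z01, z10, z11]
    simpa using congrFun this 0
  refine ⟨isLocallyHomogeneous_modelB C, ?_, fun p => Matrix.of fun i j => (p 0 ^ 2)⁻¹ * r i j, 1,
    ⟨?_, ?_, ?_⟩, ?_, ?_⟩
  · rw [isFlat_modelB_iff, ← ricciEps_one]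
    intro h0
    exact hdet (by simp [hr, h0])
  · intro i j
    have h2 : ContDiffOn ℝ ∞ (fun p : Plane => p 0 ^ 2) halfPlane :=
      ((contDiff_coord 0).pow 2).contDiffOn
    exact (h2.inv fun p hp => pow_ne_zero 2 (ne_of_gt hp)).mul contDiffOn_const
  · intro p _
    ext i j
    fin_cases i <;> fin_cases j <;> simp [hsymm]
  · intro p hp
    have hp0 : (p 0 ^ 2)⁻¹ ≠ 0 := inv_ne_zero (pow_ne_zero 2 (ne_of_gt hp))
    rw [Matrix.det_fin_two]
    have : (p 0 ^ 2)⁻¹ * (p 0 ^ 2)⁻¹ * (r 0 0 * r 1 1 - r 0 1 * r 1 0) ≠ 0 :=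
      mul_ne_zero (mul_ne_zero hp0 hp0) hdet
    intro h0
    apply this
    rw [← h0]
    simp only [Matrix.of_apply]
    ring
  · intro p hp i j k
    have hp' : p 0 ≠ 0 := ne_of_gt hp
    have hd := ((hasFDerivAt_inv_fst hp).pow 2).mul_const (r i j)
    have e : (fun q : Plane => Matrix.of (fun i j => (q 0 ^ 2)⁻¹ * r i j) i j) =
        fun q : Plane => ((q 0)⁻¹) ^ 2 * r i j := by
      funext q; simp
    rw [e, hd.fderiv]
    have hn := h.parallel (Pi.single k 1) (Pi.single i 1) (Pi.single j 1)
    rw [nablaRicciEps, formOf_single] at hn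
    have e1 := congrArg (fun x => formOf r x (Pi.single j 1))
      (plane_eq_sum (C.bil (Pi.single k 1) (Pi.single i 1)))
    have e2 := congrArg (fun x => formOf r (Pi.single i 1) x)
      (plane_eq_sum (C.bil (Pi.single k 1) (Pi.single j 1)))
    simp only [formOf_add_left, formOf_smul_left, formOf_single, C.bil_single] at e1
    simp only [formOf_add_right, formOf_smul_right, formOf_single, C.bil_single] at e2
    rw [e1, e2] at hn
    change _ = ∑ l, ((p 0)⁻¹ * C.c k i l * ((p 0 ^ 2)⁻¹ * r l j) +
      (p 0)⁻¹ * C.c k j l * ((p 0 ^ 2)⁻¹ * r i l))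
    rw [Fin.sum_univ_two]
    simp
    field_simp
    linear_combination hn
  · intro p hp i j k
    rw [curvature_modelB C hp, one_smul, hr, ricciEps_one, smul_sub, smul_smul, smul_smul]
    rfl

/-! ### Normal forms in dimension three -/

/-- The structure for which `X(σ)` is a Killing field, with `C₁₂¹ = c` and `C₂₂¹ = e`; it is one
if `σ c = 0` and `σ (σ e + 1) = 0`. -/
noncomputable def normalForm (σ c e : ℝ) : Coeffs :=
  Coeffs.mk6 ((-3 - σ * e) / 2) 0 c ((σ * e - 1) / 2) e (2 * c)

theorem N1plus_eq : N1plus = normalForm 0 0 (-1 / 2) := by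
  rw [N1plus, normalForm]; congr 1 <;> norm_num

theorem N1minus_eq : N1minus = normalForm 0 0 (1 / 2) := by
  rw [N1minus, normalForm]; congr 1 <;> norm_num

theorem N2_eq (c : ℝ) : N2 c = normalForm 0 1 c := by
  rw [N2, normalForm]; congr 1 <;> norm_num

theorem N3_eq : N3 = normalForm 1 0 (-1) := by
  rw [N3, normalForm]; congr 1 <;> norm_num

theorem N4_eq : N4 = normalForm (-1) 0 1 := by
  rw [N4, normalForm]; congr 1 <;> norm_num

/-- The shear part, with parameter v α/2 for α = `jv X 0`, brings X to the form X(s). Scaling x² by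
v then multiplies s, C₁₂¹ and C₂₂¹ by v², v⁻¹ and v⁻². -/
theorem IsSpecial.linEquiv_normalForm {C : Coeffs} {X : smoothVF (modelB C).U} (hX : IsSpecial X)
    {v : ℝ} (hv : v ≠ 0) :
    LinEquiv C (normalForm (v ^ 2 * (jv X 1 + jv X 0 ^ 2 / 4))
      ((C.c 0 1 0 - jv X 0 / 2 * C.c 1 1 0) / v) (C.c 1 1 0 / v ^ 2)) := by
  obtain ⟨h1, h2, h3, h4, h5, h6⟩ := hX.coeff_eqs
  have hs : v ^ 2 * (jv X 1 + jv X 0 ^ 2 / 4) * (C.c 1 1 0 / v ^ 2) =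
    (jv X 1 + jv X 0 ^ 2 / 4) * C.c 1 1 0 := by field_simp
  refine linEquiv_of_bil (u := v * (jv X 0 / 2)) hv fun x y => ?_
  rw [normalForm, hs]
  generalize jv X 0 = α at *
  generalize jv X 1 = σ at *
  have k0 : (-3 - (σ + α ^ 2 / 4) * C.c 1 1 0) / 2 + α * (C.c 0 1 0 - α / 2 * C.c 1 1 0) +
      C.c 1 1 0 * α ^ 2 / 4 = C.c 0 0 0 := by linear_combination 1 / 8 * α * h1 - 1 / 4 * h2 - 1 / 2 * h3
  have k1 : α / 2 * C.c 0 0 0 + C.c 0 0 1 = ((σ + α ^ 2 / 4) * C.c 1 1 0 - 1) / 2 * α +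
    2 * (C.c 0 1 0 - α / 2 * C.c 1 1 0) * α ^ 2 / 4 := by grind
  have k2 : α / 2 * C.c 0 1 0 + C.c 0 1 1 = ((σ + α ^ 2 / 4) * C.c 1 1 0 - 1) / 2 +
    2 * (C.c 0 1 0 - α / 2 * C.c 1 1 0) * α / 2 := by grind
  have k3 : α / 2 * C.c 1 1 0 + C.c 1 1 1 = 2 * (C.c 0 1 0 - α / 2 * C.c 1 1 0) := by linarith
  ext k
  fin_cases k
  · simp [ofRows_zero, ofRows_one, Coeffs.bil_apply, Coeffs.mk6]
    field_simp
    linear_combination 16 * x 0 * y 0 * k0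
  · simp [ofRows_zero, ofRows_one, Coeffs.bil_apply, Coeffs.mk6]
    field_simp
    linear_combination -16 * x 0 * y 0 * k1 - 16 * (x 0 * y 1 + y 0 * x 1) * k2 - 16 * x 1 * y 1 * k3

section NormalForm

variable {σ c e : ℝ}

/-- The Killing field `X(σ)`. -/
noncomputable def specialVF (C : Coeffs) (σ : ℝ) : smoothVF (modelB C).U :=
  vf C _ (contDiffOn_quadMap 1 0 (f := fun _ => 0) (g := fun x => σ * x ^ 2) contDiffOn_const
    (contDiffOn_const.mul (contDiffOn_id.pow 2)))

theorem specialVF_val (C : Coeffs) (σ : ℝ) : (specialVF C σ).1 = Xfield σ := by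
  refine congrArg field (funext fun x => ?_)
  simp [quadMap]

theorem isKilling_specialVF (hc : σ * c = 0) (he : σ * (σ * e + 1) = 0) :
    (modelB (normalForm σ c e)).IsKilling (specialVF (normalForm σ c e) σ) := by
  refine isKilling_quadMap _ 1 0 (f' := fun _ => 0) (f'' := fun _ => 0)
    (g' := fun x => σ * (2 * x)) (g'' := fun _ => σ * (2 * 1)) contDiffOn_const
    (contDiffOn_const.mul (contDiffOn_id.pow 2))
    (fun x _ => hasDerivAt_const x 0) (fun x _ => ?_) (fun x _ => hasDerivAt_const x 0)
    (fun x _ => ((hasDerivAt_id x).const_mul 2).const_mul σ) ?_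
  · simpa using (hasDerivAt_pow 2 x).const_mul σ
  · intro p hp v w
    have hp' : p 0 ≠ 0 := ne_of_gt hp
    ext k
    fin_cases k
    · simp [killingRHS, quadMap, ofRows_zero, ofRows_one, Coeffs.bil_apply, normalForm,
        Coeffs.mk6]
      field_simp
      linear_combination 4 * w 0 * v 0 * p 0 * hc
    · simp [killingRHS, quadMap, ofRows_zero, ofRows_one, Coeffs.bil_apply, normalForm,
        Coeffs.mk6]
      field_simp
      linear_combination 3 * v 0 * w 0 * p 0 * he + 2 * p 0 * (v 0 * w 1 + w 0 * v 1) * hc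

theorem isSpecial_specialVF (hc : σ * c = 0) (he : σ * (σ * e + 1) = 0) :
    IsSpecial (specialVF (normalForm σ c e) σ) := by
  have hk := isKilling_specialVF hc he
  have hg : HasDerivAt (fun x : ℝ => σ * x ^ 2) (σ * 2) 1 := by
    simpa using (hasDerivAt_pow 2 (1 : ℝ)).const_mul σ
  obtain ⟨j0, j1⟩ := jv_quadMap (C := normalForm σ c e) (contDiffOn_quadMap 1 0
    (f := fun _ => 0) (g := fun x => σ * x ^ 2) contDiffOn_const
    (contDiffOn_const.mul (contDiffOn_id.pow 2)))
  obtain ⟨d0, d1, d2, d3⟩ := jd_quadMap (C := normalForm σ c e) (contDiffOn_quadMap 1 0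
    (f := fun _ => 0) (g := fun x => σ * x ^ 2) contDiffOn_const
    (contDiffOn_const.mul (contDiffOn_id.pow 2))) (hasDerivAt_const (1 : ℝ) (0 : ℝ)) hg
  change jv (specialVF _ σ) 0 = _ at j0
  change jv (specialVF _ σ) 1 = _ at j1
  change jd (specialVF _ σ) 0 0 = _ at d0
  change jd (specialVF _ σ) 0 1 = _ at d1
  change jd (specialVF _ σ) 1 0 = _ at d2
  change jd (specialVF _ σ) 1 1 = _ at d3
  refine ⟨hk, eq_of_jets (isKilling_trans hk)
    ((modelB _).killing.smul_mem _ (isKilling_eulerVF _)) (fun k => ?_) fun i k => ?_,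
    eq_of_jets (isKilling_euler hk) hk (fun k => ?_) fun i k => ?_⟩
  · rw [jv_trans, jv_smul, jv_eulerVF]
    fin_cases k <;> simp [basePt, d2, d3]
  · rw [jd_trans hk, jd_smul, jd_eulerVF]
    fin_cases i <;> fin_cases k <;>
      simp only [jdd, Fin.zero_eta, Fin.mk_one, Fin.isValue, j0, d0, d1, d2, d3] <;>
      simp [normalForm, Coeffs.mk6] <;> linarith
  · rw [jv_euler]
    fin_cases k <;> simp [j0, j1, d0, d1]; ring
  · rw [jd_euler hk]
    fin_cases i <;> fin_cases k <;>
      simp only [jdd, Fin.zero_eta, Fin.mk_one, Fin.isValue, j0, d0, d1, d2, d3] <;>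
      simp [normalForm, Coeffs.mk6] <;> linarith

theorem ricciConst_normalForm (hc : σ * c = 0) :
    ricciConst (normalForm σ c e) =
      ![![-(σ * e * (σ * e - 1) / 2), 3 / 2 * c], ![-(3 / 2 * c), c ^ 2 - e * (2 + σ * e)]] := by
  funext i j
  fin_cases i <;> fin_cases j <;> simp [ricciConst, normalForm, Coeffs.mk6]
  · ring
  · linear_combination e / 2 * hc
  · linear_combination e / 2 * hc
  · ring

/-- Non-flatness is visible in ρ₁₂ = 3c/2 and, when c = 0, in ρ₂₂ = -e(2 + σe), where σ = 0 or σe =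
-1. The chain argument then leaves no room beyond E, T and X(σ). -/
theorem killingIs_normalForm (hc : σ * c = 0) (he : σ * (σ * e + 1) = 0) (h : c ≠ 0 ∨ e ≠ 0) :
    KillingIs (normalForm σ c e) {Xfield σ} ∧ dimK (normalForm σ c e) = 3 := by
  have hV : ¬ Vanishing (normalForm σ c e) := by
    rintro ⟨h1, h2, -⟩
    simp [normalForm, Coeffs.mk6] at h1 h2
    exact h.elim (· h1) (· h2)
  have hR : ¬ ∀ i j, ricciConst (normalForm σ c e) i j = 0 := by
    rw [ricciConst_normalForm hc]
    intro h'
    have h1 := h' 0 1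
    have h2 := h' 1 1
    simp at h1 h2
    subst h1
    rcases mul_eq_zero.1 he with h0 | h0
    · subst h0
      simp at h h2
      exact h h2
    · grind
  obtain ⟨h1, h2, -⟩ := (isSpecial_specialVF hc he).killing_basis fun Z hZ =>
    (isSpecial_specialVF hc he).exists_eq hV hR hZ
  rw [specialVF_val] at h1
  exact ⟨h1, h2⟩

/-- Here ρ = -(x¹)⁻²(dx¹ ⊗ dx¹ + e dx² ⊗ dx²): up to sign the hyperbolic metric for e = 1 and its
Lorentzian analogue for e = -1. -/
theorem isParallelMetric_normalForm (he : σ * e = -1) :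
    IsParallelMetric (formOf (ricciEps (normalForm σ 0 e) 1))
      (nablaRicciEps (normalForm σ 0 e) 1) := by
  have hr := ricciConst_normalForm (σ := σ) (e := e) (mul_zero σ)
  rw [← ricciEps_one, he] at hr
  have he0 : e ≠ 0 := by rintro rfl; simp at he
  refine ⟨fun v w => ?_, fun v hv => ?_, fun u v w => ?_⟩
  · rw [hr]; simp [formOf]; ring
  · have h0 := hv (Pi.single 0 1)
    have h1 := hv (Pi.single 1 1)
    rw [hr] at h0 h1
    simp [formOf] at h0 h1
    ext k
    fin_cases k
    · simpa using h0
    · have : ¬ (e = 0 ∨ (2 : ℝ) + -1 = 0) := by norm_num [he0]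
      simpa [this] using h1
  · rw [nablaRicciEps, hr]
    simp [formOf, Coeffs.bil_apply, normalForm, Coeffs.mk6, he]
    ring

/-- Each alternative of the obstruction occurs. If c ≠ 0, ρ is not symmetric. If c = σ = 0, ∂₁ spans
ker ρ but ∇ρ does not annihilate it. If c = 0 and σe = -1, ρ is parallel and non-degenerate. -/
theorem obstructsTypeA_normalForm (hc : σ * c = 0) (he : σ * (σ * e + 1) = 0)
    (h : c ≠ 0 ∨ e ≠ 0) :
    ObstructsTypeA (formOf (ricciEps (normalForm σ c e) 1)) (nablaRicciEps (normalForm σ c e) 1) := by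
  have hr := ricciConst_normalForm (e := e) hc
  rw [← ricciEps_one] at hr
  by_cases h0 : c = 0
  · subst h0
    rcases mul_eq_zero.1 he with h1 | h1
    · subst h1
      refine Or.inr (Or.inl ⟨Pi.single 1 1, Pi.single 0 1, Pi.single 1 1, fun x => ?_, ?_⟩)
      · rw [hr]; simp [formOf]
      · rw [nablaRicciEps, hr]
        simp [formOf, Coeffs.bil_apply, normalForm, Coeffs.mk6]
        simpa using h
    · have hp := isParallelMetric_normalForm (σ := σ) (e := e) (by linarith)
      exact Or.inr (Or.inr ⟨hp.parallel, hp.nondegenerate⟩)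
  · refine Or.inl ⟨Pi.single 0 1, Pi.single 1 1, ?_⟩
    rw [hr]
    simp [formOf]
    intro h'
    apply h0
    linarith

/-- For σ = 0 the Ricci tensor is not symmetric if c ≠ 0, and has rank one if c = 0. -/
theorem obstructsTypeC_normalForm (h : c ≠ 0 ∨ e ≠ 0) :
    ObstructsTypeC (formOf (ricciEps (normalForm 0 c e) 1)) := by
  have hr := ricciConst_normalForm (e := e) (zero_mul c)
  rw [← ricciEps_one] at hr
  by_cases h0 : c = 0
  · subst h0
    refine Or.inr ⟨⟨Pi.single 1 1, Pi.single 1 1, ?_⟩, Pi.single 0 1, by simp, fun w => ?_⟩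
    · rw [hr]; simp [formOf]; simpa using h
    · rw [hr]; simp [formOf]
  · refine Or.inl ⟨Pi.single 0 1, Pi.single 1 1, ?_⟩
    rw [hr]
    simp [formOf]
    intro h'
    apply h0
    linarith

end NormalForm

theorem TypeB.LinEquiv.nowhereTypeA {C : Coeffs} {σ c e : ℝ} (h : LinEquiv C (normalForm σ c e))
    (hc : σ * c = 0) (he : σ * (σ * e + 1) = 0) (hce : c ≠ 0 ∨ e ≠ 0) :
    (modelB C).NowhereTypeA := by
  obtain ⟨f, s, t, hs, ht, hr, hn⟩ := h.exists_transport
  exact nowhereTypeA_of_obstructs ((obstructsTypeA_normalForm hc he hce).transport hs ht f hr hn)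

theorem TypeB.LinEquiv.nowhereTypeC {C : Coeffs} {c e : ℝ} (h : LinEquiv C (normalForm 0 c e))
    (hce : c ≠ 0 ∨ e ≠ 0) : (modelB C).NowhereTypeC := by
  obtain ⟨f, s, t, hs, ht, hr, hn⟩ := h.exists_transport
  exact nowhereTypeC_of_obstructs ((obstructsTypeC_normalForm hce).transport hs f hr)

theorem TypeB.LinEquiv.isTypeC {C : Coeffs} {σ e : ℝ} (h : LinEquiv C (normalForm σ 0 e))
    (he : σ * e = -1) : (modelB C).IsTypeC := by
  obtain ⟨f, s, t, hs, ht, hr, hn⟩ := h.exists_transport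
  exact isTypeC_of_isParallelMetric ((isParallelMetric_normalForm he).transport hs ht f hr hn)

/-! ### Ricci tensor and normal forms in dimension four -/

theorem ricciConst_of_vanishing {C : Coeffs} (hV : Vanishing C) (i j : Fin 2) :
    ricciConst C i j = if i = 0 ∧ j = 0 then (1 + C.c 0 0 0 - C.c 0 1 1) * C.c 0 1 1 else 0 := by
  obtain ⟨h1, h2, h3⟩ := hV
  have s0 := C.symm 1 0 0
  have s1 := C.symm 1 0 1
  fin_cases i <;> fin_cases j <;> simp [ricciConst, h1, h2, h3, s0, s1]
  ring

theorem ricciIs_of_vanishing {C : Coeffs} (hV : Vanishing C) :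
    RicciIs C ((1 + C.c 0 0 0 - C.c 0 1 1) * C.c 0 1 1) := by
  intro p hp i j
  rw [ricci_modelB C hp, ricciConst_of_vanishing hV, mul_ite, mul_zero]

theorem ne_zero_of_vanishing_of_not_isFlat {C : Coeffs} (hV : Vanishing C)
    (hF : ¬ (modelB C).IsFlat) : (1 + C.c 0 0 0 - C.c 0 1 1) * C.c 0 1 1 ≠ 0 := by
  intro h
  refine hF ((isFlat_modelB_iff C).2 fun i j => ?_)
  rw [ricciConst_of_vanishing hV, h, ite_self]

theorem dimK_le_three {C : Coeffs} (hV : ¬ Vanishing C) (hF : ¬ (modelB C).IsFlat) :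
    dimK C ≤ 3 := by
  rw [isFlat_modelB_iff] at hF
  rcases killing_structure hV hF with h | ⟨X, hX, h⟩
  · rw [dimK_eq_two h]; norm_num
  · exact (hX.killing_basis h).2.1.le

theorem dimK_eq_four_of_form {C : Coeffs} {r : ℝ} (h : Form1 C r ∨ (∃ a, Form2 C r a) ∨ Form3 C r) :
    Vanishing C ∧ r = (1 + C.c 0 0 0 - C.c 0 1 1) * C.c 0 1 1 ∧ dimK C = 4 := by
  obtain ⟨hV, hr, h0⟩ : Vanishing C ∧ r = (1 + C.c 0 0 0 - C.c 0 1 1) * C.c 0 1 1 ∧ r ≠ 0 := by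
    rcases h with ⟨hV, h1, -, hr, h0⟩ | ⟨a, hV, -, hr, h0, -⟩ | ⟨hV, -, h1, hr, h0⟩
    · exact ⟨hV, by rw [hr]; linear_combination -C.c 0 1 1 * h1, h0⟩
    · exact ⟨hV, hr, h0⟩
    · exact ⟨hV, by rw [hr]; linear_combination -C.c 0 1 1 * h1, h0⟩
  exact ⟨hV, hr, (killingIs_of_vanishing hV (hr ▸ h0)).2⟩

theorem killingIs_form1 {C : Coeffs} {r : ℝ} (h : Form1 C r) : KillingIs C
    {field fun x => ![x 0, -(x 0 * Real.log (x 0))], field fun x => ![0, x 0]} := by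
  obtain ⟨hV, hr, -⟩ := dimK_eq_four_of_form (.inl h)
  obtain ⟨-, h1, h2, -, h0⟩ := h
  have hp : C.c 0 0 0 = 2 * C.c 0 1 1 := by linarith
  convert (killingIs_of_vanishing hV (hr ▸ h0)).1 using 2
  · refine congrArg field (funext fun x => ?_)
    simp [quadMap, particular, hp, h2]
  · congr 1
    refine congrArg field (funext fun x => ?_)
    simp [quadMap, homogeneous, hp]

theorem killingIs_form2 {C : Coeffs} {r a : ℝ} (h : Form2 C r a) : KillingIs C
    {field fun x => ![x 0, 0], field fun x => ![0, x 0 ^ a]} := by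
  obtain ⟨hV, hr, -⟩ := dimK_eq_four_of_form (.inr (.inl ⟨a, h⟩))
  obtain ⟨-, h2, -, h0, ha, ha0⟩ := h
  convert (killingIs_of_vanishing hV (hr ▸ h0)).1 using 2
  · refine congrArg field (funext fun x => ?_)
    simp [quadMap, particular, h2]
  · congr 1
    refine congrArg field (funext fun x => ?_)
    simp [quadMap, homogeneous, ← ha, ha0]

theorem killingIs_form3 {C : Coeffs} {r : ℝ} (h : Form3 C r) : KillingIs C
    {field fun x => ![x 0, 0], field fun x => ![0, Real.log (x 0)]} := by
  obtain ⟨hV, hr, -⟩ := dimK_eq_four_of_form (.inr (.inr h))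
  obtain ⟨-, h2, h1, -, h0⟩ := h
  convert (killingIs_of_vanishing hV (hr ▸ h0)).1 using 2
  · refine congrArg field (funext fun x => ?_)
    simp [quadMap, particular, h2]
  · congr 1
    refine congrArg field (funext fun x => ?_)
    simp [quadMap, homogeneous, h1]

/-- The map x² ↦ u x¹ + v x² keeps C₁₁¹ and C₁₂². The new constant q is related to the old C₁₁² by
vC₁₁² = q - u(C₁₁¹ - 2C₁₂²). -/
theorem linEquiv_of_vanishing {C : Coeffs} (hV : Vanishing C) {q u v : ℝ} (hv : v ≠ 0)
    (h : u * C.c 0 0 0 + v * C.c 0 0 1 = q + 2 * C.c 0 1 1 * u) :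
    LinEquiv C (Coeffs.mk6 (C.c 0 0 0) q 0 (C.c 0 1 1) 0 0) := by
  obtain ⟨h1, h2, h3⟩ := hV
  refine linEquiv_of_bil (u := u) hv fun x y => ?_
  ext k
  fin_cases k
  · simp [ofRows_zero, Coeffs.bil_apply, Coeffs.mk6, h1, h2]
  · simp [ofRows_zero, ofRows_one, Coeffs.bil_apply, Coeffs.mk6, h1, h2, h3]
    linear_combination -x 0 * y 0 * h

/-- A shear removes C₁₁² unless C₁₁¹ = 2C₁₂²; in that case a non-zero C₁₁² can only be scaled, to 1.
The Ricci constant r involves only C₁₁¹ and C₁₂², which do not change. -/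
theorem exists_form_of_vanishing {C : Coeffs} (hV : Vanishing C) {r : ℝ}
    (hr : r = (1 + C.c 0 0 0 - C.c 0 1 1) * C.c 0 1 1) (h0 : r ≠ 0) :
    ∃ C' : Coeffs, LinEquiv C C' ∧ (Form1 C' r ∨ (∃ a, Form2 C' r a) ∨ Form3 C' r) := by
  by_cases h1 : C.c 0 0 0 = 2 * C.c 0 1 1 ∧ C.c 0 0 1 ≠ 0
  · obtain ⟨h1, h2⟩ := h1
    refine ⟨_, linEquiv_of_vanishing hV (q := 1) (u := 0) (inv_ne_zero h2) (by simp [h2]),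
      .inl ⟨⟨rfl, rfl, rfl⟩, ?_, rfl, ?_, h0⟩⟩
    · simp [Coeffs.mk6, h1]
    · simp [Coeffs.mk6, hr, h1]
      left; ring
  · obtain ⟨u, hu⟩ : ∃ u : ℝ, u * C.c 0 0 0 + 1 * C.c 0 0 1 = 0 + 2 * C.c 0 1 1 * u := by
      by_cases h2 : C.c 0 0 0 = 2 * C.c 0 1 1
      · exact ⟨0, by simpa using fun h => h1 ⟨h2, h⟩⟩
      · have := sub_ne_zero.2 h2
        refine ⟨-C.c 0 0 1 / (C.c 0 0 0 - 2 * C.c 0 1 1), ?_⟩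
        field_simp
        ring
    refine ⟨_, linEquiv_of_vanishing hV one_ne_zero hu, .inr ?_⟩
    by_cases h3 : 1 + C.c 0 0 0 - 2 * C.c 0 1 1 = 0
    · refine .inr ⟨⟨rfl, rfl, rfl⟩, rfl, h3, ?_, h0⟩
      simp [Coeffs.mk6, hr]
      linear_combination C.c 0 1 1 * h3
    · exact .inl ⟨_, ⟨rfl, rfl, rfl⟩, rfl, hr, h0, rfl, h3⟩

theorem dimension_four {C : Coeffs} (hF : ¬ (modelB C).IsFlat) (h4 : dimK C = 4) :
    Vanishing C ∧ (modelB C).IsTypeA ∧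
      ∃ r : ℝ, RicciIs C r ∧
      ∃ C' : Coeffs, LinEquiv C C' ∧ RicciIs C' r ∧
        ((Form1 C' r ∧ KillingIs C'
            {field fun x => ![x 0, -(x 0 * Real.log (x 0))], field fun x => ![0, x 0]}) ∨
         (∃ a : ℝ, Form2 C' r a ∧ KillingIs C'
            {field fun x => ![x 0, 0], field fun x => ![0, x 0 ^ a]}) ∨
         (Form3 C' r ∧ KillingIs C'
            {field fun x => ![x 0, 0], field fun x => ![0, Real.log (x 0)]})) := by
  have hV : Vanishing C := by
    by_contra hV
    have := dimK_le_three hV hF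
    omega
  refine ⟨hV, isTypeA_of_vanishing hV hF, _, ricciIs_of_vanishing hV, ?_⟩
  obtain ⟨C', hC', h⟩ := exists_form_of_vanishing hV rfl
    (ne_zero_of_vanishing_of_not_isFlat hV hF)
  obtain ⟨hV', hr, -⟩ := dimK_eq_four_of_form h
  refine ⟨C', hC', by rw [hr]; exact ricciIs_of_vanishing hV', ?_⟩
  rcases h with h | ⟨a, h⟩ | h
  · exact .inl ⟨h, killingIs_form1 h⟩
  · exact .inr (.inl ⟨a, h, killingIs_form2 h⟩)
  · exact .inr (.inr ⟨h, killingIs_form3 h⟩)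

/-! ### The classification in dimension three and the theorem -/

theorem IsSpecial.exists_normalForm {C : Coeffs} (hV : ¬ Vanishing C)
    {X : smoothVF (modelB C).U} (hX : IsSpecial X) :
    (∃ e, (e = -1 / 2 ∨ e = 1 / 2) ∧ LinEquiv C (normalForm 0 0 e)) ∨
      (∃ e, LinEquiv C (normalForm 0 1 e)) ∨ LinEquiv C (normalForm 1 0 (-1)) ∨
      LinEquiv C (normalForm (-1) 0 1) := by
  obtain ⟨h1, h2, h3, h4, h5, h6⟩ := hX.coeff_eqs
  have u1 := special_shear_eq_zero h1 h2 h3 h4 h5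
  have u2 := special_scale_eq_zero h1 h2 h3 h4 h5 h6
  have key := fun v hv => hX.linEquiv_normalForm (v := v) hv
  set s := jv X 1 + jv X 0 ^ 2 / 4
  set t := C.c 0 1 0 - jv X 0 / 2 * C.c 1 1 0 with ht
  -- If s = 0, a non-zero t is scaled to 1 and C₂₂¹ remains as the parameter of 𝒩₂. If also t = 0,
  -- then C₂₂¹ ≠ 0 by `hV`; as it is divided by v², it can be scaled to ±1/2 and its sign is kept.
  by_cases hs : s = 0
  · simp only [hs, mul_zero] at key
    by_cases ht0 : t = 0
    · simp only [ht0, zero_div] at key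
      left
      have he : C.c 1 1 0 ≠ 0 := fun he => by
        rw [he, mul_zero, sub_zero] at ht
        rw [he, ← ht, ht0] at h1
        exact hV ⟨by rw [← ht, ht0], he, by linarith⟩
      rcases lt_or_gt_of_ne he with hl | hl
      · refine ⟨-1 / 2, .inl rfl, ?_⟩
        have h := key (√(-2 * C.c 1 1 0)) (Real.sqrt_ne_zero'.2 (by linarith))
        rw [Real.sq_sqrt (by linarith)] at h
        convert h using 2
        field_simp
      · refine ⟨1 / 2, .inr rfl, ?_⟩
        have h := key (√(2 * C.c 1 1 0)) (Real.sqrt_ne_zero'.2 (by linarith))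
        rw [Real.sq_sqrt (by linarith)] at h
        convert h using 2
        field_simp
    · refine .inr (.inl ⟨C.c 1 1 0 / t ^ 2, ?_⟩)
      have h := key t ht0
      rwa [div_self ht0] at h
  -- If s ≠ 0, then t = 0 and C₂₂¹ = -1/s, so v = |s|^(-1/2) brings s to its sign.
  · have e1 := (mul_eq_zero.1 u1).resolve_left hs
    have e2 := (mul_eq_zero.1 u2).resolve_left hs
    have he : C.c 1 1 0 = -1 / s := by rw [eq_div_iff hs]; linarith
    simp only [e1, zero_div, he] at key
    rcases lt_or_gt_of_ne hs with hl | hl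
    · refine .inr (.inr (.inr ?_))
      have h := key (√(-s))⁻¹ (inv_ne_zero (Real.sqrt_ne_zero'.2 (by linarith)))
      rw [inv_pow, Real.sq_sqrt (by linarith)] at h
      convert h using 2 <;> field_simp
    · refine .inr (.inr (.inl ?_))
      have h := key (√s)⁻¹ (inv_ne_zero (Real.sqrt_ne_zero'.2 (by linarith)))
      rw [inv_pow, Real.sq_sqrt (by linarith)] at h
      convert h using 2 <;> field_simp

theorem dimension_three {C : Coeffs} (hF : ¬ (modelB C).IsFlat) (h3 : dimK C = 3) :
    Nonempty ((modelB C).killing ≃ₗ⁅ℝ⁆ su11) ∧ (modelB C).NowhereTypeA ∧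
      ∃ C' : Coeffs, LinEquiv C C' ∧
        (((C' = N1plus ∨ C' = N1minus) ∧ KillingIs C' {Xfield 0} ∧ (modelB C).NowhereTypeC) ∨
         ((∃ c : ℝ, C' = N2 c) ∧ KillingIs C' {Xfield 0} ∧ (modelB C).NowhereTypeC) ∨
         (C' = N3 ∧ KillingIs C' {Xfield 1} ∧ (modelB C).IsTypeC) ∨
         (C' = N4 ∧ KillingIs C' {Xfield (-1)} ∧ (modelB C).IsTypeC)) := by
  have hV : ¬ Vanishing C := fun hV => by
    have := (killingIs_of_vanishing hV (ne_zero_of_vanishing_of_not_isFlat hV hF)).2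
    omega
  rcases killing_structure hV (mt (isFlat_modelB_iff C).2 hF) with h | ⟨X, hX, h⟩
  · have := dimK_eq_two h
    omega
  obtain ⟨-, -, B, b0, b1, b2⟩ := hX.killing_basis h
  refine ⟨hX.nonempty_lieEquiv b0 b1 b2, ?_⟩
  rcases hX.exists_normalForm hV with ⟨e, he, h⟩ | ⟨e, h⟩ | h | h
  · have he0 : (0 : ℝ) ≠ 0 ∨ e ≠ 0 := .inr (by rcases he with rfl | rfl <;> norm_num)
    refine ⟨h.nowhereTypeA (by simp) (by simp) he0, _, h, .inl ⟨?_,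
      (killingIs_normalForm (by simp) (by simp) he0).1, h.nowhereTypeC he0⟩⟩
    rw [N1plus_eq, N1minus_eq]
    exact he.imp (congrArg _) (congrArg _)
  · have he0 : (1 : ℝ) ≠ 0 ∨ e ≠ 0 := .inl one_ne_zero
    exact ⟨h.nowhereTypeA (by simp) (by simp) he0, _, h, .inr (.inl ⟨⟨e, (N2_eq e).symm⟩,
      (killingIs_normalForm (by simp) (by simp) he0).1, h.nowhereTypeC he0⟩)⟩
  · have he0 : (0 : ℝ) ≠ 0 ∨ (-1 : ℝ) ≠ 0 := .inr (by norm_num)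
    exact ⟨h.nowhereTypeA (by simp) (by simp) he0, _, h, .inr (.inr (.inl ⟨N3_eq.symm,
      (killingIs_normalForm (by simp) (by simp) he0).1, h.isTypeC (by simp)⟩))⟩
  · have he0 : (0 : ℝ) ≠ 0 ∨ (1 : ℝ) ≠ 0 := .inr (by norm_num)
    exact ⟨h.nowhereTypeA (by simp) (by simp) he0, _, h, .inr (.inr (.inr ⟨N4_eq.symm,
      (killingIs_normalForm (by simp) (by simp) he0).1, h.isTypeC (by simp)⟩))⟩

theorem theorem3p11 :
    -- `M = (ℝ⁺ × ℝ, (x¹)⁻¹ C)` is an arbitrary non-flat surface of the family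
    (∀ C : Coeffs, ¬ (modelB C).IsFlat →
      (2 ≤ dimK C ∧ dimK C ≤ 4) ∧
      -- dimension four
      (dimK C = 4 →
        Vanishing C ∧ (modelB C).IsTypeA ∧
        ∃ r : ℝ, RicciIs C r ∧
        ∃ C' : Coeffs, LinEquiv C C' ∧ RicciIs C' r ∧
          ((Form1 C' r ∧ KillingIs C'
              {field fun x => ![x 0, -(x 0 * Real.log (x 0))], field fun x => ![0, x 0]}) ∨
           (∃ a : ℝ, Form2 C' r a ∧ KillingIs C'
              {field fun x => ![x 0, 0], field fun x => ![0, x 0 ^ a]}) ∨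
           (Form3 C' r ∧ KillingIs C'
              {field fun x => ![x 0, 0], field fun x => ![0, Real.log (x 0)]}))) ∧
      -- dimension three
      (dimK C = 3 →
        Nonempty ((modelB C).killing ≃ₗ⁅ℝ⁆ su11) ∧ (modelB C).NowhereTypeA ∧
        ∃ C' : Coeffs, LinEquiv C C' ∧
          (((C' = N1plus ∨ C' = N1minus) ∧ KillingIs C' {Xfield 0} ∧ (modelB C).NowhereTypeC) ∨
           ((∃ c : ℝ, C' = N2 c) ∧ KillingIs C' {Xfield 0} ∧ (modelB C).NowhereTypeC) ∨
           (C' = N3 ∧ KillingIs C' {Xfield 1} ∧ (modelB C).IsTypeC) ∨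
           (C' = N4 ∧ KillingIs C' {Xfield (-1)} ∧ (modelB C).IsTypeC)))) ∧
    -- every structure on the two lists occurs, with the stated dimension
    (∀ (C : Coeffs) (r : ℝ), (Form1 C r ∨ (∃ a, Form2 C r a) ∨ Form3 C r) → dimK C = 4) ∧
    (dimK N1plus = 3 ∧ (modelB N1plus).NowhereTypeC) ∧
    (dimK N1minus = 3 ∧ (modelB N1minus).NowhereTypeC) ∧
    (∀ c : ℝ, dimK (N2 c) = 3 ∧ (modelB (N2 c)).NowhereTypeC) ∧
    (dimK N3 = 3 ∧ (modelB N3).IsTypeC) ∧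
    (dimK N4 = 3 ∧ (modelB N4).IsTypeC) := by
  refine ⟨fun C hF => ⟨⟨two_le_dimK C, ?_⟩, dimension_four hF, dimension_three hF⟩,
    fun C r h => (dimK_eq_four_of_form h).2.2, ⟨?_, ?_⟩, ⟨?_, ?_⟩, fun c => ⟨?_, ?_⟩, ⟨?_, ?_⟩,
    ⟨?_, ?_⟩⟩
  · by_cases hV : Vanishing C
    · exact (killingIs_of_vanishing hV (ne_zero_of_vanishing_of_not_isFlat hV hF)).2.le
    · exact (dimK_le_three hV hF).trans (by norm_num)
  · rw [N1plus_eq]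
    exact (killingIs_normalForm (by simp) (by simp) (.inr (by norm_num))).2
  · rw [N1plus_eq]
    exact nowhereTypeC_of_obstructs (obstructsTypeC_normalForm (.inr (by norm_num)))
  · rw [N1minus_eq]
    exact (killingIs_normalForm (by simp) (by simp) (.inr (by norm_num))).2
  · rw [N1minus_eq]
    exact nowhereTypeC_of_obstructs (obstructsTypeC_normalForm (.inr (by norm_num)))
  · rw [N2_eq]
    exact (killingIs_normalForm (by simp) (by simp) (.inl one_ne_zero)).2
  · rw [N2_eq]
    exact nowhereTypeC_of_obstructs (obstructsTypeC_normalForm (.inl one_ne_zero))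
  · rw [N3_eq]
    exact (killingIs_normalForm (by simp) (by simp) (.inr (by norm_num))).2
  · rw [N3_eq]
    exact isTypeC_of_isParallelMetric (isParallelMetric_normalForm (by simp))
  · rw [N4_eq]
    exact (killingIs_normalForm (by simp) (by simp) (.inr (by norm_num))).2
  · rw [N4_eq]
    exact isTypeC_of_isParallelMetric (isParallelMetric_normalForm (by simp))
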